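/- Let $n \ge 0$. An $n$-partition of type $B$ is a partition $\pi$ of the $2n$-element set $\{+1,\dots,+n,-1,\dots,-n\}$ into blocks such that $-K$ is a block for every block $K$, and such that there is at most one zero block, that is, a block $K$ with $K=-K$. Let $\mathrm{nzbk}(\pi)$ be half the number of non-zero blocks of $\pi$. Place $+1,+2,\dots,+n,-1,-2,\dots,-n$ in this order around a circle, and order the labels as $+1<\cdots<+n<-1<\cdots<-n$; join $i<j$ by a chord if they lie in the same block and no $k$ with $i<k<j$ lies in that block. The partition $\pi$ is non-crossing if no two of these chords cross. Let $\mathcal P^B_n$ be the set of non-crossing $n$-partitions of type $B$. For $\pi,\pi'\in\mathcal P^B_n$ let $\pi\vee\pi'$ be the finest $n$-partition of type $B$ (not necessarily non-crossing) that is coarser than both, and let $$J^B_n(x)=\left(x^{\mathrm{nzbk}(\pi\vee\pi')}\right)_{\pi,\pi'\in\mathcal P^B_n}$$ be the matrix of chromatic joins of type $B$. Then $$\det J^B_n(\delta^2)=\prod_{i=1}^n\left(T_i(\delta)^2-1\right)^{\binom{2n}{n-i}},$$ where $T_i$ is the Chebyshev polynomial of the first kind normalized by $T_0=2$, $T_1=\delta$,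 $T_i=\delta T_{i-1}-T_{i-2}$. The identity holds as an identity of polynomials with integer coefficients in $\delta$, equivalently for every element $\delta$ of every commutative ring. -/

import Mathlib

namespace TypeB

/-- The position `p : Fin (2 * n)` carries the label `+(p + 1)` if `p < n` and `-(p - n + 1)` if
`n ≤ p`, so that the order of `Fin (2 * n)` is the order `+1 < ⋯ < +n < -1 < ⋯ < -n` of the labels
around the circle. `opp` changes the sign of a label. -/
def opp {n : ℕ} (p : Fin (2 * n)) : Fin (2 * n) :=
  if h : p.val < n then ⟨p.val + n, by omega⟩ else ⟨p.val - n, by omega⟩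

/-- `K` is a zero block of `π`: a block with `-K = K`. -/
def IsZeroBlock {n : ℕ} (π : Setoid (Fin (2 * n))) (K : Set (Fin (2 * n))) : Prop :=
  K ∈ π.classes ∧ opp '' K = K

/-- `n`-partitions of type `B`: `-K` is a block for every block `K`, and there is at most one zero
block. Partitions are given as equivalence relations; the blocks are the classes. -/
structure IsPartition {n : ℕ} (π : Setoid (Fin (2 * n))) : Prop where
  opp_mem : ∀ K ∈ π.classes, opp '' K ∈ π.classes
  zero_unique : ∀ K L, IsZeroBlock π K → IsZeroBlock π L → K = L

/-- There is a connection chord between `i` and `j`, where `i < j`: they are consecutive elements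
of a block. -/
def IsChord {n : ℕ} (π : Setoid (Fin (2 * n))) (i j : Fin (2 * n)) : Prop :=
  i < j ∧ π i j ∧ ∀ k, i < k → k < j → ¬ π i k

/-- No two connection chords cross, i.e. the end points of two chords never interleave on the
circle. -/
def IsNonCrossing {n : ℕ} (π : Setoid (Fin (2 * n))) : Prop :=
  ∀ i k j l, i < k → k < j → j < l → ¬ (IsChord π i j ∧ IsChord π k l)

/-- The set of non-crossing `n`-partitions of type `B`. -/
def NCPartition (n : ℕ) : Type :=
  {π : Setoid (Fin (2 * n)) // IsPartition π ∧ IsNonCrossing π}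

noncomputable instance (n : ℕ) : Fintype (NCPartition n) :=
  letI : Finite (Setoid (Fin (2 * n))) :=
    Finite.of_injective (fun s : Setoid (Fin (2 * n)) => (s : Fin (2 * n) → Fin (2 * n) → Prop))
      (fun _ _ h => Setoid.ext fun a b => iff_of_eq (congrFun (congrFun h a) b))
  letI : Finite (NCPartition n) := Subtype.finite
  Fintype.ofFinite _

noncomputable instance (n : ℕ) : DecidableEq (NCPartition n) := Classical.decEq _

/-- Half of the number of non-zero blocks. -/
noncomputable def nzbk {n : ℕ} (π : Setoid (Fin (2 * n))) : ℕ :=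
  {K | K ∈ π.classes ∧ ¬ IsZeroBlock π K}.ncard / 2

/-- The finest `n`-partition of type `B`, not necessarily non-crossing, that is coarser than both
`π` and `π'` (in the order on `Setoid`, larger means coarser). -/
def join {n : ℕ} (π π' : Setoid (Fin (2 * n))) : Setoid (Fin (2 * n)) :=
  sInf {σ | IsPartition σ ∧ π ≤ σ ∧ π' ≤ σ}

theorem opp_opp {n : ℕ} (p : Fin (2 * n)) : opp (opp p) = p := by
  have hp := p.isLt
  by_cases h : p.val < n
  · have h' : ¬ (p.val + n < n) := by omega
    simp [opp, h]
  · have h' : p.val - n < n := by omega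
    ext
    simp [opp, h, h']
    omega

theorem mem_opp_image {n : ℕ} (K : Set (Fin (2 * n))) (x : Fin (2 * n)) :
    x ∈ opp '' K ↔ opp x ∈ K :=
  ⟨fun ⟨y, hy, h⟩ => by rw [← h, opp_opp]; exact hy, fun h => ⟨opp x, h, opp_opp x⟩⟩

/-- The conditions on a partition of type `B` in terms of the equivalence relation. -/
theorem isPartition_iff {n : ℕ} (π : Setoid (Fin (2 * n))) :
    IsPartition π ↔ (∀ x y, π x y → π (opp x) (opp y)) ∧
      ∀ x y, π x (opp x) → π y (opp y) → π x y := by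
  have key (h : ∀ x y, π x y → π (opp x) (opp y)) (x : Fin (2 * n)) :
      opp '' {z | π z x} = {z | π z (opp x)} := by
    ext z
    rw [mem_opp_image]
    refine ⟨fun hz => ?_, fun hz => ?_⟩
    · have := h _ _ hz
      rwa [opp_opp] at this
    · have := h _ _ hz
      rwa [opp_opp] at this
  constructor
  · intro hπ
    have h1 : ∀ x y, π x y → π (opp x) (opp y) := by
      intro x y h
      obtain ⟨w, hw⟩ := hπ.opp_mem _ (π.mem_classes y)
      have hx : opp x ∈ opp '' {z | π z y} := ⟨x, h, rfl⟩
      have hy : opp y ∈ opp '' {z | π z y} := ⟨y, π.refl y, rfl⟩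
      rw [hw] at hx hy
      exact π.trans hx (π.symm hy)
    refine ⟨h1, fun x y hx hy => ?_⟩
    have hz : ∀ x, π x (opp x) → IsZeroBlock π {z | π z x} := fun x hx =>
      ⟨π.mem_classes x, by
        rw [key h1]
        ext z
        exact ⟨fun h => π.trans h (π.symm hx), fun h => π.trans h hx⟩⟩
    have := hπ.zero_unique _ _ (hz x hx) (hz y hy)
    have hx' : x ∈ {z | π z x} := π.refl x
    rw [this] at hx'
    exact hx'
  · rintro ⟨h1, h2⟩
    refine ⟨?_, ?_⟩
    · rintro K ⟨x, rfl⟩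
      exact ⟨opp x, key h1 x⟩
    · rintro K L ⟨⟨x, rfl⟩, hK⟩ ⟨⟨y, rfl⟩, hL⟩
      rw [key h1] at hK hL
      have hx : x ∈ {z | π z x} := π.refl x
      have hy : y ∈ {z | π z y} := π.refl y
      rw [← hK] at hx
      rw [← hL] at hy
      have hxy := h2 x y hx hy
      ext z
      exact ⟨fun h => π.trans h hxy, fun h => π.trans h (π.symm hxy)⟩

/-- The join is itself of type `B`, and it is the finest one. -/
theorem join_isLeast {n : ℕ} (π π' : Setoid (Fin (2 * n))) :
    IsLeast {σ | IsPartition σ ∧ π ≤ σ ∧ π' ≤ σ} (join π π') := by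
  refine ⟨⟨?_, ?_, ?_⟩, fun σ h => sInf_le h⟩
  · rw [isPartition_iff]
    constructor
    · intro x y h σ hσ
      exact ((isPartition_iff σ).1 hσ.1).1 x y (h σ hσ)
    · intro x y h h' σ hσ
      exact ((isPartition_iff σ).1 hσ.1).2 x y (h σ hσ) (h' σ hσ)
  · exact le_sInf fun σ h => h.2.1
  · exact le_sInf fun σ h => h.2.2

/-- The matrix of chromatic joins of type `B`. -/
noncomputable def chromaticJoins (n : ℕ) {R : Type*} [CommRing R] (x : R) :
    Matrix (NCPartition n) (NCPartition n) R :=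
  fun π π' => x ^ nzbk (join π.1 π'.1)

end TypeB

/-! A non-crossing partition of type B is encoded by a `±1` path of period `2n`. The site `x` of the
circle is the vertex `2x + 1`, and two sites share a block when their vertices have the same height
and the path stays weakly above that height between them (`partitionOf`). Shifting the path by one
period shifts the sites by `n`, which is the change of sign, so the symmetry is built in. Matching
up steps with down steps turns the path into a planar matching of `2n` points in an annulus.

Every vertex `k` carries a Temperley-Lieb generator. On paths it is `Step`, which makes `k` a peak.
On partitions it isolates a site and its negative if `k` is odd, and merges two neighbouring sites,
together with their negatives, if `k` is even. On functions of `2n` spins it is `contract`. The spin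
vector of a path is a product over its arcs, and `contract` permutes these vectors as `Step`
permutes paths, up to a factor `δ = q + q⁻¹` for a closed loop; a loop around the annulus has weight
`lam + lam⁻¹ = 1`. The generators are adjoint for the pairing of spin vectors (`sum_contract`). The
same adjointness holds for `nzbk` of joins, because `nzbk` is the dimension of a space of odd
functions and joins become intersections (`oddInv_join`, `nzbk_join_isolate`). Hence a generator can
be carried from one argument to the other on both sides (`gramIdentity_iff`), which reduces
everything to zigzag paths. The result `gramIdentity` says that the matrix of chromatic joins is the
Gram matrix of the spin vectors, up to diagonal factors.

The Gram matrix is a product of a spin matrix for `lam` and a transposed one for `lam⁻¹`. Modulo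
vectors with more arcs, exchanging neighbouring opposite spins costs `-q`. Straightening with this
rule expresses the vector of a word with `r` arcs across the end of the word through standard
vectors, with leading coefficient `∏ (lam - lam⁻¹ q^(2j))` over `1 ≤ j ≤ r` (`mkQ_wrapProd`). The
standard vectors form a unitriangular matrix (`det_stdVec`), so the determinant is the product of
these coefficients (`det_wrapVec`). Multiplying by the factors for `lam⁻¹` gives `1 + q^(2j) +
q^(4j) = q^(2j) (T_j² - 1)`, and the ballot count `card_unmatched` gives `C(2n, n - j)` words with
`r ≥ j`.

The powers of `δ` and `q` cancel by `sum_card_oddDowns` and `sum_choose`. Every non-crossing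
partition comes from a path (`isRealized`); distinct words give distinct partitions because the
determinant just computed does not vanish at `q = 2`. Nonzero complex `δ` suffice to prove the
identity of integer polynomials. -/

namespace TypeB

/-! ### Periodic lattice paths and their arcs -/

/-- A `2n`-periodic lattice path with steps `±1`. -/
structure IsPath (n : ℕ) (h : ℤ → ℤ) : Prop where
  step : ∀ x, h (x + 1) = h x + 1 ∨ h (x + 1) = h x - 1
  period : ∀ x, h (x + 2 * n) = h x

/-- The vertices `a` and `b` have the same height, and the path stays weakly above them in
between. -/
def Rel (h : ℤ → ℤ) (a b : ℤ) : Prop :=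
  h a = h b ∧ ∀ x, (a ≤ x ∧ x ≤ b ∨ b ≤ x ∧ x ≤ a) → h a ≤ h x

/-- The up step at `a` is matched with the down step at `b`. -/
def IsArc (h : ℤ → ℤ) (a b : ℤ) : Prop :=
  a < b ∧ h (b + 1) = h a ∧ ∀ x, a < x → x ≤ b → h a < h x

/-- The vertex `k` is a strict local maximum of the path. -/
def IsPeak (h : ℤ → ℤ) (k : ℤ) : Prop := h (k - 1) = h k - 1 ∧ h (k + 1) = h k - 1

variable {n : ℕ} {h : ℤ → ℤ}

lemma Rel.refl (h : ℤ → ℤ) (a : ℤ) : Rel h a a :=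
  ⟨rfl, fun x hx => by rw [show x = a by omega]⟩

lemma Rel.symm {a b : ℤ} (H : Rel h a b) : Rel h b a :=
  ⟨H.1.symm, fun x hx => H.1 ▸ H.2 x hx.symm⟩

lemma Rel.trans {a b c : ℤ} (H : Rel h a b) (H' : Rel h b c) : Rel h a c := by
  refine ⟨H.1.trans H'.1, fun x hx => ?_⟩
  by_cases h1 : a ≤ x ∧ x ≤ b ∨ b ≤ x ∧ x ≤ a
  · exact H.2 x h1
  · rw [H.1]
    exact H'.2 x (by omega)

lemma IsPath.period_dvd (hh : IsPath n h) {T : ℤ} (hT : (2 * n : ℤ) ∣ T) (x : ℤ) :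
    h (x + T) = h x := by
  obtain ⟨t, rfl⟩ := hT
  have key : ∀ m : ℕ, ∀ x, h (x + 2 * n * m) = h x := by
    intro m
    induction m with
    | zero => intro x; simp
    | succ m ih =>
      intro x
      rw [show x + 2 * n * ((m + 1 : ℕ) : ℤ) = (x + 2 * n) + 2 * n * m by push_cast; ring, ih,
        hh.period]
  obtain ⟨m, rfl | rfl⟩ := t.eq_nat_or_neg
  · exact key m x
  · rw [← key m (x + _)]
    congr 1
    ring

/-- Every step changes both height and position by one. In particular `Rel` only relates vertices of
the same parity, so even and odd vertices can be treated separately. -/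
lemma IsPath.parity (hh : IsPath n h) (x y : ℤ) : (h x - h y - (x - y)) % 2 = 0 := by
  have key : ∀ m : ℕ, ∀ x, (h (x + m) - h x - m) % 2 = 0 := by
    intro m
    induction m with
    | zero => intro x; simp
    | succ m ih =>
      intro x
      have := ih x
      have := hh.step (x + m)
      push_cast
      rw [← add_assoc]
      omega
  rcases le_total y x with hxy | hxy
  · have := key (x - y).toNat y
    rw [Int.toNat_of_nonneg (by omega), show y + (x - y) = x by ring] at this
    omega
  · have := key (y - x).toNat x
    rw [Int.toNat_of_nonneg (by omega), show x + (y - x) = y by ring] at this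
    omega

lemma IsPath.reflect (hh : IsPath n h) : IsPath n (fun x => h (-x)) := by
  refine ⟨fun x => ?_, fun x => ?_⟩
  · have := hh.step (-(x + 1))
    rw [show -(x + 1) + 1 = -x by ring] at this
    omega
  · rw [← hh.period (-(x + 2 * n))]
    congr 1
    ring

/-- The reflection sends the vertex `x` to `-x`, but the step from `x` to `x + 1` to the one that
starts at `-1 - x`; arcs are labelled by steps. -/
lemma IsArc.of_reflect {a b : ℤ} (H : IsArc (fun x => h (-x)) a b) :
    IsArc h (-1 - b) (-1 - a) := by
  obtain ⟨h1, h2, h3⟩ := H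
  simp only at h2 h3
  refine ⟨by omega, ?_, fun x hx hx' => ?_⟩
  · rw [show -1 - a + 1 = -a by ring, show -1 - b = -(b + 1) by ring, h2]
  · have := h3 (-x) (by omega) (by omega)
    rw [neg_neg] at this
    rwa [show -1 - b = -(b + 1) by ring, h2]

/-- The partner is the step that first brings the path back to its starting level. Periodicity
forces this to happen within one period. -/
lemma IsPath.exists_arc_of_up (hh : IsPath n h) (hn : 0 < n) {a : ℤ} (ha : h (a + 1) = h a + 1) :
    ∃ b, IsArc h a b ∧ b < a + 2 * n := by
  classical
  have hex : ∃ m : ℕ, h (a + 1 + m) ≤ h a := by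
    refine ⟨2 * n - 1, le_of_eq ?_⟩
    rw [← hh.period a]
    congr 1
    omega
  obtain ⟨h1, h2⟩ := And.intro (Nat.find_spec hex) (fun m => Nat.find_min hex (m := m))
  have h3 : Nat.find hex ≤ 2 * n - 1 := by
    apply Nat.find_le
    refine le_of_eq ?_
    rw [← hh.period a]
    congr 1
    omega
  generalize Nat.find hex = m at *
  have hm : m ≠ 0 := by rintro rfl; simp [ha] at h1
  have h4 : ∀ x, a < x → x ≤ a + m → h a < h x := by
    intro x hx hx'
    have := h2 (x - a - 1).toNat (by omega)
    rw [Int.toNat_of_nonneg (by omega)] at this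
    rw [show a + 1 + (x - a - 1) = x by ring] at this
    omega
  refine ⟨a + m, ⟨by omega, ?_, h4⟩, by omega⟩
  have := h4 (a + m) (by omega) le_rfl
  have := hh.step (a + m)
  rw [show a + m + 1 = a + 1 + m by ring] at *
  omega

lemma IsPath.exists_arc_of_down (hh : IsPath n h) (hn : 0 < n) {b : ℤ}
    (hb : h (b + 1) = h b - 1) : ∃ a, IsArc h a b ∧ b < a + 2 * n := by
  obtain ⟨c, hc, hc'⟩ := hh.reflect.exists_arc_of_up hn (a := -1 - b) (by
    rw [show -(-1 - b + 1) = b by ring, show -(-1 - b) = b + 1 by ring, hb]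
    ring)
  refine ⟨-1 - c, ?_, by omega⟩
  have := hc.of_reflect
  rwa [show -1 - (-1 - b) = b by ring] at this

lemma IsArc.up (hh : IsPath n h) {a b : ℤ} (H : IsArc h a b) : h (a + 1) = h a + 1 := by
  have := H.2.2 (a + 1) (by omega) (by have := H.1; omega)
  have := hh.step a
  omega

lemma IsArc.down (hh : IsPath n h) {a b : ℤ} (H : IsArc h a b) : h b = h a + 1 := by
  have := H.2.2 b H.1 le_rfl
  have := hh.step b
  have := H.2.1
  omega

lemma IsArc.shift (hh : IsPath n h) {a b T : ℤ} (hT : (2 * n : ℤ) ∣ T) (H : IsArc h a b) :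
    IsArc h (a + T) (b + T) := by
  refine ⟨by have := H.1; omega, ?_, fun x hx hx' => ?_⟩
  · rw [show b + T + 1 = b + 1 + T by ring, hh.period_dvd hT, hh.period_dvd hT, H.2.1]
  · rw [hh.period_dvd hT, ← hh.period_dvd ((dvd_neg).2 hT) x]
    exact H.2.2 _ (by omega) (by omega)

lemma IsArc.right_unique {a b b' : ℤ} (H : IsArc h a b) (H' : IsArc h a b') : b = b' := by
  rcases lt_trichotomy b b' with hb | hb | hb
  · have := H'.2.2 (b + 1) (by have := H.1; omega) (by omega)
    have := H.2.1
    omega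
  · exact hb
  · have := H.2.2 (b' + 1) (by have := H'.1; omega) (by omega)
    have := H'.2.1
    omega

lemma IsArc.left_unique {a a' b : ℤ} (H : IsArc h a b) (H' : IsArc h a' b) : a = a' := by
  rcases lt_trichotomy a a' with hb | hb | hb
  · have := H.2.2 a' hb (by have := H'.1; omega)
    have := H.2.1
    have := H'.2.1
    omega
  · exact hb
  · have := H'.2.2 a hb (by have := H.1; omega)
    have := H.2.1
    have := H'.2.1
    omega

lemma IsArc.lt_add (hh : IsPath n h) (hn : 0 < n) {a b : ℤ} (H : IsArc h a b) :
    b < a + 2 * n := by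
  obtain ⟨b', hb', hlt⟩ := hh.exists_arc_of_up hn (H.up hh)
  rwa [H.right_unique hb']

lemma not_dvd_of_abs_lt {x : ℤ} (h0 : x ≠ 0) (h1 : -(2 * n : ℤ) < x)
    (h2 : x < 2 * n) : ¬ (2 * n : ℤ) ∣ x := by
  intro hd
  exact h0 (Int.eq_zero_of_abs_lt_dvd hd (abs_lt.2 ⟨h1, h2⟩))

lemma even_of_dvd {T : ℤ} (hT : (2 * n : ℤ) ∣ T) : T % 2 = 0 := by
  obtain ⟨t, rfl⟩ := hT
  rw [mul_assoc]
  omega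

lemma IsPath.apply_of_dvd (hh : IsPath n h) {x k : ℤ} (hx : (2 * n : ℤ) ∣ x - k) : h x = h k := by
  rw [← hh.period_dvd hx k]; congr 1; ring

/-! ### Raising a valley -/

open Classical in
/-- Raise the height of the vertex `k` and its translates by `2`. -/
noncomputable def raise (n : ℕ) (h : ℤ → ℤ) (k : ℤ) : ℤ → ℤ :=
  fun x => if (2 * n : ℤ) ∣ x - k then h x + 2 else h x

lemma raise_of_dvd {k x : ℤ} (hx : (2 * n : ℤ) ∣ x - k) : raise n h k x = h x + 2 := if_pos hx

lemma raise_of_not_dvd {k x : ℤ} (hx : ¬ (2 * n : ℤ) ∣ x - k) : raise n h k x = h x := if_neg hx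

lemma raise_of_odd {k x : ℤ} (hx : (x - k) % 2 = 1) : raise n h k x = h x :=
  raise_of_not_dvd fun h => by have := even_of_dvd h; omega

lemma le_raise (k x : ℤ) : h x ≤ raise n h k x := by
  by_cases hx : (2 * n : ℤ) ∣ x - k
  · rw [raise_of_dvd hx]; omega
  · rw [raise_of_not_dvd hx]

/-- The vertex `k` is a strict local minimum of the path. -/
def IsValley (h : ℤ → ℤ) (k : ℤ) : Prop := h (k - 1) = h k + 1 ∧ h (k + 1) = h k + 1

section Raise

variable {k : ℤ}

lemma IsValley.of_dvd (hh : IsPath n h) (hk : IsValley h k) {x : ℤ} (hx : (2 * n : ℤ) ∣ x - k) :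
    IsValley h x := by
  have e1 := hh.apply_of_dvd hx
  have e2 := hh.apply_of_dvd (x := x + 1) (k := k + 1) (by rwa [add_sub_add_right_eq_sub])
  have e3 := hh.apply_of_dvd (x := x - 1) (k := k - 1) (by rwa [sub_sub_sub_cancel_right])
  rw [IsValley, e1, e2, e3]
  exact hk

lemma isPath_raise (hh : IsPath n h) (hk : IsValley h k) : IsPath n (raise n h k) := by
  refine ⟨fun x => ?_, fun x => ?_⟩
  · by_cases h1 : (2 * n : ℤ) ∣ x - k
    · have h2 := even_of_dvd h1
      rw [raise_of_dvd h1, raise_of_odd (x := x + 1) (by omega)]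
      have := hk.of_dvd hh h1
      have := this.2
      omega
    · by_cases h2 : (2 * n : ℤ) ∣ x + 1 - k
      · rw [raise_of_dvd h2, raise_of_not_dvd h1]
        have := (hk.of_dvd hh h2).1
        rw [add_sub_cancel_right] at this
        omega
      · rw [raise_of_not_dvd h2, raise_of_not_dvd h1]
        exact hh.step x
  · have : (2 * n : ℤ) ∣ x + 2 * n - k ↔ (2 * n : ℤ) ∣ x - k := by
      rw [show x + 2 * n - k = (x - k) + 2 * n by ring]
      exact dvd_add_self_right
    by_cases h1 : (2 * n : ℤ) ∣ x - k
    · rw [raise_of_dvd h1, raise_of_dvd (this.2 h1), hh.period]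
    · rw [raise_of_not_dvd h1, raise_of_not_dvd (fun h => h1 (this.1 h)), hh.period]

/-- Only translates of `k` change height. If one of them lies between `x` and `y`, its neighbour is
one higher than the old valley and at least as high as `x`; by parity the valley was not below `x`
either. -/
lemma rel_raise_iff_of_even (hh : IsPath n h) (hk : IsValley h k) {x y : ℤ}
    (hx : (x - k) % 2 = 0) (hx' : ¬ (2 * n : ℤ) ∣ x - k)
    (hy : (y - k) % 2 = 0) (hy' : ¬ (2 * n : ℤ) ∣ y - k) :
    Rel (raise n h k) x y ↔ Rel h x y := by
  constructor
  · rintro ⟨h1, h2⟩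
    rw [raise_of_not_dvd hx', raise_of_not_dvd hy'] at h1
    refine ⟨h1, fun z hz => ?_⟩
    have h3 := h2 z hz
    rw [raise_of_not_dvd hx'] at h3
    by_cases h4 : (2 * n : ℤ) ∣ z - k
    · have h0 := even_of_dvd h4
      have h5 := h2 (z + 1) (by
        have : z ≠ x := by rintro rfl; contradiction
        have : z ≠ y := by rintro rfl; contradiction
        omega)
      rw [raise_of_odd (x := z + 1) (by omega), raise_of_not_dvd hx'] at h5
      have := (hk.of_dvd hh h4).2
      have := hh.parity x z
      omega
    · rwa [raise_of_not_dvd h4] at h3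
  · rintro ⟨h1, h2⟩
    refine ⟨by rwa [raise_of_not_dvd hx', raise_of_not_dvd hy'], fun z hz => ?_⟩
    rw [raise_of_not_dvd hx']
    exact (h2 z hz).trans (le_raise _ _)

lemma rel_raise_of_odd {x y : ℤ} (hx : (x - k) % 2 = 1) (hy : (y - k) % 2 = 1)
    (H : Rel h x y) : Rel (raise n h k) x y := by
  refine ⟨by rw [raise_of_odd hx, raise_of_odd hy, H.1], fun z hz => ?_⟩
  rw [raise_of_odd hx]
  exact (H.2 z hz).trans (le_raise _ _)

/-- On the vertices of the other parity the new relation is generated by the old one and the pairs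
of neighbours of the valley. Where a new relation passes below its own level in the old path, it
does so at a translate `z` of `k`. The neighbours `z - 1` and `z + 1` are then at that level, so the
relation splits there into two shorter ones. -/
lemma of_rel_raise_of_odd (hh : IsPath n h) (hk : IsValley h k)
    {σ : ℤ → ℤ → Prop} (hs : ∀ x y, σ x y → σ y x)
    (ht : ∀ x y z, σ x y → σ y z → σ x z)
    (h1 : ∀ x y, (x - k) % 2 = 1 → (y - k) % 2 = 1 → Rel h x y → σ x y)
    (h2 : ∀ T, (2 * n : ℤ) ∣ T → σ (k - 1 + T) (k + 1 + T)) {x y : ℤ} (hx : (x - k) % 2 = 1)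
    (hy : (y - k) % 2 = 1) (H : Rel (raise n h k) x y) : σ x y := by
  have main : ∀ m : ℕ, ∀ x y : ℤ, (x - k) % 2 = 1 → (y - k) % 2 = 1 → x ≤ y → y ≤ x + m →
      Rel (raise n h k) x y → σ x y := by
    intro m
    induction m using Nat.strong_induction_on with
    | _ m ih =>
    intro x y hx hy hxy hm H
    obtain ⟨H1, H2⟩ := H
    rw [raise_of_odd hx] at H1 H2
    rw [raise_of_odd hy] at H1
    by_cases hall : ∀ z, x ≤ z → z ≤ y → h x ≤ h z
    · exact h1 x y hx hy ⟨H1, fun z hz => hall z (by omega) (by omega)⟩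
    · push Not at hall
      obtain ⟨z, hz1, hz2, hz3⟩ := hall
      have hd : (2 * n : ℤ) ∣ z - k := by
        by_contra hd
        have := H2 z (by omega)
        rw [raise_of_not_dvd hd] at this
        omega
      have e := even_of_dvd hd
      obtain ⟨e1, e2⟩ := hk.of_dvd hh hd
      have hzz := H2 z (by omega)
      rw [raise_of_dvd hd] at hzz
      have := hh.parity x z
      have s2 := h2 (z - k) hd
      rw [show k - 1 + (z - k) = z - 1 by ring, show k + 1 + (z - k) = z + 1 by ring] at s2
      refine ht _ _ _ (ht _ _ _ (ih (z - 1 - x).toNat (by omega) x (z - 1) hx (by omega) (by omega)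
        (by omega) ⟨?_, fun w hw => ?_⟩) s2) (ih (y - (z + 1)).toNat (by omega) (z + 1) y
        (by omega) hy (by omega) (by omega) ⟨?_, fun w hw => ?_⟩)
      · rw [raise_of_odd hx, raise_of_odd (by omega)]; omega
      · rw [raise_of_odd hx]; exact H2 w (by omega)
      · rw [raise_of_odd hy, raise_of_odd (by omega)]; omega
      · rw [raise_of_odd (by omega)]; exact le_trans (by omega) (H2 w (by omega))
  rcases le_total x y with hxy | hxy
  · exact main (y - x).toNat x y hx hy hxy (by omega) H
  · exact hs _ _ (main (x - y).toNat y x hy hx hxy (by omega) H.symm)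

lemma isPeak_raise (hk : IsValley h k) : IsPeak (raise n h k) k := by
  rw [IsPeak, raise_of_odd (x := k - 1) (by omega), raise_of_odd (x := k + 1) (by omega),
    raise_of_dvd (x := k) (by simp)]
  have := hk.1
  have := hk.2
  omega

lemma IsPeak.raise {l : ℤ} (hl : (l - k) % 2 = 0) (hl' : ¬ (2 * n : ℤ) ∣ l - k)
    (H : IsPeak h l) : IsPeak (raise n h k) l := by
  rwa [IsPeak, raise_of_odd (x := l - 1) (by omega), raise_of_odd (x := l + 1) (by omega),
    raise_of_not_dvd hl']

end Raise

end TypeB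

namespace TypeB
variable {n : ℕ} {h : ℤ → ℤ}

/-! ### Turning an inner arc inside out -/

open Classical in
/-- Lower the heights of the vertices between the ends of an arc `(a, b)` and its translates
by `2`. -/
noncomputable def lower (n : ℕ) (h : ℤ → ℤ) (a b : ℤ) : ℤ → ℤ :=
  fun x => if ∃ T : ℤ, (2 * n : ℤ) ∣ T ∧ a + T < x ∧ x ≤ b + T then h x - 2 else h x

/-- The arc `(a, b)` lies immediately inside the arc `(p, r)`. -/
structure IsChild (h : ℤ → ℤ) (p a b r : ℤ) : Prop where
  outer : IsArc h p r
  inner : IsArc h a b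
  left : p < a
  right : b < r
  height : h a = h p + 1

section Lower

variable {p a b r : ℤ}

lemma lower_of_mem {T x : ℤ} (hT : (2 * n : ℤ) ∣ T) (h1 : a + T < x) (h2 : x ≤ b + T) :
    lower n h a b x = h x - 2 := if_pos ⟨T, hT, h1, h2⟩

lemma lower_of_not_mem {x : ℤ} (hx : ∀ T, (2 * n : ℤ) ∣ T → ¬ (a + T < x ∧ x ≤ b + T)) :
    lower n h a b x = h x := if_neg fun ⟨T, hT, h1⟩ => hx T hT h1

lemma lower_le (a b x : ℤ) : lower n h a b x ≤ h x := by
  unfold lower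
  split_ifs <;> omega

lemma lower_cases (n : ℕ) (h : ℤ → ℤ) (a b x : ℤ) :
    (∃ T : ℤ, (2 * n : ℤ) ∣ T ∧ a + T < x ∧ x ≤ b + T ∧ lower n h a b x = h x - 2) ∨
      ((∀ T, (2 * n : ℤ) ∣ T → ¬ (a + T < x ∧ x ≤ b + T)) ∧ lower n h a b x = h x) := by
  by_cases hx : ∃ T : ℤ, (2 * n : ℤ) ∣ T ∧ a + T < x ∧ x ≤ b + T
  · obtain ⟨T, hT, h1, h2⟩ := hx
    exact Or.inl ⟨T, hT, h1, h2, lower_of_mem hT h1 h2⟩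
  · push Not at hx
    have : ∀ T, (2 * n : ℤ) ∣ T → ¬ (a + T < x ∧ x ≤ b + T) := fun T hT h1 => by
      have := hx T hT h1.1; omega
    exact Or.inr ⟨this, lower_of_not_mem this⟩

lemma IsChild.shift (hh : IsPath n h) (H : IsChild h p a b r) {T : ℤ} (hT : (2 * n : ℤ) ∣ T) :
    IsChild h (p + T) (a + T) (b + T) (r + T) :=
  ⟨H.outer.shift hh hT, H.inner.shift hh hT, by have := H.left; omega, by have := H.right; omega,
    by rw [hh.period_dvd hT, hh.period_dvd hT, H.height]⟩

lemma lower_step_cases (hh : IsPath n h) (hn : 0 < n) (H : IsArc h a b) (x : ℤ) :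
    ((2 * n : ℤ) ∣ x - a ∧ lower n h a b x = h x ∧ lower n h a b (x + 1) = h (x + 1) - 2) ∨
    ((2 * n : ℤ) ∣ x - b ∧ lower n h a b x = h x - 2 ∧ lower n h a b (x + 1) = h (x + 1)) ∨
    (¬ (2 * n : ℤ) ∣ x - a ∧ ¬ (2 * n : ℤ) ∣ x - b ∧
      lower n h a b (x + 1) - lower n h a b x = h (x + 1) - h x) := by
  have hlt := H.lt_add hh hn
  have hab := H.1
  -- The translates of the closed interval from `a` to `b` are pairwise disjoint, as an arc is
  -- shorter than a period.
  have huniq : ∀ T S : ℤ, (2 * n : ℤ) ∣ T → (2 * n : ℤ) ∣ S → a + T < b + S + 1 →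
      a + S < b + T + 1 → T = S := by
    intro T S hT hS h1 h2
    by_contra hne
    exact not_dvd_of_abs_lt (n := n) (x := T - S) (by omega) (by omega) (by omega)
      (dvd_sub hT hS)
  have down : h (b + 1) = h b - 1 := by have := H.down hh; have := H.2.1; omega
  rcases lower_cases n h a b x with ⟨T, hT, h1, h2, h3⟩ | ⟨h1, h2⟩
  · rcases lower_cases n h a b (x + 1) with ⟨S, hS, g1, g2, g3⟩ | ⟨g1, g2⟩
    · refine Or.inr (Or.inr ⟨fun hd => ?_, fun hd => ?_, by omega⟩)
      · have := huniq T (x - a) hT hd (by omega) (by omega)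
        omega
      · have := huniq S (x - b) hS hd (by omega) (by omega)
        omega
    · have := g1 T hT
      refine Or.inr (Or.inl ⟨?_, h3, g2⟩)
      rwa [show x - b = T by omega]
  · rcases lower_cases n h a b (x + 1) with ⟨S, hS, g1, g2, g3⟩ | ⟨g1, g2⟩
    · have := h1 S hS
      refine Or.inl ⟨?_, h2, g3⟩
      rwa [show x - a = S by omega]
    · refine Or.inr (Or.inr ⟨fun hd => ?_, fun hd => ?_, by omega⟩)
      · exact g1 _ hd (by omega)
      · exact h1 _ hd (by omega)

lemma isPath_lower (hh : IsPath n h) (hn : 0 < n) (H : IsArc h a b) :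
    IsPath n (lower n h a b) := by
  refine ⟨fun x => ?_, fun x => ?_⟩
  · rcases lower_step_cases hh hn H x with ⟨h1, h2, h3⟩ | ⟨h1, h2, h3⟩ | ⟨_, _, h3⟩
    · have := (H.shift hh h1).up hh
      rw [show a + (x - a) = x by ring] at this
      omega
    · have h4 := (H.shift hh h1).down hh
      have h5 := (H.shift hh h1).2.1
      rw [show b + (x - b) = x by ring] at h4 h5
      omega
    · have := hh.step x
      omega
  · rcases lower_cases n h a b x with ⟨T, hT, h1, h2, h3⟩ | ⟨h1, h2⟩
    · rw [h3, lower_of_mem (T := T + 2 * n) (dvd_add hT dvd_rfl) (by omega) (by omega), hh.period]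
    · rw [h2, lower_of_not_mem, hh.period]
      intro T hT hx
      exact h1 (T - 2 * n) (dvd_sub hT dvd_rfl) (by omega)

/-- Two vertices that are related after lowering lie in the same translate of the lowered interval,
or outside of all of them, unless their level is that of the outer arc. -/
lemma rel_lower_cases (hh : IsPath n h) (H : IsChild h p a b r) {x y : ℤ}
    (hxy : Rel (lower n h a b) x y) :
    Rel h x y ∨ (lower n h a b x = h a - 1) := by
  have hpar := hh.parity
  -- A relation that leaves a lowered interval passes its first or last vertex, which has dropped to
  -- `h a - 1`. No vertex of the interval is lower than that.
  have main : ∀ x y : ℤ, Rel (lower n h a b) x y → ∀ T, (2 * n : ℤ) ∣ T → a + T < x →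
      x ≤ b + T → lower n h a b x = h x - 2 → ¬ (a + T < y ∧ y ≤ b + T) →
      lower n h a b x = h a - 1 := by
    intro x y hxy T hT h1 h2 h3 h4
    have hc := H.inner.shift hh hT
    have e0 := hh.period_dvd hT a
    have e1 := hc.2.2 x h1 h2
    have e2 := hc.up hh
    have e3 := hc.down hh
    rcases lt_or_ge (a + T) y with h5 | h5
    · have := hxy.2 (b + T) (by omega)
      rw [lower_of_mem (x := b + T) hT (by omega) le_rfl] at this
      omega
    · have := hxy.2 (a + T + 1) (by omega)
      rw [lower_of_mem (x := a + T + 1) hT (by omega) (by omega)] at this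
      omega
  rcases lower_cases n h a b x with ⟨T, hT, h1, h2, h3⟩ | ⟨h1, h2⟩
  · by_cases h4 : a + T < y ∧ y ≤ b + T
    · left
      have h5 := lower_of_mem (h := h) hT h4.1 h4.2
      refine ⟨by have := hxy.1; omega, fun z hz => ?_⟩
      have := hxy.2 z hz
      rw [lower_of_mem (x := z) hT (by omega) (by omega)] at this
      omega
    · exact Or.inr (main x y hxy T hT h1 h2 h3 h4)
  · rcases lower_cases n h a b y with ⟨S, hS, g1, g2, g3⟩ | ⟨g1, g2⟩
    · right
      rw [hxy.1]
      exact main y x hxy.symm S hS g1 g2 g3 (h1 S hS)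
    · left
      refine ⟨by have := hxy.1; omega, fun z hz => ?_⟩
      rw [← h2]
      exact (hxy.2 z hz).trans (lower_le a b z)

/-- Two related vertices stay related unless they are at the level of the inner arc and on both
sides of it. -/
lemma rel_lower_of_rel (hh : IsPath n h) (H : IsChild h p a b r) {x y : ℤ} (hxy : Rel h x y) :
    Rel (lower n h a b) x y ∨ (h x = h a ∧ ∃ T, (2 * n : ℤ) ∣ T ∧
      (x ≤ a + T ∧ b + T < y ∨ y ≤ a + T ∧ b + T < x)) := by
  -- In the old path the inside of an arc lies strictly above the two vertices bounding it, so
  -- related vertices are both inside or both outside.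
  have mixed : ∀ x y : ℤ, Rel h x y → ∀ T, (2 * n : ℤ) ∣ T → a + T < x →
      x ≤ b + T → a + T < y ∧ y ≤ b + T := by
    intro x y hxy T hT h1 h2
    by_contra h4
    have hc := H.inner.shift hh hT
    have e0 := hh.period_dvd hT a
    have e1 := hc.2.2 x h1 h2
    have e2 := hc.2.1
    rcases lt_or_ge (a + T) y with h5 | h5
    · have := hxy.2 (b + T + 1) (by omega)
      omega
    · have := hxy.2 (a + T) (by omega)
      omega
  rcases lower_cases n h a b x with ⟨T, hT, h1, h2, h3⟩ | ⟨h1, h2⟩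
  · have h4 := mixed x y hxy T hT h1 h2
    left
    refine ⟨by rw [h3, lower_of_mem hT h4.1 h4.2, hxy.1], fun z hz => ?_⟩
    rw [h3, lower_of_mem (x := z) hT (by omega) (by omega)]
    have := hxy.2 z hz
    omega
  · rcases lower_cases n h a b y with ⟨S, hS, g1, g2, g3⟩ | ⟨g1, g2⟩
    · exact absurd (mixed y x hxy.symm S hS g1 g2) (h1 S hS)
    · by_contra hcon
      push Not at hcon
      refine hcon.1 ⟨by rw [h2, g2, hxy.1], fun z hz => ?_⟩
      rw [h2]
      have hz' := hxy.2 z hz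
      rcases lower_cases n h a b z with ⟨T, hT, k1, k2, k3⟩ | ⟨k1, k2⟩
      · have hc := H.inner.shift hh hT
        have e0 := hh.period_dvd hT a
        have e1 := hc.2.2 z k1 k2
        have := h1 T hT
        have := g1 T hT
        have e2 := hxy.2 (a + T) (by omega)
        by_cases h5 : h x = h a
        · have := hcon.2 h5 T hT
          omega
        · omega
      · omega

/-! ### The move at a vertex on a slope -/

/-- The inner arc `(a, b)` and the outer arc `(p, r)` are attached to the two steps at the
vertex `k`. -/
structure IsSlope (h : ℤ → ℤ) (k p a b r : ℤ) : Prop extends IsChild h p a b r where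
  vertex : k = a ∧ k = p + 1 ∨ k = b + 1 ∧ k = r

lemma IsSlope.parity (hh : IsPath n h) {k : ℤ} (H : IsSlope h k p a b r) : (a - k) % 2 = 0 := by
  have := hh.parity a (b + 1)
  have := H.inner.2.1
  have := H.vertex
  omega

/-- Both exceptional cases disappear. The level `h a - 1` has the wrong parity. A pair at the level
of `a` on both sides of the inner arc avoids `k`, so it would have to see across an end `p` or `r +
1` of the outer arc, which is lower. -/
lemma rel_lower_iff_of_even (hh : IsPath n h) {k : ℤ} (H : IsSlope h k p a b r) {x y : ℤ}
    (hx : (x - k) % 2 = 0) (hx' : ¬ (2 * n : ℤ) ∣ x - k)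
    (hy : ¬ (2 * n : ℤ) ∣ y - k) :
    Rel (lower n h a b) x y ↔ Rel h x y := by
  have h0 := H.parity hh
  have h3 := hh.parity x a
  constructor
  · intro hxy
    refine (rel_lower_cases hh H.toIsChild hxy).resolve_right fun h1 => ?_
    rcases lower_cases n h a b x with ⟨T, hT, h1, h2, h3⟩ | ⟨h1, h2⟩ <;> omega
  · intro hxy
    refine (rel_lower_of_rel hh H.toIsChild hxy).resolve_right ?_
    have key : ∀ x y : ℤ, ¬ (2 * n : ℤ) ∣ x - k → ¬ (2 * n : ℤ) ∣ y - k → Rel h x y → h x = h a →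
        ∀ T, (2 * n : ℤ) ∣ T → x ≤ a + T → b + T < y → False := by
      intro x y hx' hy hxy h1 T hT h4 h5
      have hc := H.toIsChild.shift hh hT
      have e0 := hh.period_dvd hT a
      have e1 := hc.height
      have e2 := hc.inner.1
      have e3 := hc.outer.2.1
      rcases H.vertex with ⟨h6, h7⟩ | ⟨h6, h7⟩
      · have : x ≠ k + T := by rintro rfl; exact hx' (by simpa using hT)
        have := hxy.2 (p + T) (by omega)
        omega
      · have : y ≠ k + T := by rintro rfl; exact hy (by simpa using hT)
        have := hxy.2 (r + T + 1) (by omega)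
        omega
    rintro ⟨h1, T, hT, ⟨h4, h5⟩ | ⟨h4, h5⟩⟩
    · exact key x y hx' hy hxy h1 T hT h4 h5
    · exact key y x hy hx' hxy.symm (by rw [← hxy.1, h1]) T hT h4 h5

lemma rel_lower_of_odd (hh : IsPath n h) {k : ℤ} (H : IsSlope h k p a b r) {x y : ℤ}
    (hx : (x - k) % 2 = 1) (hxy : Rel h x y) : Rel (lower n h a b) x y := by
  have h0 := H.parity hh
  have h3 := hh.parity x a
  exact (rel_lower_of_rel hh H.toIsChild hxy).resolve_right fun h1 => by have := h1.1; omega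

lemma IsArc.rel (hh : IsPath n h) (H : IsArc h a b) : Rel h (a + 1) b := by
  have h1 := H.up hh
  have h2 := H.down hh
  have h0 := H.1
  exact ⟨by omega, fun z hz => by have := H.2.2 z (by omega) (by omega); omega⟩

lemma IsArc.rel_outer (H : IsArc h a b) : Rel h a (b + 1) := by
  have h0 := H.1
  refine ⟨H.2.1.symm, fun z hz => ?_⟩
  by_cases h1 : z = a
  · rw [h1]
  by_cases h2 : z = b + 1
  · rw [h2, H.2.1]
  exact (H.2.2 z (by omega) (by omega)).le

/-- The neighbours of `k` lie just inside the inner arc and just outside the outer arc, so the move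
joins exactly these two regions. -/
lemma of_rel_lower_of_odd (hh : IsPath n h) {k : ℤ} (H : IsSlope h k p a b r)
    {σ : ℤ → ℤ → Prop} (hs : ∀ x y, σ x y → σ y x)
    (ht : ∀ x y z, σ x y → σ y z → σ x z)
    (h1 : ∀ x y, (x - k) % 2 = 1 → (y - k) % 2 = 1 → Rel h x y → σ x y)
    (h2 : ∀ T, (2 * n : ℤ) ∣ T → σ (k - 1 + T) (k + 1 + T)) {x y : ℤ} (hx : (x - k) % 2 = 1)
    (hy : (y - k) % 2 = 1) (hxy : Rel (lower n h a b) x y) : σ x y := by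
  have h0 := H.parity hh
  have hap := hh.parity a p
  have hpr := hh.parity p (r + 1)
  have hab := hh.parity a (b + 1)
  have hht := H.height
  have hi := H.inner.2.1
  have ho := H.outer.2.1
  have h2' : ∀ T, (2 * n : ℤ) ∣ T → σ (a + 1 + T) (p + T) := by
    intro T hT
    have hT2 := even_of_dvd hT
    rcases H.vertex with ⟨h6, h7⟩ | ⟨h6, h7⟩
    · have := hs _ _ (h2 T hT)
      rwa [show k + 1 + T = a + 1 + T by omega, show k - 1 + T = p + T by omega] at this
    · have e1 := (H.inner.shift hh hT).rel hh
      have e2 := (H.outer.shift hh hT).rel_outer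
      have := h2 T hT
      rw [show k - 1 + T = b + T by omega, show k + 1 + T = r + T + 1 by omega] at this
      rw [show a + 1 + T = a + T + 1 by ring]
      exact ht _ _ _ (h1 _ _ (by omega) (by omega) e1) (ht _ _ _ this
        (hs _ _ (h1 _ _ (by omega) (by omega) e2)))
  rcases rel_lower_cases hh H.toIsChild hxy with h3 | h3
  · exact h1 x y hx hy h3
  -- A vertex at the level of the merged region can be traded for one that had this height already
  -- in the old path: if it was inside the inner arc, go to `a + 1` and from there to `p`.
  have rep : ∀ x, (x - k) % 2 = 1 → lower n h a b x = h a - 1 → ∃ x', (x' - k) % 2 = 1 ∧ σ x x' ∧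
      h x' = h a - 1 ∧ (∀ z, (x ≤ z ∧ z ≤ x' ∨ x' ≤ z ∧ z ≤ x) → h a - 1 ≤ h z) := by
    intro x hx h3
    rcases lower_cases n h a b x with ⟨T, hT, g1, g2, g3⟩ | ⟨g1, g2⟩
    · have hT2 := even_of_dvd hT
      have hc := H.toIsChild.shift hh hT
      have e0 := hh.period_dvd hT a
      have e1 := hc.inner.up hh
      have e2 := hc.height
      have hL := hc.left
      refine ⟨p + T, by omega, ht _ _ _ (h1 x (a + T + 1) hx (by omega) ⟨by omega, fun z hz => ?_⟩)
        ?_, by omega, fun z hz => ?_⟩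
      · have := hc.inner.2.2 z (by omega) (by omega)
        omega
      · have := h2' T hT
        rwa [show a + 1 + T = a + T + 1 by ring] at this
      · by_cases hz' : z = p + T
        · rw [hz']; omega
        · have := hc.outer.2.2 z (by omega) (by have := hc.right; omega)
          omega
    · refine ⟨x, hx, h1 x x hx hx (Rel.refl h x), by omega, fun z hz => ?_⟩
      rw [show z = x by omega]
      omega
  obtain ⟨x', k1, k2, k3, k4⟩ := rep x hx h3
  obtain ⟨y', l1, l2, l3, l4⟩ := rep y hy (hxy.1 ▸ h3)
  refine ht _ _ _ k2 (ht _ _ _ (h1 x' y' k1 l1 ⟨by omega, fun z hz => ?_⟩) (hs _ _ l2))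
  by_cases c1 : x ≤ z ∧ z ≤ x' ∨ x' ≤ z ∧ z ≤ x
  · have := k4 z c1; omega
  by_cases c2 : y ≤ z ∧ z ≤ y' ∨ y' ≤ z ∧ z ≤ y
  · have := l4 z c2; omega
  have := hxy.2 z (by omega)
  have := lower_le (n := n) (h := h) a b z
  omega

/-- The steps of the lowered path. -/
lemma lower_up_iff (hh : IsPath n h) (hn : 0 < n) (H : IsArc h a b) (x : ℤ) :
    lower n h a b (x + 1) = lower n h a b x + 1 ↔
      (h (x + 1) = h x + 1 ∧ ¬ (2 * n : ℤ) ∣ x - a) ∨ (2 * n : ℤ) ∣ x - b := by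
  rcases lower_step_cases hh hn H x with ⟨h1, h2, h3⟩ | ⟨h1, h2, h3⟩ | ⟨h1, h2, h3⟩
  · have e := (H.shift hh h1).up hh
    rw [show a + (x - a) = x by ring] at e
    have : ¬ (2 * n : ℤ) ∣ x - b := by
      intro hd
      have := dvd_sub h1 hd
      have h5 := H.lt_add hh hn
      have h6 := H.1
      exact not_dvd_of_abs_lt (by omega) (by omega) (by omega) this
    simp only [h1, this, not_true, and_false, or_false, iff_false]
    omega
  · have e := (H.shift hh h1).down hh
    have e' := (H.shift hh h1).2.1
    rw [show b + (x - b) = x by ring] at e e'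
    simp only [h1, or_true, iff_true]
    omega
  · simp only [h1, h2, not_false_eq_true, and_true, or_false]
    omega

lemma raise_up_iff (hh : IsPath n h) {k : ℤ} (hk : IsValley h k) (x : ℤ) :
    raise n h k (x + 1) = raise n h k x + 1 ↔
      (h (x + 1) = h x + 1 ∧ ¬ (2 * n : ℤ) ∣ x - k) ∨ (2 * n : ℤ) ∣ x - (k - 1) := by
  by_cases h1 : (2 * n : ℤ) ∣ x - k
  · have h2 := even_of_dvd h1
    have h3 : ¬ (2 * n : ℤ) ∣ x - (k - 1) := fun h => by have := even_of_dvd h; omega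
    rw [raise_of_dvd h1, raise_of_odd (x := x + 1) (by omega)]
    have := (hk.of_dvd hh h1).2
    simp only [h1, h3, not_true, and_false, or_false, iff_false]
    omega
  · by_cases h2 : (2 * n : ℤ) ∣ x + 1 - k
    · rw [raise_of_dvd h2, raise_of_not_dvd h1]
      have := (hk.of_dvd hh h2).1
      rw [add_sub_cancel_right] at this
      rw [show x - (k - 1) = x + 1 - k by ring]
      simp only [h2, or_true, iff_true]
      omega
    · rw [raise_of_not_dvd h2, raise_of_not_dvd h1]
      rw [show x - (k - 1) = x + 1 - k by ring]
      simp [h1, h2]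

lemma isPeak_lower (hh : IsPath n h) (hn : 0 < n) {k : ℤ} (H : IsSlope h k p a b r) :
    IsPeak (lower n h a b) k := by
  have hp := isPath_lower hh hn H.inner
  have h1 := lower_up_iff hh hn H.inner (k - 1)
  have h2 := lower_up_iff hh hn H.inner k
  have s1 := hp.step (k - 1)
  have s2 := hp.step k
  rw [sub_add_cancel] at h1 s1
  have h5 := H.inner.lt_add hh hn
  have h5' := H.outer.lt_add hh hn
  have h6 := H.inner.1
  have hR := H.right
  have hL := H.left
  have u : lower n h a b k = lower n h a b (k - 1) + 1 := by
    rw [h1]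
    rcases H.vertex with ⟨h6, h7⟩ | ⟨h6, h7⟩
    · left
      refine ⟨?_, not_dvd_of_abs_lt (by omega) (by omega) (by omega)⟩
      have := H.outer.up hh
      rwa [show p + 1 = k by omega, show p = k - 1 by omega] at this
    · right
      rw [show k - 1 - b = 0 by omega]
      exact dvd_zero _
  have d : ¬ lower n h a b (k + 1) = lower n h a b k + 1 := by
    rw [h2]
    rcases H.vertex with ⟨h6, h7⟩ | ⟨h6, h7⟩
    · rintro (⟨-, h8⟩ | h8)
      · exact h8 (by rw [show k - a = 0 by omega]; exact dvd_zero _)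
      · exact not_dvd_of_abs_lt (by omega) (by omega) (by omega) h8
    · rintro (⟨h8, -⟩ | h8)
      · have := H.outer.down hh
        have := H.outer.2.1
        rw [← h7] at *
        omega
      · exact not_dvd_of_abs_lt (by omega) (by omega) (by omega) h8
  exact ⟨by omega, by omega⟩

lemma IsPeak.lower (hh : IsPath n h) (hn : 0 < n) {k : ℤ} (H : IsSlope h k p a b r) {l : ℤ}
    (hl : (l - k) % 2 = 0) (hp : IsPeak h l) : IsPeak (lower n h a b) l := by
  have hpath := isPath_lower hh hn H.inner
  have h0 := H.parity hh
  have h1 := lower_up_iff hh hn H.inner (l - 1)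
  have h2 := lower_up_iff hh hn H.inner l
  have s1 := hpath.step (l - 1)
  have s2 := hpath.step l
  rw [sub_add_cancel] at h1 s1
  obtain ⟨p1, p2⟩ := hp
  have u : TypeB.lower n h a b l = TypeB.lower n h a b (l - 1) + 1 := by
    rw [h1]
    refine Or.inl ⟨by omega, fun hd => ?_⟩
    have := even_of_dvd hd
    omega
  have d : ¬ TypeB.lower n h a b (l + 1) = TypeB.lower n h a b l + 1 := by
    rw [h2]
    rintro (⟨h3, -⟩ | h3)
    · omega
    · have := even_of_dvd h3
      have := hh.parity a (b + 1)
      have := H.inner.2.1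
      omega
  exact ⟨by omega, by omega⟩

/-- At `k` there are two consecutive up steps or two consecutive down steps. Their arcs are nested,
since the one whose step is lower cannot close before the other. -/
lemma exists_isSlope (hh : IsPath n h) (hn : 0 < n) {k : ℤ} (h1 : ¬ IsPeak h k)
    (h2 : ¬ IsValley h k) : ∃ p a b r, IsSlope h k p a b r := by
  have s1 := hh.step (k - 1)
  have s2 := hh.step k
  rw [sub_add_cancel] at s1
  unfold IsPeak at h1
  unfold IsValley at h2
  by_cases hu : h (k + 1) = h k + 1
  · obtain ⟨b, hb, -⟩ := hh.exists_arc_of_up hn hu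
    obtain ⟨r, hr, -⟩ := hh.exists_arc_of_up hn (a := k - 1) (by rw [sub_add_cancel]; omega)
    refine ⟨k - 1, k, b, r, ⟨hr, hb, by omega, ?_, by omega⟩, by omega⟩
    have := hb.2.1
    have := hr.2.1
    by_contra hlt
    rcases eq_or_ne r b with rfl | hne
    · omega
    · have := hb.2.2 (r + 1) (by have := hr.1; omega) (by omega)
      omega
  · obtain ⟨a, ha, -⟩ := hh.exists_arc_of_down hn (b := k - 1) (by rw [sub_add_cancel]; omega)
    obtain ⟨p, hp, -⟩ := hh.exists_arc_of_down hn (b := k) (by omega)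
    have e1 := ha.2.1
    have e2 := hp.2.1
    rw [sub_add_cancel] at e1
    refine ⟨p, a, k - 1, k, ⟨hp, ha, ?_, by omega, by omega⟩, by omega⟩
    by_contra hlt
    rcases eq_or_ne p a with rfl | hne
    · omega
    · have := ha.2.2 p (by omega) (by have := hp.1; have : p ≠ k := by omega
                                      omega)
      omega

end Lower
end TypeB

namespace TypeB
variable {n : ℕ} {h : ℤ → ℤ}

/-! ### The partition of a path -/

/-- The position on the circle of an integer. -/
def res (n : ℕ) [NeZero n] (x : ℤ) : Fin (2 * n) :=
  ⟨(x % (2 * n)).toNat, by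
    have := Nat.pos_of_neZero n
    have := Int.emod_lt_of_pos x (b := 2 * n) (by omega)
    omega⟩

lemma res_val (n : ℕ) [NeZero n] (x : ℤ) : ((res n x).val : ℤ) = x % (2 * n) := by
  have := Nat.pos_of_neZero n
  exact Int.toNat_of_nonneg (Int.emod_nonneg _ (by omega))

lemma res_eq_iff [NeZero n] {x y : ℤ} : res n x = res n y ↔ (2 * n : ℤ) ∣ x - y := by
  rw [Fin.ext_iff, ← Int.natCast_inj, res_val, res_val]
  rw [Int.emod_eq_emod_iff_emod_sub_eq_zero, Int.dvd_iff_emod_eq_zero]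

lemma res_natCast [NeZero n] (p : Fin (2 * n)) : res n (p.val : ℤ) = p := by
  rw [Fin.ext_iff, ← Int.natCast_inj, res_val]
  have := p.isLt
  exact Int.emod_eq_of_lt (by omega) (by omega)

lemma res_add_dvd [NeZero n] {T : ℤ} (hT : (2 * n : ℤ) ∣ T) (x : ℤ) : res n (x + T) = res n x :=
  res_eq_iff.2 (by simpa using hT)

lemma opp_res [NeZero n] (x : ℤ) : opp (res n x) = res n (x + n) := by
  have hn := Nat.pos_of_neZero n
  have h1 := res_val n x
  have h2 := (res n x).isLt
  have h3 : res n (x + n) = res n ((res n x).val + n : ℤ) := by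
    rw [res_eq_iff, h1]
    have := Int.emod_add_mul_ediv x (2 * n)
    exact ⟨x / (2 * n), by omega⟩
  rw [h3, Fin.ext_iff]
  unfold opp
  split_ifs with h4
  · have := res_val n ((res n x).val + n : ℤ)
    rw [Int.emod_eq_of_lt (by omega) (by omega)] at this
    simp only
    omega
  · have := res_val n ((res n x).val + n : ℤ)
    rw [show ((res n x).val + n : ℤ) = ((res n x).val - n) + 2 * n by ring, Int.add_emod_right,
      Int.emod_eq_of_lt (by omega) (by omega)] at this
    simp only
    rw [show ((res n x).val + n : ℤ) = ((res n x).val - n) + 2 * n by ring]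
    omega

lemma dvd_iff_even {t : ℤ} (hn : 0 < n) : (2 * n : ℤ) ∣ n * t ↔ t % 2 = 0 := by
  rw [mul_comm (2 : ℤ), mul_dvd_mul_iff_left (by omega)]
  omega

/-- `n` divides `x - y` if and only if the positions agree up to sign. -/
lemma dvd_iff_res [NeZero n] {x y : ℤ} :
    (2 * n : ℤ) ∣ 2 * x + 1 - (2 * y + 1) ↔ res n x = res n y ∨ res n x = opp (res n y) := by
  have hn := Nat.pos_of_neZero n
  rw [opp_res, res_eq_iff, res_eq_iff, show 2 * x + 1 - (2 * y + 1) = 2 * (x - y) by ring,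
    mul_dvd_mul_iff_left two_ne_zero]
  constructor
  · rintro ⟨t, ht⟩
    rw [ht, show x - (y + n) = n * (t - 1) by rw [mul_sub, ← ht]; ring, dvd_iff_even hn,
      dvd_iff_even hn]
    omega
  · rintro (h1 | h1)
    · exact (Dvd.intro_left _ rfl).trans h1
    · have := dvd_add ((Dvd.intro_left 2 rfl : (n : ℤ) ∣ 2 * n).trans h1) (dvd_refl (n : ℤ))
      rwa [show x - (y + n) + n = x - y by ring] at this

lemma Rel.shift (hh : IsPath n h) {T x y : ℤ} (hT : (2 * n : ℤ) ∣ T) (H : Rel h x y) :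
    Rel h (x + T) (y + T) := by
  refine ⟨by rw [hh.period_dvd hT, hh.period_dvd hT, H.1], fun z hz => ?_⟩
  rw [hh.period_dvd hT, ← hh.period_dvd ((dvd_neg).2 hT) z]
  exact H.2 _ (by omega)

/-- The partition whose blocks are the regions cut out by the arcs of a path. -/
def partitionOf [NeZero n] (hh : IsPath n h) : Setoid (Fin (2 * n)) where
  r p q := ∃ x y : ℤ, res n x = p ∧ res n y = q ∧ Rel h (2 * x + 1) (2 * y + 1)
  iseqv := by
    refine ⟨fun p => ⟨p.val, p.val, res_natCast p, res_natCast p, Rel.refl h _⟩, ?_, ?_⟩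
    · rintro p q ⟨x, y, hx, hy, H⟩
      exact ⟨y, x, hy, hx, H.symm⟩
    · rintro p q r ⟨x, y, hx, hy, H⟩ ⟨y', z, hy', hz, H'⟩
      have hd := res_eq_iff.1 (hy.trans hy'.symm)
      refine ⟨x, z + (y - y'), hx, by rw [res_add_dvd hd, hz], H.trans ?_⟩
      have := H'.shift hh (Dvd.dvd.mul_left hd 2)
      convert this using 1 <;> ring

lemma partitionOf_res [NeZero n] (hh : IsPath n h) {x y : ℤ} :
    partitionOf hh (res n x) (res n y) ↔
      ∃ T, (2 * n : ℤ) ∣ T ∧ Rel h (2 * x + 1) (2 * (y + T) + 1) := by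
  constructor
  · rintro ⟨x', y', hx, hy, H⟩
    have h1 := res_eq_iff.1 hx
    have h2 := res_eq_iff.1 hy
    refine ⟨(y' - y) - (x' - x), dvd_sub h2 h1, ?_⟩
    have := H.shift hh (Dvd.dvd.mul_left ((dvd_neg).2 h1) 2)
    convert this using 1 <;> ring
  · rintro ⟨T, hT, H⟩
    exact ⟨x, y + T, rfl, res_add_dvd hT y, H⟩

lemma partitionOf_of_rel [NeZero n] (hh : IsPath n h) {x y : ℤ}
    (H : Rel h (2 * x + 1) (2 * y + 1)) : partitionOf hh (res n x) (res n y) :=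
  ⟨x, y, rfl, rfl, H⟩

lemma exists_res [NeZero n] (p : Fin (2 * n)) : ∃ x : ℤ, res n x = p := ⟨_, res_natCast p⟩

lemma partitionOf_opp [NeZero n] (hh : IsPath n h) {p q : Fin (2 * n)} (H : partitionOf hh p q) :
    partitionOf hh (opp p) (opp q) := by
  obtain ⟨x, y, rfl, rfl, H⟩ := H
  refine ⟨x + n, y + n, (opp_res x).symm, (opp_res y).symm, ?_⟩
  have := H.shift hh (dvd_refl _)
  convert this using 1 <;> ring

/-- A site in a zero block has minimal height. -/
lemma le_of_partitionOf_opp [NeZero n] (hh : IsPath n h) {x : ℤ}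
    (H : partitionOf hh (res n x) (opp (res n x))) (z : ℤ) : h (2 * x + 1) ≤ h z := by
  have hn := Nat.pos_of_neZero n
  rw [opp_res, partitionOf_res] at H
  obtain ⟨T, hT, H⟩ := H
  -- `n + T` is an odd multiple of `n`, so the two related vertices are at least one full period of
  -- the path apart.
  have h1 : (2 * n : ℤ) ≤ |2 * (n + T)| := by
    obtain ⟨t, rfl⟩ := hT
    rw [show (2 : ℤ) * (n + 2 * n * t) = 2 * n * (1 + 2 * t) by ring, abs_mul,
      abs_of_nonneg (by omega)]
    have : 1 ≤ |1 + 2 * t| := Int.one_le_abs (by omega)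
    nlinarith
  have key : ∀ l : ℤ, (∀ z, l ≤ z → z ≤ l + 2 * n → h (2 * x + 1) ≤ h z) →
      ∀ z, h (2 * x + 1) ≤ h z := by
    intro l hl z
    have e1 := Int.emod_add_mul_ediv (z - l) (2 * n)
    have e2 := Int.emod_nonneg (z - l) (b := 2 * n) (by omega)
    have e3 := Int.emod_lt_of_pos (z - l) (b := 2 * n) (by omega)
    have := hl (l + (z - l) % (2 * n)) (by omega) (by omega)
    rwa [hh.apply_of_dvd (x := l + (z - l) % (2 * n)) (k := z)
      ⟨-((z - l) / (2 * n)), by rw [mul_neg]; omega⟩] at this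
  rcases abs_cases (2 * (n + T)) with ⟨h2, h3⟩ | ⟨h2, h3⟩
  · exact key (2 * x + 1) (fun w h4 h5 => H.2 w (by omega)) z
  · exact key (2 * x + 1 - 2 * n) (fun w h4 h5 => H.2 w (by omega)) z

/-- Sites of zero blocks all lie at the minimal height of the path, and any two vertices of minimal
height are related. -/
lemma isPartition_partitionOf [NeZero n] (hh : IsPath n h) : IsPartition (partitionOf hh) := by
  rw [isPartition_iff]
  refine ⟨fun p q H => partitionOf_opp hh H, fun p q hp hq => ?_⟩
  obtain ⟨x, rfl⟩ := exists_res p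
  obtain ⟨y, rfl⟩ := exists_res q
  have h1 := le_of_partitionOf_opp hh hp
  have h2 := le_of_partitionOf_opp hh hq
  exact partitionOf_of_rel hh ⟨le_antisymm (h1 _) (h2 _), fun z _ => h1 z⟩

/-- Two sites of the same block see each other on one of the two sides of the circle. -/
lemma partitionOf_cases [NeZero n] (hh : IsPath n h) {x y : ℤ}
    (H : partitionOf hh (res n x) (res n y)) :
    h (2 * x + 1) = h (2 * y + 1) ∧
      ((∀ z, 2 * x + 1 ≤ z → z ≤ 2 * y + 1 → h (2 * x + 1) ≤ h z) ∨
      (∀ z, 2 * y + 1 ≤ z → z ≤ 2 * (x + 2 * n) + 1 → h (2 * x + 1) ≤ h z)) := by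
  rw [partitionOf_res] at H
  obtain ⟨T, hT, H1, H2⟩ := H
  rw [hh.apply_of_dvd (x := 2 * (y + T) + 1) (k := 2 * y + 1)
    (by rw [show 2 * (y + T) + 1 - (2 * y + 1) = 2 * T by ring]; exact Dvd.dvd.mul_left hT 2)] at H1
  refine ⟨H1, ?_⟩
  obtain ⟨t, rfl⟩ := hT
  rcases lt_or_ge t 0 with ht | ht
  · right
    intro z h1 h2
    have : (2 * n : ℤ) * t ≤ -(2 * n) := by nlinarith
    have := H2 (z + 2 * n * (-2)) (by omega)
    rwa [hh.period_dvd (Dvd.intro _ rfl)] at this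
  · left
    intro z h1 h2
    have : 0 ≤ (2 * n : ℤ) * t := by positivity
    exact H2 z (by omega)

/-- When two related pairs interleave, each pair sees itself over an interval that contains an end
of the other. This bounds the two levels by each other, so all four sites belong to one block. -/
lemma isNonCrossing_partitionOf [NeZero n] (hh : IsPath n h) :
    IsNonCrossing (partitionOf hh) := by
  rintro i k j l hik hkj hjl ⟨⟨-, hij, hij'⟩, ⟨-, hkl, -⟩⟩
  refine hij' k hik hkj ?_
  have hi := i.isLt
  have hl := l.isLt
  rw [← res_natCast i, ← res_natCast j] at hij
  rw [← res_natCast k, ← res_natCast l] at hkl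
  rw [Fin.lt_def] at hik hkj hjl
  have c1 := partitionOf_cases hh hij
  have c2 := partitionOf_cases hh hkl
  have e1 := hh.apply_of_dvd (x := 2 * (i.val + 2 * n) + 1) (k := 2 * i.val + 1) ⟨2, by ring⟩
  have e2 := hh.apply_of_dvd (x := 2 * (k.val + 2 * n) + 1) (k := 2 * k.val + 1) ⟨2, by ring⟩
  obtain ⟨a1, a2⟩ := c1
  obtain ⟨b1, b2⟩ := c2
  rcases a2 with a2 | a2
  · have a3 := a2 (2 * k.val + 1) (by omega) (by omega)
    have heq : h (2 * i.val + 1) = h (2 * k.val + 1) := by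
      rcases b2 with b2 | b2
      · have := b2 (2 * j.val + 1) (by omega) (by omega)
        omega
      · have := b2 (2 * (i.val + 2 * n) + 1) (by omega) (by omega)
        omega
    rw [← res_natCast i, ← res_natCast k]
    exact partitionOf_of_rel hh ⟨heq, fun z hz => a2 z (by omega) (by omega)⟩
  · have a3 := a2 (2 * l.val + 1) (by omega) (by omega)
    have heq : h (2 * j.val + 1) = h (2 * l.val + 1) := by
      rcases b2 with b2 | b2
      · have := b2 (2 * j.val + 1) (by omega) (by omega)
        omega
      · have := b2 (2 * (i.val + 2 * n) + 1) (by omega) (by omega)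
        omega
    rw [← res_natCast i, ← res_natCast k]
    refine (partitionOf hh).trans hij ((partitionOf hh).trans ?_ ((partitionOf hh).symm hkl))
    exact partitionOf_of_rel hh ⟨heq, fun z hz => by
      have := a2 z (by omega) (by omega); omega⟩

/-! ### The elementary moves -/

/-- The elementary move at a vertex `k` that is not a peak. It makes `k` a peak. -/
inductive Move (n : ℕ) (h : ℤ → ℤ) (k : ℤ) : (ℤ → ℤ) → Prop
  | raise : IsValley h k → Move n h k (raise n h k)
  | lower {p a b r : ℤ} : IsSlope h k p a b r → Move n h k (lower n h a b)

variable {k : ℤ} {h' : ℤ → ℤ}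

lemma IsSlope.not_isPeak (hh : IsPath n h) {p a b r : ℤ} (H : IsSlope h k p a b r) :
    ¬ IsPeak h k := by
  rintro ⟨h1, h2⟩
  rcases H.vertex with ⟨h3, h4⟩ | ⟨h3, h4⟩
  · have := H.inner.up hh
    rw [← h3] at this
    omega
  · have e1 := H.inner.down hh
    have e2 := H.inner.2.1
    rw [← h3] at e2
    rw [show b = k - 1 by omega] at e1
    omega

lemma Move.isPath (hh : IsPath n h) (hn : 0 < n) (H : Move n h k h') : IsPath n h' := by
  cases H with
  | raise H => exact isPath_raise hh H
  | lower H => exact isPath_lower hh hn H.inner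

lemma Move.isPeak (hh : IsPath n h) (hn : 0 < n) (H : Move n h k h') : IsPeak h' k := by
  cases H with
  | raise H => exact isPeak_raise H
  | lower H => exact isPeak_lower hh hn H

lemma Move.not_isPeak (hh : IsPath n h) (H : Move n h k h') : ¬ IsPeak h k := by
  cases H with
  | raise H => intro h1; have := h1.1; have := H.1; omega
  | lower H => exact H.not_isPeak hh

lemma Move.isPeak_of_even (hh : IsPath n h) (hn : 0 < n) (H : Move n h k h') {l : ℤ}
    (hl : (l - k) % 2 = 0) (hp : IsPeak h l) : IsPeak h' l := by
  cases H with
  | raise H =>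
    refine hp.raise hl fun hd => ?_
    have := hp.1
    have := (H.of_dvd hh hd).1
    omega
  | lower H => exact hp.lower hh hn H hl

lemma Move.rel_iff (hh : IsPath n h) (H : Move n h k h') {x y : ℤ}
    (hx : (x - k) % 2 = 0) (hx' : ¬ (2 * n : ℤ) ∣ x - k)
    (hy : (y - k) % 2 = 0) (hy' : ¬ (2 * n : ℤ) ∣ y - k) : Rel h' x y ↔ Rel h x y := by
  cases H with
  | raise H => exact rel_raise_iff_of_even hh H hx hx' hy hy'
  | lower H => exact rel_lower_iff_of_even hh H hx hx' hy'

lemma Move.rel_of_odd (hh : IsPath n h) (H : Move n h k h') {x y : ℤ}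
    (hx : (x - k) % 2 = 1) (hy : (y - k) % 2 = 1) (hxy : Rel h x y) : Rel h' x y := by
  cases H with
  | raise H => exact rel_raise_of_odd hx hy hxy
  | lower H => exact rel_lower_of_odd hh H hx hxy

lemma Move.of_rel_of_odd (hh : IsPath n h) (H : Move n h k h')
    {σ : ℤ → ℤ → Prop} (hs : ∀ x y, σ x y → σ y x)
    (ht : ∀ x y z, σ x y → σ y z → σ x z)
    (h1 : ∀ x y, (x - k) % 2 = 1 → (y - k) % 2 = 1 → Rel h x y → σ x y)
    (h2 : ∀ T, (2 * n : ℤ) ∣ T → σ (k - 1 + T) (k + 1 + T)) {x y : ℤ} (hx : (x - k) % 2 = 1)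
    (hy : (y - k) % 2 = 1) (hxy : Rel h' x y) : σ x y := by
  cases H with
  | raise H => exact of_rel_raise_of_odd hh H hs ht h1 h2 hx hy hxy
  | lower H => exact of_rel_lower_of_odd hh H hs ht h1 h2 hx hy hxy

/-- A move exchanges an up step and a down step. -/
lemma Move.up_iff (hh : IsPath n h) (hn : 0 < n) (H : Move n h k h') :
    ∃ u v, (u - k) % 2 = 0 ∧ (v - k) % 2 = 1 ∧ h (u + 1) = h u + 1 ∧ h (v + 1) = h v - 1 ∧
      ∀ x, h' (x + 1) = h' x + 1 ↔
        (h (x + 1) = h x + 1 ∧ ¬ (2 * n : ℤ) ∣ x - u) ∨ (2 * n : ℤ) ∣ x - v := by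
  cases H with
  | raise H =>
    refine ⟨k, k - 1, by omega, by omega, H.2, ?_, raise_up_iff hh H⟩
    have := H.1
    rw [sub_add_cancel]
    omega
  | @lower p a b r H =>
    have h0 := H.parity hh
    have h1 := hh.parity a (b + 1)
    have h2 := H.inner.2.1
    have h3 := H.inner.down hh
    exact ⟨a, b, h0, by omega, H.inner.up hh, by omega, lower_up_iff hh hn H.inner⟩

lemma exists_move (hh : IsPath n h) (hn : 0 < n) (hk : ¬ IsPeak h k) : ∃ h', Move n h k h' := by
  by_cases hv : IsValley h k
  · exact ⟨_, .raise hv⟩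
  · obtain ⟨p, a, b, r, H⟩ := exists_isSlope hh hn hk hv
    exact ⟨_, .lower H⟩

lemma IsPeak.rel_eq {x : ℤ} (H : IsPeak h k) (hx : Rel h k x) : x = k := by
  by_contra hne
  rcases lt_or_gt_of_ne hne with h1 | h1
  · have := hx.2 (k - 1) (by omega)
    have := H.1
    omega
  · have := hx.2 (k + 1) (by omega)
    have := H.2
    omega

/-! ### The moves on partitions -/

/-- Make `i` and `-i` singletons. -/
def isolate (i : Fin (2 * n)) (π : Setoid (Fin (2 * n))) : Setoid (Fin (2 * n)) where
  r p q := p = q ∨ (π p q ∧ (p ≠ i ∧ p ≠ opp i) ∧ (q ≠ i ∧ q ≠ opp i))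
  iseqv := by
    refine ⟨fun p => Or.inl rfl, ?_, ?_⟩
    · rintro p q (h1 | ⟨h1, h2, h3⟩)
      · exact Or.inl h1.symm
      · exact Or.inr ⟨π.symm h1, h3, h2⟩
    · rintro p q r (rfl | ⟨h1, h2, h3⟩) (rfl | ⟨g1, g2, g3⟩)
      · exact Or.inl rfl
      · exact Or.inr ⟨g1, g2, g3⟩
      · exact Or.inr ⟨h1, h2, h3⟩
      · exact Or.inr ⟨π.trans h1 g1, h2, g3⟩

lemma isolate_apply {i p q : Fin (2 * n)} {π : Setoid (Fin (2 * n))} :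
    isolate i π p q ↔ p = q ∨ (π p q ∧ (p ≠ i ∧ p ≠ opp i) ∧ (q ≠ i ∧ q ≠ opp i)) := Iff.rfl

lemma isolate_le (i : Fin (2 * n)) (π : Setoid (Fin (2 * n))) : isolate i π ≤ π := by
  rintro p q (h1 | ⟨h1, -⟩)
  · exact h1 ▸ π.refl p
  · exact h1

lemma not_dvd_iff_res [NeZero n] {x y : ℤ} : ¬ (2 * n : ℤ) ∣ 2 * x + 1 - (2 * y + 1) ↔
    res n x ≠ res n y ∧ res n x ≠ opp (res n y) := by
  rw [dvd_iff_res, not_or]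

lemma partitionOf_eq_of_isPeak [NeZero n] (hh : IsPath n h) {i : ℤ} (hi : IsPeak h (2 * i + 1))
    {q : Fin (2 * n)} (H : partitionOf hh (res n i) q) : q = res n i := by
  obtain ⟨y, rfl⟩ := exists_res q
  rw [partitionOf_res] at H
  obtain ⟨T, hT, H⟩ := H
  have := hi.rel_eq H
  rw [res_eq_iff, show y - i = -T by omega]
  exact (dvd_neg).2 hT

lemma isolate_eq_self {i : Fin (2 * n)} {π : Setoid (Fin (2 * n))} (hπ : IsPartition π)
    (hi : ∀ q, π i q → q = i) : isolate i π = π := by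
  refine le_antisymm (isolate_le i π) fun p q H => ?_
  have hopp := ((isPartition_iff π).1 hπ).1
  have key : ∀ p q, π p q → p = i ∨ p = opp i → p = q := by
    rintro p q H (rfl | rfl)
    · exact (hi q H).symm
    · have := hopp _ _ H
      rw [opp_opp] at this
      rw [← hi _ this, opp_opp]
  rw [isolate_apply]
  by_cases h1 : p = i ∨ p = opp i
  · exact Or.inl (key p q H h1)
  by_cases h2 : q = i ∨ q = opp i
  · exact Or.inl (key q p (π.symm H) h2).symm
  · exact Or.inr ⟨H, by tauto, by tauto⟩

/-- A peak is related to no other vertex, so the move at an odd vertex leaves its site and the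
opposite one as singletons; `Move.rel_iff` keeps everything else. -/
lemma Move.partitionOf_isolate [NeZero n] (hh : IsPath n h) {i : ℤ} (H : Move n h (2 * i + 1) h')
    (hh' : IsPath n h') : partitionOf hh' = isolate (res n i) (partitionOf hh) := by
  have hpk := H.isPeak hh (Nat.pos_of_neZero n)
  have h1 := isolate_eq_self (isPartition_partitionOf hh')
    (fun q hq => partitionOf_eq_of_isPeak hh' hpk hq)
  -- Since the new partition is its own isolation, only sites other than the two isolated ones
  -- remain to be compared.
  rw [← h1]
  ext p q
  rw [isolate_apply, isolate_apply]
  obtain ⟨x, rfl⟩ := exists_res p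
  obtain ⟨y, rfl⟩ := exists_res q
  refine or_congr Iff.rfl (and_congr_left fun hxy => ?_)
  rw [partitionOf_res, partitionOf_res]
  refine exists_congr fun T => and_congr_right fun hT => ?_
  rw [H.rel_iff hh (by omega) (not_dvd_iff_res.2 hxy.1) (by omega)]
  rw [not_dvd_iff_res, res_add_dvd hT]
  exact hxy.2

/-- At a vertex that is not a peak, an arc starts to the right or ends to the left. The two vertices
bounding this arc are related and at most one period of the path apart, hence different sites. -/
lemma exists_partitionOf_ne [NeZero n] (hh : IsPath n h) {i : ℤ} (hi : ¬ IsPeak h (2 * i + 1)) :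
    ∃ q, q ≠ res n i ∧ partitionOf hh (res n i) q := by
  have hn := Nat.pos_of_neZero n
  have s1 := hh.step (2 * i)
  have s2 := hh.step (2 * i + 1)
  rw [IsPeak, add_sub_cancel_right] at hi
  have key : ∀ y : ℤ, y ≠ i → y < i + 2 * n → i < y + 2 * n → Rel h (2 * i + 1) (2 * y + 1) →
      ∃ q, q ≠ res n i ∧ partitionOf hh (res n i) q := by
    intro y h1 h2 h3 h4
    refine ⟨res n y, ?_, partitionOf_of_rel hh h4⟩
    rw [Ne, res_eq_iff]
    exact not_dvd_of_abs_lt (by omega) (by omega) (by omega)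
  by_cases hu : h (2 * i + 1 + 1) = h (2 * i + 1) + 1
  · obtain ⟨b, hb, hb'⟩ := hh.exists_arc_of_up hn hu
    have e := hb.rel_outer
    have e1 := hb.1
    have e2 := hh.parity (2 * i + 1) (b + 1)
    have e3 := hb.2.1
    refine key (b / 2) (by omega) (by omega) (by omega) ?_
    rwa [show 2 * (b / 2) + 1 = b + 1 by omega]
  · obtain ⟨a, ha, ha'⟩ := hh.exists_arc_of_down hn (b := 2 * i) (by omega)
    have e := ha.rel_outer
    have e1 := ha.1
    have e2 := hh.parity (2 * i + 1) a
    have e3 := ha.2.1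
    refine key (a / 2) (by omega) (by omega) (by omega) ?_
    rw [show 2 * (a / 2) + 1 = a by omega]
    exact e.symm

lemma partitionOf_of_isPeak [NeZero n] (hh : IsPath n h) {i : ℤ} (hi : IsPeak h (2 * i + 2)) :
    partitionOf hh (res n i) (res n (i + 1)) := by
  obtain ⟨h1, h2⟩ := hi
  refine partitionOf_of_rel hh ⟨?_, fun z hz => ?_⟩
  · rw [show 2 * i + 2 - 1 = 2 * i + 1 by ring] at h1
    rw [show 2 * i + 2 + 1 = 2 * (i + 1) + 1 by ring] at h2
    omega
  · obtain rfl | rfl | rfl : z = 2 * i + 2 - 1 ∨ z = 2 * i + 2 ∨ z = 2 * i + 2 + 1 := by omega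
    all_goals (rw [show 2 * i + 1 = 2 * i + 2 - 1 by ring]; try omega)

lemma Move.le_partitionOf [NeZero n] (hh : IsPath n h) {i : ℤ} (H : Move n h (2 * i + 2) h')
    (hh' : IsPath n h') : partitionOf hh ≤ partitionOf hh' := by
  rintro p q ⟨x, y, hx, hy, hxy⟩
  exact ⟨x, y, hx, hy, H.rel_of_odd hh (by omega) (by omega) hxy⟩

/-- Together with `Move.le_partitionOf` and `partitionOf_of_isPeak` this characterizes the move at
an even vertex: the result is the finest partition of type B above the old one that merges the two
neighbouring sites. -/
lemma Move.partitionOf_le [NeZero n] (hh : IsPath n h) {i : ℤ} (H : Move n h (2 * i + 2) h')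
    (hh' : IsPath n h') {σ : Setoid (Fin (2 * n))} (hσ : IsPartition σ) (hle : partitionOf hh ≤ σ)
    (hi : σ (res n i) (res n (i + 1))) : partitionOf hh' ≤ σ := by
  have hopp := ((isPartition_iff σ).1 hσ).1
  have hi' := hopp _ _ hi
  rw [opp_res, opp_res] at hi'
  rintro p q ⟨x, y, rfl, rfl, hxy⟩
  have := H.of_rel_of_odd hh (σ := fun u v => σ (res n ((u - 1) / 2)) (res n ((v - 1) / 2)))
    (fun _ _ h1 => σ.symm h1) (fun _ _ _ h1 h2 => σ.trans h1 h2) ?_ ?_ (by omega) (by omega) hxy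
  · simpa using this
  · intro u v hu hv huv
    refine hle ?_
    apply partitionOf_of_rel
    rwa [show 2 * ((u - 1) / 2) + 1 = u by omega, show 2 * ((v - 1) / 2) + 1 = v by omega]
  · rintro T ⟨t, rfl⟩
    rw [show (2 * i + 2 - 1 + 2 * n * t - 1) = 2 * (i + n * t) by ring,
      show (2 * i + 2 + 1 + 2 * n * t - 1) = 2 * (i + 1 + n * t) by ring,
      Int.mul_ediv_cancel_left _ two_ne_zero, Int.mul_ediv_cancel_left _ two_ne_zero]
    -- Translating vertices by `2n * t` translates sites by `n * t`: for even `t` this is the same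
    -- pair of sites, for odd `t` the opposite pair.
    rcases Int.even_or_odd' t with ⟨s, rfl | rfl⟩
    · have hd : (2 * n : ℤ) ∣ n * (2 * s) := ⟨s, by ring⟩
      rwa [res_add_dvd hd, res_add_dvd hd]
    · have hd : (2 * n : ℤ) ∣ n * (2 * s) := ⟨s, by ring⟩
      rwa [show i + n * (2 * s + 1) = i + n + n * (2 * s) by ring,
        show i + 1 + n * (2 * s + 1) = i + 1 + n + n * (2 * s) by ring,
        res_add_dvd hd, res_add_dvd hd]

end TypeB

namespace TypeB
variable {n : ℕ}

/-! ### Counting non-zero blocks by linear algebra -/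

/-- The odd functions that are constant on the blocks of `π`. -/
def oddInv (π : Setoid (Fin (2 * n))) : Submodule ℚ (Fin (2 * n) → ℚ) where
  carrier := {f | (∀ p, f (opp p) = -f p) ∧ ∀ p q, π p q → f p = f q}
  add_mem' := fun {f g} hf hg => ⟨fun p => by simp [hf.1 p, hg.1 p]; ring, fun p q h => by
    simp [hf.2 p q h, hg.2 p q h]⟩
  zero_mem' := ⟨fun p => by simp, fun p q _ => rfl⟩
  smul_mem' := fun c f hf => ⟨fun p => by simp [hf.1 p], fun p q h => by simp [hf.2 p q h]⟩

lemma oddInv_anti {π π' : Setoid (Fin (2 * n))} (h : π ≤ π') : oddInv π' ≤ oddInv π :=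
  fun _ hf => ⟨hf.1, fun p q hpq => hf.2 p q (h hpq)⟩

lemma eq_zero_of_mem_oddInv {π : Setoid (Fin (2 * n))} {f : Fin (2 * n) → ℚ} (hf : f ∈ oddInv π)
    {p : Fin (2 * n)} (hp : π p (opp p)) : f p = 0 := by
  have h1 := hf.2 _ _ hp
  rw [hf.1] at h1
  linarith

lemma isPartition_ker {f : Fin (2 * n) → ℚ} (hf : ∀ p, f (opp p) = -f p) :
    IsPartition (Setoid.ker f) := by
  rw [isPartition_iff]
  simp only [Setoid.ker_def, hf]
  refine ⟨fun x y h => by rw [h], fun x y hx hy => by linarith⟩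

/-- The level sets of an odd function form a partition of type B, the only possible zero block being
its zero set. So if it is constant on the blocks of both partitions, it is constant on those of the
join. -/
lemma oddInv_join (π π' : Setoid (Fin (2 * n))) :
    oddInv (join π π') = oddInv π ⊓ oddInv π' := by
  have hj := (join_isLeast π π')
  refine le_antisymm (le_inf (oddInv_anti hj.1.2.1) (oddInv_anti hj.1.2.2)) ?_
  rintro f ⟨h1, h2⟩
  have : join π π' ≤ Setoid.ker f :=
    hj.2 ⟨isPartition_ker h1.1, fun p q h => h1.2 p q h, fun p q h => h2.2 p q h⟩
  exact ⟨h1.1, fun p q h => this h⟩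

open Classical in
/-- The smallest elements of the unions `K ∪ -K` for non-zero blocks `K`. -/
noncomputable def signedReps (π : Setoid (Fin (2 * n))) : Finset (Fin (2 * n)) :=
  {p | ¬ π p (opp p) ∧ ∀ q, π p q ∨ π (opp p) q → p ≤ q}

section Count

variable {π : Setoid (Fin (2 * n))}

lemma mem_signedReps {p : Fin (2 * n)} :
    p ∈ signedReps π ↔ ¬ π p (opp p) ∧ ∀ q, π p q ∨ π (opp p) q → p ≤ q := by
  simp [signedReps]

lemma rel_opp_iff (hπ : IsPartition π) {p q : Fin (2 * n)} :
    π (opp p) q ↔ π p (opp q) := by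
  have hopp := ((isPartition_iff π).1 hπ).1
  constructor
  · intro h; have := hopp _ _ h; rwa [opp_opp] at this
  · intro h; have := hopp _ _ h; rwa [opp_opp] at this

lemma signedReps_eq (hπ : IsPartition π) {s t : Fin (2 * n)} (hs : s ∈ signedReps π)
    (ht : t ∈ signedReps π) (h : π s t ∨ π (opp s) t) : s = t := by
  rw [mem_signedReps] at hs ht
  refine le_antisymm (hs.2 t h) (ht.2 s ?_)
  rcases h with h | h
  · exact Or.inl (π.symm h)
  · exact Or.inr ((rel_opp_iff hπ).2 (π.symm h))

lemma not_rel_opp (hπ : IsPartition π) {s t : Fin (2 * n)} (hs : s ∈ signedReps π)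
    (ht : t ∈ signedReps π) : ¬ π s (opp t) := by
  intro h
  have h' := signedReps_eq hπ hs ht (Or.inr ((rel_opp_iff hπ).2 h))
  subst h'
  exact (mem_signedReps.1 hs).1 h

lemma exists_signedRep (hπ : IsPartition π) {p : Fin (2 * n)} (hp : ¬ π p (opp p)) :
    ∃ t ∈ signedReps π, π p t ∨ π p (opp t) := by
  classical
  have hopp := ((isPartition_iff π).1 hπ).1
  let S : Finset (Fin (2 * n)) := {q | π p q ∨ π (opp p) q}
  have hS : S.Nonempty := ⟨p, by simp [S]⟩
  have hm := S.min'_mem hS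
  have hmin : ∀ q, π p q ∨ π (opp p) q → S.min' hS ≤ q := fun q hq =>
    S.min'_le q (by simpa [S] using hq)
  generalize S.min' hS = t at hm hmin
  have ht : π p t ∨ π (opp p) t := by simpa [S] using hm
  refine ⟨t, mem_signedReps.2 ⟨fun h => ?_, fun q hq => hmin q ?_⟩, ?_⟩
  · rcases ht with ht | ht
    · exact hp (π.trans ht (π.trans h (π.symm (hopp _ _ ht))))
    · have h1 := hopp _ _ ht
      rw [opp_opp] at h1
      exact hp (π.trans h1 (π.trans (π.symm h) (π.symm ht)))
  · rcases ht with ht | ht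
    · rcases hq with hq | hq
      · exact Or.inl (π.trans ht hq)
      · exact Or.inr (π.trans (hopp _ _ ht) hq)
    · rcases hq with hq | hq
      · exact Or.inr (π.trans ht hq)
      · have h1 := hopp _ _ ht
        rw [opp_opp] at h1
        exact Or.inl (π.trans h1 hq)
  · exact ht.imp id fun h => (rel_opp_iff hπ).1 h

/-- An odd invariant function vanishes on the zero block, and it is determined by arbitrary values
on one block out of each pair `K`, `-K`. -/
lemma finrank_oddInv (hπ : IsPartition π) :
    Module.finrank ℚ (oddInv π) = (signedReps π).card := by
  classical
  have hopp := ((isPartition_iff π).1 hπ).1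
  let F : oddInv π →ₗ[ℚ] (signedReps π → ℚ) :=
    { toFun := fun f t => f.1 t.1
      map_add' := fun f g => rfl
      map_smul' := fun c f => rfl }
  have hF : Function.Bijective F := by
    constructor
    · rw [← LinearMap.ker_eq_bot, LinearMap.ker_eq_bot']
      rintro ⟨f, hf⟩ h
      ext p
      change f p = 0
      have hz : ∀ t ∈ signedReps π, f t = 0 := fun t ht => congrFun h ⟨t, ht⟩
      by_cases hp : π p (opp p)
      · exact eq_zero_of_mem_oddInv hf hp
      · obtain ⟨t, ht, h1 | h1⟩ := exists_signedRep hπ hp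
        · rw [hf.2 _ _ h1, hz t ht]
        · rw [hf.2 _ _ h1, hf.1, hz t ht, neg_zero]
    · intro g
      refine ⟨⟨fun p => ∑ t : signedReps π, g t *
        ((if π p t.1 then 1 else 0) - (if π p (opp t.1) then 1 else 0)), fun p => ?_,
        fun p q hpq => ?_⟩, ?_⟩
      · rw [← Finset.sum_neg_distrib]
        refine Finset.sum_congr rfl fun t _ => ?_
        have h1 : π (opp p) t.1 ↔ π p (opp t.1) := rel_opp_iff hπ
        have h2 : π (opp p) (opp t.1) ↔ π p t.1 := by rw [rel_opp_iff hπ, opp_opp]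
        simp only [h1, h2]
        ring
      · refine Finset.sum_congr rfl fun t _ => ?_
        have h1 : ∀ r, π p r ↔ π q r := fun r =>
          ⟨fun h => π.trans (π.symm hpq) h, fun h => π.trans hpq h⟩
        simp only [h1]
      · ext s
        change ∑ t : signedReps π, g t *
          ((if π s.1 t.1 then 1 else 0) - (if π s.1 (opp t.1) then 1 else 0)) = g s
        rw [Finset.sum_eq_single s]
        · rw [if_pos (π.refl s.1), if_neg (not_rel_opp hπ s.2 s.2)]
          ring
        · intro t _ hts
          rw [if_neg, if_neg (not_rel_opp hπ s.2 t.2)]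
          · ring
          · intro h
            exact hts (Subtype.ext (signedReps_eq hπ s.2 t.2 (Or.inl h))).symm
        · intro h; exact absurd (Finset.mem_univ s) h
  rw [(LinearEquiv.ofBijective F hF).finrank_eq, Module.finrank_fintype_fun_eq_card,
    Fintype.card_coe]

lemma isZeroBlock_iff (hπ : IsPartition π) {p : Fin (2 * n)} :
    IsZeroBlock π {q | π q p} ↔ π p (opp p) := by
  have hopp := ((isPartition_iff π).1 hπ).1
  constructor
  · rintro ⟨-, h⟩
    have : opp p ∈ {q | π q p} := h ▸ ⟨p, π.refl p, rfl⟩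
    exact π.symm this
  · intro h
    refine ⟨π.mem_classes p, ?_⟩
    ext q
    rw [mem_opp_image]
    change π (opp q) p ↔ π q p
    rw [rel_opp_iff hπ]
    exact ⟨fun h' => π.trans h' (π.symm h), fun h' => π.trans h' h⟩

/-- The non-zero blocks are the classes of the signed representatives and the opposite classes,
without repetition. -/
lemma nzbk_eq_finrank (hπ : IsPartition π) : nzbk π = Module.finrank ℚ (oddInv π) := by
  classical
  rw [finrank_oddInv hπ, nzbk]
  have hcls : ∀ p q : Fin (2 * n), ({r | π r p} : Set (Fin (2 * n))) = {r | π r q} → π p q := by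
    intro p q h
    have : p ∈ {r | π r p} := π.refl p
    rw [h] at this
    exact this
  have hopp := ((isPartition_iff π).1 hπ).1
  let c : Fin (2 * n) → Set (Fin (2 * n)) := fun p => {r | π r p}
  have hset : {K | K ∈ π.classes ∧ ¬ IsZeroBlock π K} =
      c '' (signedReps π : Set (Fin (2 * n))) ∪
        (fun p => c (opp p)) '' (signedReps π : Set (Fin (2 * n))) := by
    ext K
    constructor
    · rintro ⟨⟨p, rfl⟩, hK⟩
      rw [isZeroBlock_iff hπ] at hK
      obtain ⟨t, ht, h1 | h1⟩ := exists_signedRep hπ hK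
      · refine Or.inl ⟨t, ht, ?_⟩
        ext r
        exact ⟨fun h => π.trans h (π.symm h1), fun h => π.trans h h1⟩
      · refine Or.inr ⟨t, ht, ?_⟩
        ext r
        exact ⟨fun h => π.trans h (π.symm h1), fun h => π.trans h h1⟩
    · rintro (⟨t, ht, rfl⟩ | ⟨t, ht, rfl⟩)
      · exact ⟨π.mem_classes t, fun h => (mem_signedReps.1 ht).1 ((isZeroBlock_iff hπ).1 h)⟩
      · refine ⟨π.mem_classes (opp t), fun h => (mem_signedReps.1 ht).1 ?_⟩
        have := hopp _ _ ((isZeroBlock_iff hπ).1 h)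
        rwa [opp_opp] at this
  have hinj1 : Set.InjOn c (signedReps π : Set (Fin (2 * n))) := fun s hs t ht h =>
    signedReps_eq hπ hs ht (Or.inl (hcls _ _ h))
  have hinj2 : Set.InjOn (fun p => c (opp p)) (signedReps π : Set (Fin (2 * n))) :=
    fun s hs t ht h => signedReps_eq hπ hs ht (Or.inl (by
      have := hopp _ _ (hcls _ _ h)
      rwa [opp_opp, opp_opp] at this))
  rw [hset, Set.ncard_union_eq, hinj1.ncard_image, hinj2.ncard_image,
    Set.ncard_coe_finset]
  · omega
  · rw [Set.disjoint_left]
    rintro K ⟨s, hs, rfl⟩ ⟨t, ht, h⟩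
    exact not_rel_opp hπ hs ht (π.symm (hcls _ _ h))

end Count

lemma nzbk_join (π π' : Setoid (Fin (2 * n))) :
    nzbk (join π π') = Module.finrank ℚ (oddInv π ⊓ oddInv π' : Submodule ℚ (Fin (2 * n) → ℚ)) := by
  rw [nzbk_eq_finrank (join_isLeast π π').1.1, oddInv_join]

lemma opp_ne {p : Fin (2 * n)} : opp p ≠ p := by
  have := p.isLt
  rw [Ne, Fin.ext_iff]
  unfold opp
  split_ifs with h
  · simp only; omega
  · simp only; omega

/-! ### Isolating a site and joins -/

/-- One linear condition undoes the isolation, since oddness takes care of `-i`. If `i` is in the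
zero block, the condition forces `f i = 0`: either `y = -i`, or `y` still lies in a zero block after
the isolation. -/
lemma oddInv_isolate_inf {π : Setoid (Fin (2 * n))} (hπ : IsPartition π) {i y : Fin (2 * n)}
    (hy : π i y) (hne : y ≠ i) {f : Fin (2 * n) → ℚ} (hf : f ∈ oddInv (isolate i π))
    (hfy : f i = f y) : f ∈ oddInv π := by
  have hopp := ((isPartition_iff π).1 hπ).1
  obtain ⟨h1, h2⟩ := hf
  have hz : ∀ p, p ≠ i → p ≠ opp i → π p (opp p) → f p = 0 := by
    intro p g1 g2 g3
    have := h2 p (opp p) (Or.inr ⟨g3, ⟨g1, g2⟩, fun h => g2 (by rw [← h, opp_opp]), fun h => g1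
      (by rw [← opp_opp p, h, opp_opp])⟩)
    rw [h1] at this
    linarith
  have hi0 : π i (opp i) → f i = 0 := by
    intro h
    by_cases hyi : y = opp i
    · rw [hyi, h1] at hfy
      linarith
    · rw [hfy]
      exact hz y hne hyi (π.trans (π.symm hy) (π.trans h (hopp _ _ hy)))
  have key : ∀ p, π i p → f p = f i := by
    intro p hp
    by_cases hpi : p = i
    · rw [hpi]
    by_cases hpo : p = opp i
    · rw [hpo] at hp ⊢
      rw [h1, hi0 hp, neg_zero]
    by_cases hyi : y = opp i
    · rw [hyi] at hy
      rw [hi0 hy]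
      exact hz p hpi hpo (π.trans (π.symm hp) (π.trans hy (hopp _ _ hp)))
    · rw [hfy]
      exact h2 p y (Or.inr ⟨π.trans (π.symm hp) hy, ⟨hpi, hpo⟩, hne, hyi⟩)
  have key' : ∀ p, π (opp i) p → f p = f (opp i) := by
    intro p hp
    have h3 := hopp _ _ hp
    rw [opp_opp] at h3
    have := key _ h3
    rw [h1] at this
    rw [h1]
    linarith
  refine ⟨h1, fun p q hpq => ?_⟩
  by_cases c1 : p = i
  · subst c1; exact (key q hpq).symm
  by_cases c2 : p = opp i
  · subst c2; exact (key' q hpq).symm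
  by_cases c3 : q = i
  · subst c3; exact key p (π.symm hpq)
  by_cases c4 : q = opp i
  · subst c4; exact key' p (π.symm hpq)
  exact h2 p q (Or.inr ⟨hpq, ⟨c1, c2⟩, c3, c4⟩)

lemma finrank_inf_ker {V : Type*} [AddCommGroup V] [Module ℚ V] [FiniteDimensional ℚ V]
    (W : Submodule ℚ V) (φ : V →ₗ[ℚ] ℚ) {e : V} (he : e ∈ W) (hφ : φ e ≠ 0) :
    Module.finrank ℚ (W ⊓ LinearMap.ker φ : Submodule ℚ V) + 1 = Module.finrank ℚ W := by
  have h0 : φ.comp W.subtype ≠ 0 := fun h => hφ (by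
    have := LinearMap.congr_fun h ⟨e, he⟩
    simpa using this)
  rw [← Module.Dual.finrank_ker_add_one_of_ne_zero (f := φ.comp W.subtype) h0, LinearMap.ker_comp,
    ← Submodule.map_comap_subtype W (LinearMap.ker φ)]
  congr 1
  exact Submodule.finrank_map_subtype_eq W _

lemma finrank_isolate_add_one {π π' : Setoid (Fin (2 * n))} (hπ : IsPartition π)
    {i y : Fin (2 * n)} (hy : π i y) (hne : y ≠ i) :
    Module.finrank ℚ (oddInv π ⊓ oddInv (isolate i π') : Submodule ℚ (Fin (2 * n) → ℚ)) + 1 =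
      Module.finrank ℚ
        (oddInv (isolate i π) ⊓ oddInv (isolate i π') : Submodule ℚ (Fin (2 * n) → ℚ)) := by
  classical
  let φ : (Fin (2 * n) → ℚ) →ₗ[ℚ] ℚ :=
    LinearMap.proj (R := ℚ) (φ := fun _ => ℚ) i - LinearMap.proj (R := ℚ) (φ := fun _ => ℚ) y
  -- After isolation the value at `i` is free. This vector lies in both isolated spaces, and `φ`
  -- takes the value `1` on it, or `2` if `y = -i`, so `φ` cuts the dimension by exactly one.
  let e : Fin (2 * n) → ℚ := fun p => (if p = i then 1 else 0) - (if p = opp i then 1 else 0)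
  have hoi : ∀ p, opp p = i ↔ p = opp i := fun p =>
    ⟨fun h => by rw [← h, opp_opp], fun h => by rw [h, opp_opp]⟩
  have hoi' : ∀ p, opp p = opp i ↔ p = i := fun p =>
    ⟨fun h => by rw [← opp_opp p, h, opp_opp], fun h => by rw [h]⟩
  have he : ∀ ρ : Setoid (Fin (2 * n)), e ∈ oddInv (isolate i ρ) := by
    intro ρ
    refine ⟨fun p => ?_, fun p q hpq => ?_⟩
    · simp only [e, hoi, hoi']
      ring
    · rcases hpq with rfl | ⟨-, ⟨h1, h2⟩, h3, h4⟩
      · rfl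
      · simp [e, h1, h2, h3, h4]
  have heq : oddInv π ⊓ oddInv (isolate i π') =
      oddInv (isolate i π) ⊓ oddInv (isolate i π') ⊓ LinearMap.ker φ := by
    ext f
    simp only [Submodule.mem_inf, LinearMap.mem_ker]
    constructor
    · rintro ⟨h1, h2⟩
      exact ⟨⟨oddInv_anti (isolate_le i π) h1, h2⟩, by simp [φ, h1.2 _ _ hy]⟩
    · rintro ⟨⟨h1, h2⟩, h3⟩
      refine ⟨oddInv_isolate_inf hπ hy hne h1 ?_, h2⟩
      simpa [φ, sub_eq_zero] using h3
  rw [heq, finrank_inf_ker _ φ (Submodule.mem_inf.2 ⟨he π, he π'⟩)]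
  have h1 : opp i ≠ i := opp_ne
  simp only [φ, e, LinearMap.sub_apply, LinearMap.proj_apply, if_neg hne, if_neg h1.symm, if_true]
  split_ifs <;> norm_num

open Classical in
/-- Isolating `i` is self-adjoint up to the obvious factors. -/
lemma nzbk_join_isolate {π π' : Setoid (Fin (2 * n))} (hπ : IsPartition π) (hπ' : IsPartition π')
    (i : Fin (2 * n)) :
    nzbk (join (isolate i π) π') + (if ∃ y, y ≠ i ∧ π i y then 0 else 1) =
      nzbk (join π (isolate i π')) + (if ∃ y, y ≠ i ∧ π' i y then 0 else 1) := by
  -- Both sides are compared with the join in which both partitions are isolated: restoring one of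
  -- them costs one dimension unless `i` was a singleton in it.
  have key : ∀ π π' : Setoid (Fin (2 * n)), IsPartition π →
      nzbk (join π (isolate i π')) + 1 = nzbk (join (isolate i π) (isolate i π')) +
        (if ∃ y, y ≠ i ∧ π i y then 0 else 1) := by
    intro π π' hπ
    split_ifs with h
    · obtain ⟨y, h1, h2⟩ := h
      rw [nzbk_join, nzbk_join, finrank_isolate_add_one hπ h2 h1, add_zero]
    · push Not at h
      rw [isolate_eq_self hπ fun q hq => by_contra fun hne => h q hne hq]
  have hc : ∀ π π' : Setoid (Fin (2 * n)), nzbk (join π π') = nzbk (join π' π) := fun π π' => by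
    rw [nzbk_join, nzbk_join, inf_comm]
  have h1 := key π π' hπ
  have h2 := key π' π hπ'
  rw [hc π', hc (isolate i π')] at h2
  omega

lemma nzbk_join_congr {π π' τ τ' : Setoid (Fin (2 * n))}
    (h : oddInv π ⊓ oddInv π' = oddInv τ ⊓ oddInv τ') : nzbk (join π π') = nzbk (join τ τ') := by
  rw [nzbk_join, nzbk_join, h]

end TypeB

namespace TypeB
variable {n : ℕ} {h : ℤ → ℤ}

/-! ### How the arcs change under a move -/

/-- Raising changes only the arcs at the two steps of the valley. The first exclusion keeps the
starting vertex of the arc fixed; the second one keeps its closing vertex fixed, which could be a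
translate of `k` only for the arc from `a`. -/
lemma IsArc.raise {k a c d : ℤ} (hh : IsPath n h) (hb : IsArc h a (k - 1))
    (hc : IsArc h c d) (h1 : ¬ (2 * n : ℤ) ∣ c - k) (h2 : ¬ (2 * n : ℤ) ∣ c - a) :
    IsArc (raise n h k) c d := by
  refine ⟨hc.1, ?_, fun x hx hx' => ?_⟩
  · rw [raise_of_not_dvd h1, raise_of_not_dvd, hc.2.1]
    intro hd
    apply h2
    have e := hb.shift hh hd
    rw [show k - 1 + (d + 1 - k) = d by ring] at e
    have := hc.left_unique e
    rwa [show c - a = d + 1 - k by omega]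
  · rw [raise_of_not_dvd h1]
    exact (hc.2.2 x hx hx').trans_le (le_raise _ _)

lemma isArc_raise_self {k : ℤ} (hk : IsValley h k) : IsArc (raise n h k) (k - 1) k := by
  have h1 := isPeak_raise (n := n) hk
  refine ⟨by omega, by rw [h1.1, h1.2], fun x hx hx' => ?_⟩
  rw [show x = k by omega, h1.1]
  omega

/-- The arcs `(a, k - 1)` and `(k, b)` are reconnected to `(a, b)` and `(k - 1, k)`. The excluded
case is that of a single arc running around the annulus from `k` back to `k`. -/
lemma isArc_raise {k a b : ℤ} (hh : IsPath n h) (hb : IsArc h a (k - 1)) (ha : IsArc h k b)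
    (h1 : ¬ (2 * n : ℤ) ∣ a - k) : IsArc (raise n h k) a b := by
  have e1 := hb.2.1
  rw [sub_add_cancel] at e1
  have e2 := ha.1
  have e3 := hb.1
  have h2 : ¬ (2 * n : ℤ) ∣ b + 1 - k := by
    intro hd
    apply h1
    have e := hb.shift hh hd
    rw [show k - 1 + (b + 1 - k) = b by ring] at e
    have := ha.left_unique e
    rw [show a - k = -(b + 1 - k) by omega]
    exact (dvd_neg).2 hd
  refine ⟨by omega, by rw [raise_of_not_dvd h1, raise_of_not_dvd h2, ha.2.1, e1],
    fun x hx hx' => ?_⟩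
  rw [raise_of_not_dvd h1]
  rcases lt_trichotomy x k with hxk | hxk | hxk
  · exact (hb.2.2 x hx (by omega)).trans_le (le_raise _ _)
  · rw [hxk, raise_of_dvd (x := k) (by simp)]
    omega
  · rw [← e1]
    exact (ha.2.2 x hxk hx').trans_le (le_raise _ _)

section Lower

variable {p a b r : ℤ}

lemma lower_of_bounds (hh : IsPath n h) (hn : 0 < n) (H : IsChild h p a b r) {x : ℤ}
    (h1 : p ≤ x) (h2 : x ≤ r + 1) (h3 : ¬ (a < x ∧ x ≤ b)) : lower n h a b x = h x := by
  apply lower_of_not_mem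
  rintro T ⟨t, rfl⟩ ⟨h4, h5⟩
  have e1 := H.outer.lt_add hh hn
  have e2 := H.inner.1
  have e3 := H.left
  have e4 := H.right
  rcases lt_trichotomy t 0 with ht | ht | ht
  · have : (2 * n : ℤ) * t ≤ -(2 * n) := by nlinarith
    omega
  · subst ht
    simp only [mul_zero, add_zero] at h4 h5
    exact h3 ⟨h4, h5⟩
  · have : (2 * n : ℤ) ≤ (2 * n : ℤ) * t := by nlinarith
    omega

/-- Lowering turns the up step at `a` into a down step, which now closes the arc from `p`;
symmetrically the step at `b` opens the arc to `r`. -/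
lemma isArc_lower_left (hh : IsPath n h) (hn : 0 < n) (H : IsChild h p a b r) :
    IsArc (lower n h a b) p a := by
  have e2 := H.inner.1
  have e3 := H.left
  have e4 := H.right
  have e5 := H.height
  refine ⟨e3, ?_, fun x hx hx' => ?_⟩
  · rw [lower_of_bounds hh hn H le_rfl (by omega) (by omega),
      lower_of_mem (x := a + 1) (dvd_zero _) (by omega) (by omega), H.inner.up hh, e5]
    ring
  · rw [lower_of_bounds hh hn H le_rfl (by omega) (by omega),
      lower_of_bounds hh hn H (by omega) (by omega) (by omega)]
    exact H.outer.2.2 x hx (by omega)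

lemma isArc_lower_right (hh : IsPath n h) (hn : 0 < n) (H : IsChild h p a b r) :
    IsArc (lower n h a b) b r := by
  have e2 := H.inner.1
  have e3 := H.left
  have e4 := H.right
  have e5 := H.height
  have e6 : lower n h a b b = h p := by
    rw [lower_of_mem (x := b) (dvd_zero _) (by omega) (by omega), H.inner.down hh, e5]
    ring
  refine ⟨e4, ?_, fun x hx hx' => ?_⟩
  · rw [e6, lower_of_bounds hh hn H (by omega) (by omega) (by omega), H.outer.2.1]
  · rw [e6, lower_of_bounds hh hn H (by omega) (by omega) (by omega)]
    exact H.outer.2.2 x (by omega) (by omega)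

lemma IsArc.lower {c d : ℤ} (hh : IsPath n h) (H : IsChild h p a b r) (hc : IsArc h c d)
    (h1 : ¬ (2 * n : ℤ) ∣ c - p) (h2 : ¬ (2 * n : ℤ) ∣ c - a) : IsArc (lower n h a b) c d := by
  rcases lower_cases n h a b c with ⟨T, hT, g1, g2, g3⟩ | ⟨g1, g2⟩
  · have hs := H.shift hh hT
    have hlt : d < b + T := by
      have e1 := hs.inner.2.1
      have e2 := hs.inner.2.2 c g1 g2
      by_contra hge
      rcases eq_or_ne d (b + T) with rfl | hne
      · have := hc.2.1
        omega
      · have := hc.2.2 (b + T + 1) (by omega) (by omega)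
        omega
    refine ⟨hc.1, ?_, fun x hx hx' => ?_⟩
    · rw [g3, lower_of_mem (x := d + 1) hT (by have := hc.1; omega) (by omega), hc.2.1]
    · rw [g3, lower_of_mem (x := x) hT (by omega) (by omega)]
      have := hc.2.2 x hx hx'
      omega
  · refine ⟨hc.1, ?_, fun x hx hx' => ?_⟩
    · rw [g2, lower_of_not_mem, hc.2.1]
      rintro T hT ⟨g3, g4⟩
      have hs := H.inner.shift hh hT
      have e1 := hs.2.2 (d + 1) g3 g4
      have e2 := hc.2.1
      have e3 := hc.1
      have := g1 T hT
      have hne : c ≠ a + T := by rintro rfl; exact h2 (by simpa using hT)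
      have := hc.2.2 (a + T) (by omega) (by omega)
      omega
    · rw [g2]
      rcases lower_cases n h a b x with ⟨T, hT, k1, k2, k3⟩ | ⟨k1, k2⟩
      · have hs := H.shift hh hT
        have e1 := hs.inner.2.2 x k1 k2
        have := g1 T hT
        have hne : c ≠ a + T := by rintro rfl; exact h2 (by simpa using hT)
        have hne' : c ≠ p + T := by rintro rfl; exact h1 (by simpa using hT)
        have e2 := hc.2.2 (a + T) (by omega) (by omega)
        have e3 := hs.height
        have e4 : h c ≠ h (p + T) := by
          intro heq
          have := hs.left
          rcases lt_or_gt_of_ne hne' with h5 | h5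
          · have := hc.2.2 (p + T) h5 (by omega)
            omega
          · have := hs.outer.2.2 c h5 (by have := hs.right; omega)
            omega
        omega
      · rw [k2]
        exact hc.2.2 x hx hx'

end Lower

/-! ### Spin vectors -/

section Spin

variable {K : Type*} [Field K] [NeZero n]

/-- The contribution of a spin down at the step `a`. -/
noncomputable def minus (lam : K) (s : Fin (2 * n) → Bool) (a : ℤ) : K :=
  if s (res n a) then lam ^ (a / (2 * n)) else 0

/-- The contribution of a spin up at the step `a`. -/
noncomputable def plus (lam : K) (s : Fin (2 * n) → Bool) (a : ℤ) : K :=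
  if s (res n a) then 0 else lam ^ (-(a / (2 * n)))

/-- The contribution of an arc. -/
noncomputable def cup (q lam : K) (a b : ℤ) (s : Fin (2 * n) → Bool) : K :=
  minus lam s b * plus lam s a + q * (plus lam s b * minus lam s a)

open Classical in
/-- The down step matched with an up step. -/
noncomputable def partner (h : ℤ → ℤ) (a : ℤ) : ℤ :=
  if H : ∃ b, IsArc h a b then H.choose else a

lemma IsArc.partner_eq {a b : ℤ} (H : IsArc h a b) : partner h a = b := by
  have hex : ∃ b, IsArc h a b := ⟨b, H⟩
  rw [partner, dif_pos hex]
  exact hex.choose_spec.right_unique H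

/-- The contribution of a step: that of its arc if it goes up. -/
noncomputable def stepWeight (q lam : K) (h : ℤ → ℤ) (x : ℤ) (s : Fin (2 * n) → Bool) : K :=
  if h (x + 1) = h x + 1 then cup q lam x (partner h x) s else 1

/-- The spin vector of a path. -/
noncomputable def spinVec (q lam : K) (h : ℤ → ℤ) (s : Fin (2 * n) → Bool) : K :=
  ∏ c : Fin (2 * n), stepWeight q lam h c.val s

/-- The two ends of an arc carry opposite spins, so their winding exponents enter with opposite
signs and only the difference matters. -/
lemma cup_shift {q lam : K} (hl : lam ≠ 0) {T : ℤ} (hT : (2 * n : ℤ) ∣ T) (a b : ℤ)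
    (s : Fin (2 * n) → Bool) : cup q lam (a + T) (b + T) s = cup q lam a b s := by
  unfold cup minus plus
  rw [res_add_dvd hT, res_add_dvd hT, Int.add_ediv_of_dvd_right hT, Int.add_ediv_of_dvd_right hT]
  generalize T / (2 * n) = t
  generalize a / (2 * (n : ℤ)) = x
  generalize b / (2 * (n : ℤ)) = y
  have h1 : lam ^ (y + t) * lam ^ (-(x + t)) = lam ^ y * lam ^ (-x) := by
    rw [← zpow_add₀ hl, ← zpow_add₀ hl]; congr 1; ring
  have h2 : lam ^ (-(y + t)) * lam ^ (x + t) = lam ^ (-y) * lam ^ x := by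
    rw [← zpow_add₀ hl, ← zpow_add₀ hl]; congr 1; ring
  split_ifs <;> simp only [mul_zero, zero_mul, add_zero, zero_add, h1, h2]

lemma stepWeight_shift {q lam : K} (hl : lam ≠ 0) (hh : IsPath n h) {T : ℤ}
    (hT : (2 * n : ℤ) ∣ T) (x : ℤ) (s : Fin (2 * n) → Bool) :
    stepWeight q lam h (x + T) s = stepWeight q lam h x s := by
  unfold stepWeight
  rw [show x + T + 1 = x + 1 + T by ring, hh.period_dvd hT, hh.period_dvd hT]
  split_ifs with hu
  · obtain ⟨b, hb, -⟩ := hh.exists_arc_of_up (Nat.pos_of_neZero n) hu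
    rw [hb.partner_eq, (hb.shift hh hT).partner_eq, cup_shift hl hT]
  · rfl

lemma stepWeight_res {q lam : K} (hl : lam ≠ 0) (hh : IsPath n h) (x : ℤ)
    (s : Fin (2 * n) → Bool) :
    stepWeight q lam h ((res n x).val : ℤ) s = stepWeight q lam h x s := by
  have hT : (2 * n : ℤ) ∣ (res n x).val - x := by rw [← res_eq_iff, res_natCast]
  rw [← stepWeight_shift hl hh hT x]
  congr 1
  ring

lemma IsArc.stepWeight_eq (q lam : K) (hh : IsPath n h) {a b : ℤ} (H : IsArc h a b)
    (s : Fin (2 * n) → Bool) : stepWeight q lam h a s = cup q lam a b s := by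
  rw [stepWeight, if_pos (H.up hh), H.partner_eq]

lemma IsArc.stepWeight_right (q lam : K) (hh : IsPath n h) {a b : ℤ} (H : IsArc h a b)
    (s : Fin (2 * n) → Bool) : stepWeight q lam h b s = 1 := by
  rw [stepWeight, if_neg]
  have := H.down hh
  have := H.2.1
  omega

/-! ### The Temperley-Lieb operators on functions of spins -/

/-- Replace the spins at the two steps of the vertex `k`. -/
def respin (k : ℤ) (s : Fin (2 * n) → Bool) (x y : Bool) : Fin (2 * n) → Bool :=
  Function.update (Function.update s (res n (k - 1)) x) (res n k) y

/-- The Temperley-Lieb operator at the vertex `k`. -/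
noncomputable def contract (q lam : K) (k : ℤ) (F : (Fin (2 * n) → Bool) → K)
    (s : Fin (2 * n) → Bool) : K :=
  q⁻¹ * cup q lam (k - 1) k s *
    ∑ x : Bool, ∑ y : Bool, cup q lam⁻¹ (k - 1) k (respin k s x y) * F (respin k s x y)

lemma res_pred_ne (k : ℤ) : res n (k - 1) ≠ res n k := by
  have := Nat.pos_of_neZero n
  rw [Ne, res_eq_iff]
  exact not_dvd_of_abs_lt (by omega) (by omega) (by omega)

lemma respin_right (k : ℤ) (s : Fin (2 * n) → Bool) (x y : Bool) :
    respin k s x y (res n k) = y := by simp [respin]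

lemma respin_left (k : ℤ) (s : Fin (2 * n) → Bool) (x y : Bool) :
    respin k s x y (res n (k - 1)) = x := by simp [respin, res_pred_ne]

lemma respin_of_ne {k a : ℤ} (h1 : res n a ≠ res n (k - 1)) (h2 : res n a ≠ res n k)
    (s : Fin (2 * n) → Bool) (x y : Bool) : respin k s x y (res n a) = s (res n a) := by
  simp [respin, h1, h2]

lemma respin_respin (k : ℤ) (s : Fin (2 * n) → Bool) (x y x' y' : Bool) :
    respin k (respin k s x y) x' y' = respin k s x' y' := by
  ext c
  by_cases h1 : c = res n k
  · subst h1; rw [respin_right, respin_right]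
  by_cases h2 : c = res n (k - 1)
  · subst h2; rw [respin_left, respin_left]
  · simp [respin, h1, h2]

lemma respin_self (k : ℤ) (s : Fin (2 * n) → Bool) :
    respin k s (s (res n (k - 1))) (s (res n k)) = s := by
  ext c
  by_cases h1 : c = res n k
  · subst h1; rw [respin_right]
  by_cases h2 : c = res n (k - 1)
  · subst h2; rw [respin_left]
  · simp [respin, h1]

lemma cup_respin {q lam : K} {k a b : ℤ} (h1 : res n a ≠ res n (k - 1)) (h2 : res n a ≠ res n k)
    (h3 : res n b ≠ res n (k - 1)) (h4 : res n b ≠ res n k) (s : Fin (2 * n) → Bool)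
    (x y : Bool) : cup q lam a b (respin k s x y) = cup q lam a b s := by
  simp only [cup, minus, plus, respin_of_ne h1 h2, respin_of_ne h3 h4]

/-- A factor that ignores the two spins at `k` passes through the operator; this makes all later
computations local. -/
lemma contract_mul {q lam : K} {k : ℤ} (C R : (Fin (2 * n) → Bool) → K)
    (hR : ∀ s x y, R (respin k s x y) = R s) (s : Fin (2 * n) → Bool) :
    contract q lam k (fun s => C s * R s) s = contract q lam k C s * R s := by
  unfold contract
  rw [mul_assoc _ _ (R s), Finset.sum_mul]
  simp only [Finset.sum_mul, hR, mul_assoc]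

/-! ### Local relations: closing a loop and reconnecting arcs -/

section Contract

variable {q lam : K} {k a b : ℤ}

/-- The cup paired with itself gives `1 + q²`, as the powers of `lam` and `lam⁻¹` cancel, and `q⁻¹`
turns this into the loop weight. -/
lemma contract_cup_self (hq : q ≠ 0) (hl : lam ≠ 0) (s : Fin (2 * n) → Bool) :
    contract q lam k (cup q lam (k - 1) k) s = (q + q⁻¹) * cup q lam (k - 1) k s := by
  unfold contract
  have hA := zpow_ne_zero ((k - 1) / (2 * n)) hl
  have hB := zpow_ne_zero (k / (2 * n)) hl
  simp only [Fintype.sum_bool, cup, minus, plus, respin_left, respin_right, inv_zpow, zpow_neg]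
  generalize lam ^ ((k - 1) / (2 * (n : ℤ))) = A at *
  generalize lam ^ (k / (2 * (n : ℤ))) = B at *
  simp only [if_true, Bool.false_eq_true, if_false]
  field_simp
  ring

lemma contract_valley (hq : q ≠ 0) (hl : lam ≠ 0) (h1 : res n a ≠ res n (k - 1))
    (h2 : res n a ≠ res n k) (h3 : res n b ≠ res n (k - 1)) (h4 : res n b ≠ res n k)
    (s : Fin (2 * n) → Bool) :
    contract q lam k (fun s => cup q lam a (k - 1) s * cup q lam k b s) s =
      cup q lam (k - 1) k s * cup q lam a b s := by
  unfold contract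
  rw [mul_comm q⁻¹, mul_assoc]
  congr 1
  have hA := zpow_ne_zero ((k - 1) / (2 * n)) hl
  have hB := zpow_ne_zero (k / (2 * n)) hl
  simp only [Fintype.sum_bool, cup, minus, plus, respin_left, respin_right,
    respin_of_ne h1 h2, respin_of_ne h3 h4, inv_zpow, zpow_neg]
  generalize lam ^ ((k - 1) / (2 * (n : ℤ))) = A at *
  generalize lam ^ (k / (2 * (n : ℤ))) = B at *
  simp only [if_true, Bool.false_eq_true, if_false]
  field_simp
  ring

lemma contract_up (hq : q ≠ 0) (hl : lam ≠ 0) (h1 : res n a ≠ res n (k - 1))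
    (h2 : res n a ≠ res n k) (h3 : res n b ≠ res n (k - 1)) (h4 : res n b ≠ res n k)
    (s : Fin (2 * n) → Bool) :
    contract q lam k (fun s => cup q lam (k - 1) b s * cup q lam k a s) s =
      cup q lam (k - 1) k s * cup q lam a b s := by
  unfold contract
  rw [mul_comm q⁻¹, mul_assoc]
  congr 1
  have hA := zpow_ne_zero ((k - 1) / (2 * n)) hl
  have hB := zpow_ne_zero (k / (2 * n)) hl
  simp only [Fintype.sum_bool, cup, minus, plus, respin_left, respin_right,
    respin_of_ne h1 h2, respin_of_ne h3 h4, inv_zpow, zpow_neg]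
  generalize lam ^ ((k - 1) / (2 * (n : ℤ))) = A at *
  generalize lam ^ (k / (2 * (n : ℤ))) = B at *
  simp only [if_true, Bool.false_eq_true, if_false]
  field_simp
  ring

lemma contract_down (hq : q ≠ 0) (hl : lam ≠ 0) (h1 : res n a ≠ res n (k - 1))
    (h2 : res n a ≠ res n k) (h3 : res n b ≠ res n (k - 1)) (h4 : res n b ≠ res n k)
    (s : Fin (2 * n) → Bool) :
    contract q lam k (fun s => cup q lam a k s * cup q lam b (k - 1) s) s =
      cup q lam (k - 1) k s * cup q lam a b s := by
  unfold contract
  rw [mul_comm q⁻¹, mul_assoc]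
  congr 1
  have hA := zpow_ne_zero ((k - 1) / (2 * n)) hl
  have hB := zpow_ne_zero (k / (2 * n)) hl
  simp only [Fintype.sum_bool, cup, minus, plus, respin_left, respin_right,
    respin_of_ne h1 h2, respin_of_ne h3 h4, inv_zpow, zpow_neg]
  generalize lam ^ ((k - 1) / (2 * (n : ℤ))) = A at *
  generalize lam ^ (k / (2 * (n : ℤ))) = B at *
  simp only [if_true, Bool.false_eq_true, if_false]
  field_simp
  ring

/-- An arc around the whole circle contributes the weight `lam + lam⁻¹ = 1`. -/
lemma contract_around (hq : q ≠ 0) (hl : lam ≠ 0) (hl1 : lam + lam⁻¹ = 1)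
    (s : Fin (2 * n) → Bool) :
    contract q lam k (cup q lam k (k - 1 + 2 * n)) s = cup q lam (k - 1) k s := by
  unfold contract
  rw [mul_comm q⁻¹, mul_assoc]
  conv_rhs => rw [← mul_one (cup q lam (k - 1) k s)]
  congr 1
  have hA := zpow_ne_zero ((k - 1) / (2 * n)) hl
  have hB := zpow_ne_zero (k / (2 * n)) hl
  have hn : (2 * n : ℤ) ≠ 0 := by have := Nat.pos_of_neZero n; omega
  simp only [Fintype.sum_bool, cup, minus, plus, respin_left, respin_right,
    res_add_dvd (dvd_refl (2 * n : ℤ)), Int.add_ediv_of_dvd_right (dvd_refl (2 * n : ℤ)), Int.ediv_self hn,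
    neg_add, zpow_add₀ hl, zpow_one, inv_zpow, zpow_neg]
  generalize lam ^ ((k - 1) / (2 * (n : ℤ))) = A at *
  generalize lam ^ (k / (2 * (n : ℤ))) = B at *
  simp only [if_true, Bool.false_eq_true, if_false]
  field_simp at hl1 ⊢
  linear_combination (q * A * B) * hl1

end Contract

end Spin
end TypeB

/-! ### Spin vectors transform like paths -/

namespace TypeB
variable {n : ℕ} {h h' : ℤ → ℤ}

section Spin

variable {K : Type*} [Field K] [NeZero n] {q lam : K} {k : ℤ}

/-- The steps at `k` belong to arcs whose up steps are in `S`. -/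
def Covers (h : ℤ → ℤ) (j : ℤ) (S : Finset (Fin (2 * n))) : Prop :=
  ∃ a b, IsArc h a b ∧ (j = a ∨ j = b) ∧ res n a ∈ S

lemma stepWeight_respin (hh : IsPath n h) {S : Finset (Fin (2 * n))}
    (h1 : Covers h (k - 1) S) (h2 : Covers h k S) {c : Fin (2 * n)} (hc : c ∉ S)
    (s : Fin (2 * n) → Bool) (x y : Bool) :
    stepWeight q lam h c.val (respin k s x y) = stepWeight q lam h c.val s := by
  by_cases hu : h (c.val + 1) = h c.val + 1
  · obtain ⟨d, hd, -⟩ := hh.exists_arc_of_up (Nat.pos_of_neZero n) hu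
    rw [hd.stepWeight_eq q lam hh, hd.stepWeight_eq q lam hh]
    have key : ∀ j, Covers h j S → res n c.val ≠ res n j ∧ res n d ≠ res n j := by
      rintro j ⟨a, b, hab, hj, ha⟩
      have aux : ∀ e, (2 * n : ℤ) ∣ e → c.val = a + e → False := by
        rintro e he h3
        apply hc
        rwa [← res_natCast c, h3, res_add_dvd he]
      have hud : h (d + 1) = h d - 1 := by have := hd.down hh; have := hd.2.1; omega
      constructor
      · intro heq
        rw [res_eq_iff] at heq
        have hs := hab.shift hh heq
        rcases hj with rfl | rfl
        · exact aux _ heq (by ring)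
        · rw [show j + (c.val - j) = (c.val : ℤ) by ring] at hs
          have := hs.down hh
          have := hs.2.1
          omega
      · intro heq
        rw [res_eq_iff] at heq
        have hs := hab.shift hh heq
        rcases hj with rfl | rfl
        · rw [show j + (d - j) = d by ring] at hs
          have := hs.up hh
          omega
        · rw [show j + (d - j) = d by ring] at hs
          exact aux _ heq (hd.left_unique hs)
    exact cup_respin (key _ h1).1 (key _ h2).1 (key _ h1).2 (key _ h2).2 s x y
  · rw [stepWeight, stepWeight, if_neg hu, if_neg hu]

/-- Reduction to the arcs through the steps `k - 1` and `k`: all other arcs are common to the two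
paths and do not see the replaced spins. The set `S` has to contain the up steps, in either path, of
all arcs that change. -/
lemma contract_spinVec (hh : IsPath n h) (hh' : IsPath n h')
    {S : Finset (Fin (2 * n))}
    (h1 : Covers h (k - 1) S) (h2 : Covers h k S)
    (hup : ∀ x, res n x ∉ S → (h' (x + 1) = h' x + 1 ↔ h (x + 1) = h x + 1))
    (harc : ∀ x d, res n x ∉ S → IsArc h x d → IsArc h' x d)
    (hS : ∀ s : Fin (2 * n) → Bool, contract q lam k (fun s => ∏ c ∈ S, stepWeight q lam h c.val s) s =
      ∏ c ∈ S, stepWeight q lam h' c.val s) :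
    contract (n := n) q lam k (spinVec q lam h) = spinVec q lam h' := by
  ext s
  have e : spinVec (n := n) q lam h = fun s => (∏ c ∈ S, stepWeight q lam h c.val s) *
      ∏ c ∈ Sᶜ, stepWeight q lam h c.val s := by
    ext s
    rw [spinVec, Finset.prod_mul_prod_compl]
  rw [e, contract_mul, hS, spinVec, ← Finset.prod_mul_prod_compl S]
  · congr 1
    refine Finset.prod_congr rfl fun c hc => ?_
    rw [Finset.mem_compl] at hc
    have hc' := hc
    rw [← res_natCast c] at hc'
    by_cases hu : h (c.val + 1) = h c.val + 1
    · obtain ⟨d, hd, -⟩ := hh.exists_arc_of_up (Nat.pos_of_neZero n) hu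
      rw [hd.stepWeight_eq q lam hh, (harc _ d hc' hd).stepWeight_eq q lam hh']
    · rw [stepWeight, stepWeight, if_neg hu, if_neg ((hup _ hc').not.2 hu)]
  · intro s x y
    exact Finset.prod_congr rfl fun c hc =>
      stepWeight_respin hh h1 h2 (Finset.mem_compl.1 hc) s x y

lemma prod_triple {a b c : ℤ} (hl : lam ≠ 0) (hh : IsPath n h) (h1 : res n a ≠ res n b)
    (h2 : res n a ≠ res n c) (h3 : res n b ≠ res n c) (s : Fin (2 * n) → Bool) :
    ∏ x ∈ {res n a, res n b, res n c}, stepWeight q lam h x.val s =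
      stepWeight q lam h a s * (stepWeight q lam h b s * stepWeight q lam h c s) := by
  rw [Finset.prod_insert (by simp [h1, h2]), Finset.prod_insert (by simp [h3]),
    Finset.prod_singleton, stepWeight_res hl hh, stepWeight_res hl hh, stepWeight_res hl hh]

lemma IsArc.res_ne (hh : IsPath n h) {a b a' b' : ℤ} (H : IsArc h a b) (H' : IsArc h a' b') :
    res n a ≠ res n b' := by
  intro heq
  rw [res_eq_iff] at heq
  have hs := H'.shift hh heq
  rw [show b' + (a - b') = a by ring] at hs
  have := hs.down hh
  have := hs.2.1
  have := H.up hh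
  omega

lemma IsArc.res_left_iff (hh : IsPath n h) {a b a' b' : ℤ} (H : IsArc h a b)
    (H' : IsArc h a' b') : res n a = res n a' ↔ res n b = res n b' := by
  rw [res_eq_iff, res_eq_iff]
  constructor
  · intro hd
    have hs := H'.shift hh hd
    rw [show a' + (a - a') = a by ring] at hs
    rwa [show b - b' = a - a' by have := H.right_unique hs; omega]
  · intro hd
    have hs := H'.shift hh hd
    rw [show b' + (b - b') = b by ring] at hs
    rwa [show a - a' = b - b' by have := H.left_unique hs; omega]

lemma contract_raise (hq : q ≠ 0) (hl : lam ≠ 0) (hl1 : lam + lam⁻¹ = 1) (hh : IsPath n h)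
    (hk : IsValley h k) : contract (n := n) q lam k (spinVec q lam h) = spinVec q lam (raise n h k) := by
  have hn := Nat.pos_of_neZero n
  have hh' := isPath_raise hh hk
  have hkk := isArc_raise_self (n := n) hk
  obtain ⟨b, hb, -⟩ := hh.exists_arc_of_up hn hk.2
  obtain ⟨a, ha, ha'⟩ := hh.exists_arc_of_down hn (b := k - 1) (by
    have := hk.1; rw [sub_add_cancel]; omega)
  have hak1 := hb.res_ne hh ha
  have hdown : ∀ s, stepWeight q lam (raise n h k) k s = 1 := hkk.stepWeight_right q lam hh'
  -- Either both steps of the valley belong to one arc around the annulus, and the operator closes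
  -- it to a loop of weight `lam + lam⁻¹`, or they belong to two different arcs, which are
  -- reconnected.
  by_cases hd : (2 * n : ℤ) ∣ a - k
  · have hbk : b = k - 1 + 2 * n := by
      have h1 := hb.lt_add hh hn
      have h2 := ha.1
      have h3 : a - k = -(2 * n) := by
        by_contra hne
        have : (2 * n : ℤ) ∣ a - k + 2 * n := dvd_add hd dvd_rfl
        exact not_dvd_of_abs_lt (by omega) (by omega) (by omega) this
      have hs := ha.shift hh (dvd_refl (2 * n : ℤ))
      rw [show a + 2 * n = k by omega] at hs
      exact hb.right_unique hs
    subst hbk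
    have hra := res_eq_iff.2 hd
    have hp : ∀ (g : ℤ → ℤ) (_ : IsPath n g) (s : Fin (2 * n) → Bool),
        ∏ x ∈ ({res n k, res n (k - 1)} : Finset (Fin (2 * n))), stepWeight q lam g x.val s =
          stepWeight q lam g k s * stepWeight q lam g (k - 1) s := by
      intro g hg s
      rw [Finset.prod_insert (by simpa using hak1), Finset.prod_singleton,
        stepWeight_res hl hg, stepWeight_res hl hg]
    refine contract_spinVec (S := {res n k, res n (k - 1)}) hh hh'
      ⟨a, _, ha, Or.inr rfl, by simp [hra]⟩ ⟨k, _, hb, Or.inl rfl, by simp⟩ ?_ ?_ ?_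
    · intro x hx
      simp only [Finset.mem_insert, Finset.mem_singleton, res_eq_iff, not_or] at hx
      rw [raise_up_iff hh hk]
      tauto
    · intro x d hx hxd
      simp only [Finset.mem_insert, Finset.mem_singleton, not_or] at hx
      refine ha.raise hh hxd (fun h => hx.1 (res_eq_iff.2 h)) fun h => hx.1 ?_
      rw [← hra]
      exact res_eq_iff.2 h
    · intro s
      simp only [hp h hh, hp _ hh', hdown, ha.stepWeight_right q lam hh, hb.stepWeight_eq q lam hh,
        hkk.stepWeight_eq q lam hh', mul_one, one_mul]
      exact contract_around hq hl hl1 s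
  · have hra : res n k ≠ res n a := fun h => hd (res_eq_iff.1 h.symm)
    have hab := isArc_raise hh ha hb hd
    have hak := ha.res_ne hh ha
    have hrb : res n b ≠ res n (k - 1) := fun h => hra ((hb.res_left_iff hh ha).2 h)
    refine contract_spinVec (S := {res n k, res n a, res n (k - 1)}) hh hh'
      ⟨a, _, ha, Or.inr rfl, by simp⟩ ⟨k, _, hb, Or.inl rfl, by simp⟩ ?_ ?_ ?_
    · intro x hx
      simp only [Finset.mem_insert, Finset.mem_singleton, res_eq_iff, not_or] at hx
      rw [raise_up_iff hh hk]
      tauto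
    · intro x d hx hxd
      simp only [Finset.mem_insert, Finset.mem_singleton, res_eq_iff, not_or] at hx
      exact ha.raise hh hxd hx.1 hx.2.1
    · intro s
      simp only [prod_triple hl hh hra hak1 hak, prod_triple hl hh' hra hak1 hak, hdown,
        ha.stepWeight_right q lam hh, hb.stepWeight_eq q lam hh, ha.stepWeight_eq q lam hh,
        hab.stepWeight_eq q lam hh', hkk.stepWeight_eq q lam hh', mul_one, one_mul]
      have := contract_valley hq hl hak hra.symm hrb (fun h => hb.res_ne hh hb h.symm) s
      rw [mul_comm (cup q lam a b s), ← this]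
      congr 1
      ext s
      ring

/-- The up steps are `p`, `a` before the move and `p`, `b` after it. Whether the slope goes up or
down decides which local relation applies. -/
lemma contract_lower (hq : q ≠ 0) (hl : lam ≠ 0) (hh : IsPath n h) {p a b r : ℤ}
    (H : IsSlope h k p a b r) :
    contract (n := n) q lam k (spinVec q lam h) = spinVec q lam (lower n h a b) := by
  have hn := Nat.pos_of_neZero n
  have hh' := isPath_lower hh hn H.inner
  have hpa := isArc_lower_left hh hn H.toIsChild
  have hbr := isArc_lower_right hh hn H.toIsChild
  have e1 := H.outer.lt_add hh hn
  have e2 := H.left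
  have e3 := H.right
  have e4 := H.inner.1
  have hrpa : res n p ≠ res n a := by
    rw [Ne, res_eq_iff]
    exact not_dvd_of_abs_lt (by omega) (by omega) (by omega)
  have hrpb := H.outer.res_ne hh H.inner
  have hrab := H.inner.res_ne hh H.inner
  have hrpr := H.outer.res_ne hh H.outer
  have hrar := H.inner.res_ne hh H.outer
  have hrbr : res n b ≠ res n r := fun h => hrpa ((H.outer.res_left_iff hh H.inner).2 h.symm)
  have hcov : Covers h (k - 1) {res n p, res n a, res n b} ∧
      Covers h k {res n p, res n a, res n b} := by
    rcases H.vertex with ⟨h1, h2⟩ | ⟨h1, h2⟩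
    · exact ⟨⟨p, r, H.outer, Or.inl (by omega), by simp⟩, ⟨a, b, H.inner, Or.inl h1, by simp⟩⟩
    · exact ⟨⟨a, b, H.inner, Or.inr (by omega), by simp⟩, ⟨p, r, H.outer, Or.inr h2, by simp⟩⟩
  refine contract_spinVec (S := {res n p, res n a, res n b}) hh hh' hcov.1 hcov.2 ?_ ?_ ?_
  · intro x hx
    simp only [Finset.mem_insert, Finset.mem_singleton, res_eq_iff, not_or] at hx
    rw [lower_up_iff hh hn H.inner]
    tauto
  · intro x d hx hxd
    simp only [Finset.mem_insert, Finset.mem_singleton, res_eq_iff, not_or] at hx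
    exact hxd.lower hh H.toIsChild hx.1 hx.2.1
  · intro s
    simp only [prod_triple hl hh hrpa hrpb hrab, prod_triple hl hh' hrpa hrpb hrab,
      H.inner.stepWeight_right q lam hh, H.inner.stepWeight_eq q lam hh,
      H.outer.stepWeight_eq q lam hh, hpa.stepWeight_right q lam hh',
      hpa.stepWeight_eq q lam hh', hbr.stepWeight_eq q lam hh', mul_one, one_mul]
    rcases H.vertex with ⟨h1, h2⟩ | ⟨h1, h2⟩
    · obtain rfl : a = k := h1.symm
      obtain rfl : p = a - 1 := by omega
      exact contract_up hq hl hrpb.symm hrab.symm hrpr.symm hrar.symm s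
    · obtain rfl : r = k := h2.symm
      obtain rfl : b = r - 1 := by omega
      rw [contract_down hq hl hrpb hrpr hrab hrar s, mul_comm]

lemma Move.contract_eq (hq : q ≠ 0) (hl : lam ≠ 0) (hl1 : lam + lam⁻¹ = 1) (hh : IsPath n h)
    (H : Move n h k h') : contract (n := n) q lam k (spinVec q lam h) = spinVec q lam h' := by
  cases H with
  | raise H => exact contract_raise hq hl hl1 hh H
  | lower H => exact contract_lower hq hl hh H

lemma IsPeak.isArc (H : IsPeak h k) : IsArc h (k - 1) k := by
  refine ⟨by omega, by rw [H.1, H.2], fun x hx hx' => ?_⟩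
  rw [show x = k by omega, H.1]
  omega

lemma IsPeak.contract_eq (hq : q ≠ 0) (hl : lam ≠ 0) (hh : IsPath n h) (H : IsPeak h k)
    (s : Fin (2 * n) → Bool) :
    contract q lam k (spinVec q lam h) s = (q + q⁻¹) * spinVec q lam h s := by
  have e : spinVec (n := n) q lam h = fun s => cup q lam (k - 1) k s *
      ∏ c ∈ {res n (k - 1)}ᶜ, stepWeight q lam h c.val s := by
    ext s
    rw [spinVec, ← Finset.prod_mul_prod_compl {res n (k - 1)}, Finset.prod_singleton,
      stepWeight_res hl hh, H.isArc.stepWeight_eq q lam hh]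
  rw [e, contract_mul, contract_cup_self hq hl, mul_assoc]
  intro s x y
  exact Finset.prod_congr rfl fun c hc =>
    stepWeight_respin hh ⟨_, _, H.isArc, Or.inl rfl, by simp⟩
      ⟨_, _, H.isArc, Or.inr rfl, by simp⟩ (Finset.mem_compl.1 hc) s x y

/-! ### Adjointness of the operators -/

/-- On triples of a spin configuration and two further spins, exchanging the latter with the spins
at the two steps is an involution, and it interchanges the two sums. -/
lemma sum_respin (k : ℤ) (φ ψ : (Fin (2 * n) → Bool) → K) :
    ∑ s, φ s * ∑ x, ∑ y, ψ (respin k s x y) = ∑ s, (∑ x, ∑ y, φ (respin k s x y)) * ψ s := by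
  let f : (Fin (2 * n) → Bool) × Bool × Bool → (Fin (2 * n) → Bool) × Bool × Bool :=
    fun t => (respin k t.1 t.2.1 t.2.2, t.1 (res n (k - 1)), t.1 (res n k))
  have hf : Function.Involutive f := by
    rintro ⟨s, x, y⟩
    simp only [f, respin_respin, respin_self, respin_left, respin_right]
  have h1 : ∑ t : (Fin (2 * n) → Bool) × Bool × Bool, φ t.1 * ψ (respin k t.1 t.2.1 t.2.2) =
      ∑ t : (Fin (2 * n) → Bool) × Bool × Bool, φ (respin k t.1 t.2.1 t.2.2) * ψ t.1 := by
    refine Fintype.sum_equiv hf.toPerm _ _ ?_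
    rintro ⟨s, x, y⟩
    simp only [Function.Involutive.coe_toPerm, f, respin_respin, respin_self]
  simp only [Fintype.sum_prod_type] at h1
  simp only [Finset.mul_sum, Finset.sum_mul]
  exact h1

/-- The pairing of spin vectors. -/
noncomputable def pairing (q lam : K) (n : ℕ) [NeZero n] (h h' : ℤ → ℤ) : K :=
  ∑ s : Fin (2 * n) → Bool, spinVec q lam h s * spinVec q lam⁻¹ h' s

/-- As a matrix acting on the two spins, the operator is `q⁻¹` times the cup for `lam` times the
transposed cup for `lam⁻¹`, so transposing it inverts `lam`. -/
lemma sum_contract (k : ℤ) (F G : (Fin (2 * n) → Bool) → K) :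
    ∑ s, contract q lam k F s * G s = ∑ s, F s * contract q lam⁻¹ k G s := by
  have h1 := sum_respin (n := n) k (fun s => q⁻¹ * cup q lam (k - 1) k s * G s)
    (fun s => cup q lam⁻¹ (k - 1) k s * F s)
  have h2 : ∀ s, contract q lam k F s * G s = q⁻¹ * cup q lam (k - 1) k s * G s *
      ∑ x, ∑ y, cup q lam⁻¹ (k - 1) k (respin k s x y) * F (respin k s x y) := by
    intro s; rw [contract]; ring
  have h3 : ∀ s, F s * contract q lam⁻¹ k G s =
      (∑ x, ∑ y, q⁻¹ * cup q lam (k - 1) k (respin k s x y) * G (respin k s x y)) *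
        (cup q lam⁻¹ (k - 1) k s * F s) := by
    intro s
    rw [contract, inv_inv]
    simp only [mul_assoc, ← Finset.mul_sum]
    ring
  simp only [h2, h3]
  exact h1

end Spin
end TypeB

namespace TypeB
variable {n : ℕ} {h h' : ℤ → ℤ} {k : ℤ}

/-! ### The Gram matrix of the spin vectors -/

/-- The down steps at odd positions. -/
def oddDowns (n : ℕ) (h : ℤ → ℤ) : Finset (Fin (2 * n)) :=
  {c | c.val % 2 = 1 ∧ h (c.val + 1) ≠ h c.val + 1}

lemma mem_oddDowns {c : Fin (2 * n)} :
    c ∈ oddDowns n h ↔ c.val % 2 = 1 ∧ h (c.val + 1) ≠ h c.val + 1 := by simp [oddDowns]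

lemma res_val_mod_two [NeZero n] (x : ℤ) : ((res n x).val : ℤ) % 2 = x % 2 := by
  have : (2 * n : ℤ) ∣ (res n x).val - x := by rw [← res_eq_iff, res_natCast]
  have := even_of_dvd this
  omega

lemma dvd_sub_iff_eq_res [NeZero n] (c : Fin (2 * n)) (u : ℤ) :
    (2 * n : ℤ) ∣ c.val - u ↔ c = res n u := by
  rw [← res_eq_iff, res_natCast]

lemma IsPath.step_res [NeZero n] (hh : IsPath n h) (u : ℤ) :
    h ((res n u).val + 1) - h (res n u).val = h (u + 1) - h u := by
  have hd : (2 * n : ℤ) ∣ (res n u).val - u := by rw [← res_eq_iff, res_natCast]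
  rw [hh.apply_of_dvd hd, hh.apply_of_dvd (x := (res n u).val + 1) (k := u + 1)
    (by rwa [add_sub_add_right_eq_sub])]

/-- The up step that a move turns down has the parity of `k`, and the down step that it turns up has
the other parity. For odd `k` only the former affects the odd positions, for even `k` only the
latter. -/
lemma Move.card_oddDowns_odd [NeZero n] (hh : IsPath n h) (H : Move n h k h') (hk : k % 2 = 1) :
    (oddDowns n h').card = (oddDowns n h).card + 1 := by
  obtain ⟨u, v, hu, hv, hu', hv', hup⟩ := H.up_iff hh (Nat.pos_of_neZero n)
  have h1 := res_val_mod_two (n := n) u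
  have h2 := res_val_mod_two (n := n) v
  have h3 := hh.step_res u
  have hnot : res n u ∉ oddDowns n h := by
    rw [mem_oddDowns]
    rintro ⟨-, h4⟩
    exact h4 (by omega)
  rw [← Finset.card_insert_of_notMem hnot]
  congr 1
  ext c
  rw [Finset.mem_insert, mem_oddDowns, mem_oddDowns, Ne, hup, dvd_sub_iff_eq_res,
    dvd_sub_iff_eq_res]
  by_cases c1 : c = res n u
  · subst c1
    have : res n u ≠ res n v := fun h => by rw [h] at h1; omega
    simp only [not_true, and_false, this, or_false, not_false_eq_true, and_true, true_or, iff_true]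
    omega
  · by_cases c2 : c = res n v
    · subst c2
      simp only [c1, not_false_eq_true, and_true, or_true, not_true, and_false, false_or, false_iff]
      omega
    · simp [c1, c2]

lemma Move.card_oddDowns_even [NeZero n] (hh : IsPath n h) (H : Move n h k h') (hk : k % 2 = 0) :
    (oddDowns n h').card + 1 = (oddDowns n h).card := by
  obtain ⟨u, v, hu, hv, hu', hv', hup⟩ := H.up_iff hh (Nat.pos_of_neZero n)
  have h1 := res_val_mod_two (n := n) u
  have h2 := res_val_mod_two (n := n) v
  have h3 := hh.step_res v
  have hmem : res n v ∈ oddDowns n h := by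
    rw [mem_oddDowns]
    omega
  rw [← Finset.card_erase_add_one hmem]
  congr 2
  ext c
  rw [Finset.mem_erase, mem_oddDowns, mem_oddDowns, Ne, hup, dvd_sub_iff_eq_res,
    dvd_sub_iff_eq_res]
  by_cases c1 : c = res n u
  · subst c1
    have : ¬ (res n u).val % 2 = 1 := by omega
    simp [this]
  · by_cases c2 : c = res n v
    · simp [c2]
    · simp [c1, c2]

/-- The elementary move at `k`, which does nothing at a peak. -/
def Step (n : ℕ) (h : ℤ → ℤ) (k : ℤ) (h' : ℤ → ℤ) : Prop :=
  IsPeak h k ∧ h' = h ∨ Move n h k h'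

lemma Step.isPath (hh : IsPath n h) (hn : 0 < n) (H : Step n h k h') : IsPath n h' := by
  rcases H with ⟨-, rfl⟩ | H
  · exact hh
  · exact H.isPath hh hn

lemma exists_step (hh : IsPath n h) (hn : 0 < n) (k : ℤ) : ∃ h', Step n h k h' := by
  by_cases hk : IsPeak h k
  · exact ⟨h, Or.inl ⟨hk, rfl⟩⟩
  · obtain ⟨h', H⟩ := exists_move hh hn hk
    exact ⟨h', Or.inr H⟩

section Spin

variable {K : Type*} [Field K] [NeZero n] {q lam : K}

open Classical in
lemma Step.contract_eq (hq : q ≠ 0) (hl : lam ≠ 0) (hl1 : lam + lam⁻¹ = 1) (hh : IsPath n h)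
    (H : Step n h k h') (s : Fin (2 * n) → Bool) : contract q lam k (spinVec q lam h) s =
      (if IsPeak h k then q + q⁻¹ else 1) * spinVec q lam h' s := by
  rcases H with ⟨hk, rfl⟩ | H
  · rw [if_pos hk, hk.contract_eq hq hl hh]
  · rw [if_neg (H.not_isPeak hh), H.contract_eq hq hl hl1 hh, one_mul]

-- Adjointness in terms of paths: carrying the generator across the pairing changes it only by the
-- loop weights of the paths that already have a peak at `k`.
open Classical in
lemma Step.pairing_eq (hq : q ≠ 0) (hl : lam ≠ 0) (hl1 : lam + lam⁻¹ = 1) {g g' : ℤ → ℤ}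
    (hh : IsPath n h) (hg : IsPath n g) (H : Step n h k h') (G : Step n g k g') :
    (if IsPeak h k then q + q⁻¹ else 1) * pairing q lam n h' g =
      (if IsPeak g k then q + q⁻¹ else 1) * pairing q lam n h g' := by
  have h1 := sum_contract (q := q) (lam := lam) k (spinVec q lam h) (spinVec (n := n) q lam⁻¹ g)
  simp only [H.contract_eq hq hl hl1 hh, G.contract_eq hq (inv_ne_zero hl)
    (by rw [inv_inv, add_comm, hl1]) hg] at h1
  rw [pairing, pairing, Finset.mul_sum, Finset.mul_sum]
  convert h1 using 2 <;> ring

open Classical in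
lemma Step.pow_odd (hh : IsPath n h) (H : Step n h k h') (hk : k % 2 = 1) (δ : K) :
    δ ^ (oddDowns n h').card * (δ ^ 2) ^ (if IsPeak h k then 1 else 0) =
      δ ^ (oddDowns n h).card * δ * (if IsPeak h k then δ else 1) := by
  rcases H with ⟨hp, rfl⟩ | H
  · rw [if_pos hp, if_pos hp]
    ring
  · rw [if_neg (H.not_isPeak hh), if_neg (H.not_isPeak hh), H.card_oddDowns_odd hh hk]
    ring

open Classical in
lemma Step.pow_even (hh : IsPath n h) (H : Step n h k h') (hk : k % 2 = 0) (δ : K) :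
    δ ^ (oddDowns n h').card * δ = δ ^ (oddDowns n h).card * (if IsPeak h k then δ else 1) := by
  rcases H with ⟨hp, rfl⟩ | H
  · rw [if_pos hp]
  · rw [if_neg (H.not_isPeak hh), ← H.card_oddDowns_even hh hk]
    ring

end Spin

lemma Step.partitionOf_isolate [NeZero n] (hh : IsPath n h) {i : ℤ} (H : Step n h (2 * i + 1) h')
    (hh' : IsPath n h') : partitionOf hh' = isolate (res n i) (partitionOf hh) := by
  rcases H with ⟨hp, rfl⟩ | H
  · exact (isolate_eq_self (isPartition_partitionOf hh)
      fun _ hq => partitionOf_eq_of_isPeak hh hp hq).symm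
  · exact H.partitionOf_isolate hh hh'

lemma Step.mem_oddInv_iff [NeZero n] (hh : IsPath n h) {i : ℤ} (H : Step n h (2 * i + 2) h')
    (hh' : IsPath n h') (f : Fin (2 * n) → ℚ) :
    f ∈ oddInv (partitionOf hh') ↔
      f ∈ oddInv (partitionOf hh) ∧ f (res n i) = f (res n (i + 1)) := by
  rcases H with ⟨hp, rfl⟩ | H
  · exact ⟨fun hf => ⟨hf, hf.2 _ _ (partitionOf_of_isPeak hh hp)⟩, fun hf => hf.1⟩
  · constructor
    · intro hf
      exact ⟨oddInv_anti (H.le_partitionOf hh hh') hf,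
        hf.2 _ _ (partitionOf_of_isPeak hh' (H.isPeak hh (Nat.pos_of_neZero n)))⟩
    · rintro ⟨hf, hi⟩
      have := H.partitionOf_le hh hh' (isPartition_ker hf.1) (fun p q hpq => hf.2 p q hpq) hi
      exact ⟨hf.1, fun p q hpq => this hpq⟩

open Classical in
lemma exists_ne_iff [NeZero n] (hh : IsPath n h) (i : ℤ) :
    (∃ y, y ≠ res n i ∧ partitionOf hh (res n i) y) ↔ ¬ IsPeak h (2 * i + 1) :=
  ⟨fun ⟨_, h1, h2⟩ hp => h1 (partitionOf_eq_of_isPeak hh hp h2), exists_partitionOf_ne hh⟩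

section Gram

variable {K : Type*} [Field K] [NeZero n]

/-- The comparison between the chromatic join of two partitions and the pairing of the spin
vectors. -/
def GramIdentity (q lam : K) (hh : IsPath n h) (hh' : IsPath n h') : Prop :=
  ((q + q⁻¹) ^ 2) ^ nzbk (join (partitionOf hh) (partitionOf hh')) * ((q + q⁻¹) * q) ^ n =
    (q + q⁻¹) ^ ((oddDowns n h).card + (oddDowns n h').card) * pairing q lam n h h'

variable {q lam : K}

/-- Both sides obey the same exchange rule when the generator at `k` is carried from one path to the
other. For even `k` the generator imposes `f i = f (i + 1)` on an intersection of spaces, and it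
does not matter on which factor. For odd `k` the rule for `nzbk` is `nzbk_join_isolate`. The powers
counting odd down steps absorb the difference to `Step.pairing_eq`. -/
lemma gramIdentity_iff (hq : q ≠ 0) (hδ : q + q⁻¹ ≠ 0) (hl : lam ≠ 0) (hl1 : lam + lam⁻¹ = 1)
    {g g' : ℤ → ℤ} (hh : IsPath n h) (hg : IsPath n g) (hh' : IsPath n h') (hg' : IsPath n g')
    (H : Step n h k h') (G : Step n g k g') :
    GramIdentity q lam hh' hg ↔ GramIdentity q lam hh hg' := by
  classical
  have hp := Step.pairing_eq hq hl hl1 hh hg H G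
  unfold GramIdentity
  generalize q + q⁻¹ = δ at *
  rcases Int.emod_two_eq_zero_or_one k with hk | hk
  · obtain ⟨i, rfl⟩ : ∃ i, k = 2 * i + 2 := ⟨k / 2 - 1, by omega⟩
    have e1 := H.pow_even hh hk δ
    have e2 := G.pow_even hg hk δ
    have e3 : nzbk (join (partitionOf hh') (partitionOf hg)) =
        nzbk (join (partitionOf hh) (partitionOf hg')) := by
      apply nzbk_join_congr
      ext f
      simp only [Submodule.mem_inf, H.mem_oddInv_iff hh hh', G.mem_oddInv_iff hg hg']
      tauto
    have e4 : δ ^ ((oddDowns n h').card + (oddDowns n g).card) * pairing q lam n h' g =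
        δ ^ ((oddDowns n h).card + (oddDowns n g').card) * pairing q lam n h g' := by
      apply mul_left_cancel₀ hδ
      rw [pow_add, pow_add]
      linear_combination (δ ^ (oddDowns n g).card * pairing q lam n h' g) * e1 -
        (δ ^ (oddDowns n h).card * pairing q lam n h g') * e2 +
        δ ^ (oddDowns n h).card * δ ^ (oddDowns n g).card * hp
    rw [e3, e4]
  · obtain ⟨i, rfl⟩ : ∃ i, k = 2 * i + 1 := ⟨k / 2, by omega⟩
    have e1 := H.pow_odd hh hk δ
    have e2 := G.pow_odd hg hk δ
    have e3 := nzbk_join_isolate (isPartition_partitionOf hh) (isPartition_partitionOf hg) (res n i)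
    rw [← H.partitionOf_isolate hh hh', ← G.partitionOf_isolate hg hg'] at e3
    simp only [exists_ne_iff, ite_not] at e3
    have e5 := congrArg (fun m => (δ ^ 2) ^ m) e3
    simp only [pow_add] at e5
    have n1 : (δ ^ 2) ^ (if IsPeak h (2 * i + 1) then 1 else 0) ≠ 0 := by positivity
    have n2 : (δ ^ 2) ^ (if IsPeak g (2 * i + 1) then 1 else 0) ≠ 0 := by positivity
    rw [← mul_left_inj' n1, ← mul_left_inj' n2 (a := (δ ^ 2) ^ nzbk (join (partitionOf hh) _) * _)]
    have l : (δ ^ 2) ^ nzbk (join (partitionOf hh') (partitionOf hg)) * (δ * q) ^ n *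
        (δ ^ 2) ^ (if IsPeak h (2 * i + 1) then 1 else 0) =
        (δ ^ 2) ^ nzbk (join (partitionOf hh) (partitionOf hg')) * (δ * q) ^ n *
        (δ ^ 2) ^ (if IsPeak g (2 * i + 1) then 1 else 0) := by
      linear_combination (δ * q) ^ n * e5
    have r : δ ^ ((oddDowns n h').card + (oddDowns n g).card) * pairing q lam n h' g *
        (δ ^ 2) ^ (if IsPeak h (2 * i + 1) then 1 else 0) =
        δ ^ ((oddDowns n h).card + (oddDowns n g').card) * pairing q lam n h g' *
        (δ ^ 2) ^ (if IsPeak g (2 * i + 1) then 1 else 0) := by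
      rw [pow_add, pow_add]
      linear_combination (δ ^ (oddDowns n g).card * pairing q lam n h' g) * e1 -
        (δ ^ (oddDowns n h).card * pairing q lam n h g') * e2 +
        δ ^ (oddDowns n h).card * δ ^ (oddDowns n g).card * δ * hp
    rw [l, r]

end Gram
end TypeB

/-! ### Reduction of the Gram identity to zigzag paths -/

namespace TypeB
variable {n : ℕ} {h h' : ℤ → ℤ} {k : ℤ}

/-- Lower a peak by `2`. -/
noncomputable def dent (n : ℕ) (h : ℤ → ℤ) (k : ℤ) : ℤ → ℤ := fun x => -raise n (fun y => -h y) k x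

lemma dent_of_dvd {x : ℤ} (hx : (2 * n : ℤ) ∣ x - k) : dent n h k x = h x - 2 := by
  rw [dent, raise_of_dvd hx]; ring

lemma dent_of_not_dvd {x : ℤ} (hx : ¬ (2 * n : ℤ) ∣ x - k) : dent n h k x = h x := by
  rw [dent, raise_of_not_dvd hx]; ring

lemma IsPath.neg (hh : IsPath n h) : IsPath n (fun y => -h y) :=
  ⟨fun x => by have := hh.step x; omega, fun x => by simp only [hh.period]⟩

lemma isPath_dent (hh : IsPath n h) (hk : IsPeak h k) : IsPath n (dent n h k) := by
  refine (isPath_raise hh.neg ⟨?_, ?_⟩).neg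
  · show -h (k - 1) = -h k + 1
    have := hk.1; omega
  · show -h (k + 1) = -h k + 1
    have := hk.2; omega

lemma isValley_dent (hk : IsPeak h k) : IsValley (dent n h k) k := by
  have h1 : ¬ (2 * n : ℤ) ∣ k - 1 - k := fun h => by have := even_of_dvd h; omega
  have h2 : ¬ (2 * n : ℤ) ∣ k + 1 - k := fun h => by have := even_of_dvd h; omega
  rw [IsValley, dent_of_not_dvd h1, dent_of_not_dvd h2, dent_of_dvd (x := k) (by simp), hk.1, hk.2]
  omega

lemma raise_dent : raise n (dent n h k) k = h := by
  ext x
  by_cases hx : (2 * n : ℤ) ∣ x - k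
  · rw [raise_of_dvd hx, dent_of_dvd hx]; ring
  · rw [raise_of_not_dvd hx, dent_of_not_dvd hx]

/-- Every path is obtained from a lower one by raising valleys. -/
lemma IsPath.raise_induction [NeZero n] {g : ℤ → ℤ} (hg : IsPath n g)
    (P : (ℤ → ℤ) → Prop) (hP : P g)
    (hraise : ∀ f k, IsPath n f → IsValley f k → P f → P (raise n f k)) {h : ℤ → ℤ}
    (hh : IsPath n h) (hle : ∀ x, g x ≤ h x) (hpar : (h 0 - g 0) % 2 = 0) : P h := by
  have hn := Nat.pos_of_neZero n
  obtain ⟨m, hm⟩ : ∃ m : ℕ, ∑ c : Fin (2 * n), (h c.val - g c.val) = m :=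
    ⟨_, (Int.toNat_of_nonneg (Finset.sum_nonneg fun c _ => by have := hle c.val; omega)).symm⟩
  induction m using Nat.strong_induction_on generalizing h with
  | _ m ih =>
  have hres : ∀ x, ∃ c : Fin (2 * n), h x = h c.val ∧ g x = g c.val := fun x =>
    ⟨res n x, hh.apply_of_dvd (by rw [← res_eq_iff, res_natCast]),
      hg.apply_of_dvd (by rw [← res_eq_iff, res_natCast])⟩
  by_cases hex : ∃ c : Fin (2 * n), g c.val < h c.val
  · let S : Finset (Fin (2 * n)) := {c | g c.val < h c.val}
    obtain ⟨c, hc, hmax⟩ := S.exists_max_image (fun c => h c.val) (by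
      obtain ⟨c, hc⟩ := hex
      exact ⟨c, by simpa [S] using hc⟩)
    have hc' : g c.val < h c.val := by simpa [S] using hc
    have hmax' : ∀ x, g x < h x → h x ≤ h c.val := by
      intro x hx
      obtain ⟨d, hd1, hd2⟩ := hres x
      rw [hd1]
      exact hmax d (by simp only [S, Finset.mem_filter, Finset.mem_univ, true_and]; omega)
    have hpk : IsPeak h c.val := by
      have s1 := hh.step c.val
      have s2 := hg.step c.val
      have s3 := hh.step (c.val - 1)
      have s4 := hg.step (c.val - 1)
      rw [sub_add_cancel] at s3 s4
      have m1 := hmax' (c.val + 1)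
      have m2 := hmax' (c.val - 1)
      exact ⟨by omega, by omega⟩
    have hp := isPath_dent hh hpk
    have hpar' : ∀ x, (h x - g x) % 2 = 0 := fun x => by
      have := hh.parity x 0
      have := hg.parity x 0
      omega
    rw [← raise_dent (n := n) (h := h) (k := c.val)]
    have hle' : ∀ x, g x ≤ dent n h c.val x := by
      intro x
      by_cases hx : (2 * n : ℤ) ∣ x - c.val
      · rw [dent_of_dvd hx]
        have := hh.apply_of_dvd hx
        have := hg.apply_of_dvd hx
        have := hpar' c.val
        omega
      · rw [dent_of_not_dvd hx]
        exact hle x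
    have hsum : ∑ d : Fin (2 * n), (dent n h c.val d.val - g d.val) = m - 2 := by
      rw [← hm, eq_sub_iff_add_eq, ← Finset.sum_erase_add _ _ (Finset.mem_univ c),
        ← Finset.sum_erase_add (a := c) _ (fun d : Fin (2 * n) => h d.val - g d.val)
          (Finset.mem_univ c),
        dent_of_dvd (x := (c.val : ℤ)) (by simp),
        Finset.sum_congr rfl (g := fun d : Fin (2 * n) => h d.val - g d.val)]
      · ring
      · intro d hd
        rw [dent_of_not_dvd]
        rw [dvd_sub_iff_eq_res, res_natCast]
        exact Finset.ne_of_mem_erase hd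
    have hnn : 0 ≤ ∑ d : Fin (2 * n), (dent n h c.val d.val - g d.val) :=
      Finset.sum_nonneg fun d _ => by have := hle' d.val; omega
    refine hraise _ _ hp (isValley_dent hpk) (ih (m - 2) (by omega) hp hle' ?_ (by omega))
    by_cases hx : (2 * n : ℤ) ∣ 0 - c.val
    · rw [dent_of_dvd hx]; omega
    · rw [dent_of_not_dvd hx]; omega
  · push Not at hex
    have : h = g := by
      ext x
      obtain ⟨c, h1, h2⟩ := hres x
      have := hex c
      have := hle x
      omega
    rwa [this]

lemma IsPeak.of_dvd (hh : IsPath n h) (hk : IsPeak h k) {x : ℤ} (hx : (2 * n : ℤ) ∣ x - k) :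
    IsPeak h x := by
  rw [IsPeak, hh.apply_of_dvd hx, hh.apply_of_dvd (x := x + 1) (k := k + 1)
    (by rwa [add_sub_add_right_eq_sub]), hh.apply_of_dvd (x := x - 1) (k := k - 1)
    (by rwa [sub_sub_sub_cancel_right])]
  exact hk

/-- Pair the even positions with the odd ones. -/
def evenOddEquiv (n : ℕ) : Fin n × Fin 2 ≃ Fin (2 * n) :=
  finProdFinEquiv.trans (finCongr (Nat.mul_comm _ _))

lemma evenOddEquiv_val (x : Fin n × Fin 2) : (evenOddEquiv n x).val = x.2.val + 2 * x.1.val := by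
  simp [evenOddEquiv]

lemma prod_evenOdd {M : Type*} [CommMonoid M] (F : Fin (2 * n) → M) :
    ∏ c, F c = ∏ i : Fin n, F (evenOddEquiv n (i, 0)) * F (evenOddEquiv n (i, 1)) := by
  rw [← Equiv.prod_comp (evenOddEquiv n), Fintype.prod_prod_type]
  simp only [Fin.prod_univ_two]

lemma card_odd (n : ℕ) : (Finset.univ.filter fun c : Fin (2 * n) => c.val % 2 = 1).card = n := by
  have : (Finset.univ.filter fun c : Fin (2 * n) => c.val % 2 = 1) =
      Finset.univ.image (fun i : Fin n => evenOddEquiv n (i, 1)) := by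
    ext c
    simp only [Finset.mem_filter, Finset.mem_image, Finset.mem_univ, true_and, Fin.ext_iff,
      evenOddEquiv_val, Fin.val_one]
    constructor
    · intro h
      exact ⟨⟨c.val / 2, by omega⟩, by simp only; omega⟩
    · rintro ⟨i, hi⟩
      omega
  rw [this, Finset.card_image_of_injective _ fun i j hij => by simpa using hij, Finset.card_univ,
    Fintype.card_fin]

lemma card_oddDowns_zigzag (h1 : ∀ i, IsPeak h (2 * i + 1)) : (oddDowns n h).card = n := by
  refine Eq.trans (congrArg Finset.card (Finset.filter_congr fun c _ => and_iff_left_of_imp ?_))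
    (card_odd n)
  intro hc
  have := (h1 (c.val / 2)).2
  rw [show 2 * (c.val / 2 : ℤ) + 1 = c.val by omega] at this
  omega

section Zigzag

variable [NeZero n] {g : ℤ → ℤ}

/-- With peaks at all odd vertices both partitions consist of singletons, and the positive labels
represent the `n` pairs of blocks. -/
lemma nzbk_join_zigzag (hh : IsPath n h) (hg : IsPath n g) (h1 : ∀ i, IsPeak h (2 * i + 1))
    (h2 : ∀ i, IsPeak g (2 * i + 1)) : nzbk (join (partitionOf hh) (partitionOf hg)) = n := by
  have hn := Nat.pos_of_neZero n
  have e1 : ∀ p q, partitionOf hh p q ↔ p = q := by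
    intro p q
    constructor
    · intro H
      obtain ⟨i, rfl⟩ := exists_res p
      exact (partitionOf_eq_of_isPeak hh (h1 i) H).symm
    · rintro rfl
      exact (partitionOf hh).refl p
  have e2 : ∀ p q, partitionOf hg p q ↔ p = q := by
    intro p q
    constructor
    · intro H
      obtain ⟨i, rfl⟩ := exists_res p
      exact (partitionOf_eq_of_isPeak hg (h2 i) H).symm
    · rintro rfl
      exact (partitionOf hg).refl p
  have e3 : partitionOf hg = partitionOf hh := by ext p q; rw [e1, e2]
  rw [nzbk_join, e3, inf_idem, finrank_oddInv (isPartition_partitionOf hh)]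
  have : signedReps (partitionOf hh) = Finset.univ.filter (fun p : Fin (2 * n) => p.val < n) := by
    ext p
    simp only [mem_signedReps, e1, Finset.mem_filter, Finset.mem_univ, true_and, or_imp,
      forall_and, le_refl, forall_eq', true_and]
    constructor
    · rintro ⟨-, h3⟩
      by_contra h4
      rw [opp, dif_neg h4, Fin.le_def] at h3
      simp only at h3
      omega
    · intro h3
      refine ⟨opp_ne.symm, ?_⟩
      rw [opp, dif_pos h3, Fin.le_def]
      simp
  rw [this, Fin.card_filter_val_lt]
  omega

variable {K : Type*} [Field K] {q lam : K}

lemma spinVec_zigzag (hh : IsPath n h) (h1 : ∀ i, IsPeak h (2 * i + 1)) (s : Fin (2 * n) → Bool) :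
    spinVec q lam h s = ∏ i : Fin n, ((if s (evenOddEquiv n (i, 1)) ∧ ¬ s (evenOddEquiv n (i, 0))
      then 1 else 0) + q * (if ¬ s (evenOddEquiv n (i, 1)) ∧ s (evenOddEquiv n (i, 0))
      then 1 else 0)) := by
  rw [spinVec, prod_evenOdd]
  refine Finset.prod_congr rfl fun i _ => ?_
  have e0 : ((evenOddEquiv n (i, 0)).val : ℤ) = 2 * i.val := by simp [evenOddEquiv_val]
  have e1 : ((evenOddEquiv n (i, 1)).val : ℤ) = 2 * i.val + 1 := by
    simp [evenOddEquiv_val, add_comm]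
  have r0 := res_natCast (evenOddEquiv n (i, 0))
  have r1 := res_natCast (evenOddEquiv n (i, 1))
  have H := (h1 i.val).isArc
  rw [add_sub_cancel_right] at H
  rw [e0] at r0 ⊢
  rw [e1] at r1 ⊢
  have := i.isLt
  rw [H.stepWeight_eq q lam hh, H.stepWeight_right q lam hh, mul_one, cup, minus, minus, plus, plus,
    r0, r1, Int.ediv_eq_zero_of_lt (by omega) (by omega),
    Int.ediv_eq_zero_of_lt (by omega) (by omega)]
  cases s (evenOddEquiv n (i, 0)) <;> cases s (evenOddEquiv n (i, 1)) <;> simp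

/-- The arcs join the positions `2i` and `2i + 1`, so the sum over spins factorizes into `n` equal
factors `1 + q²`. -/
lemma pairing_zigzag (hh : IsPath n h) (hg : IsPath n g)
    (h1 : ∀ i, IsPeak h (2 * i + 1)) (h2 : ∀ i, IsPeak g (2 * i + 1)) :
    pairing q lam n h g = (1 + q ^ 2) ^ n := by
  simp only [pairing, spinVec_zigzag hh h1, spinVec_zigzag hg h2, ← Finset.prod_mul_distrib]
  let e : (Fin n → Fin 2 → Bool) ≃ (Fin (2 * n) → Bool) :=
    (Equiv.curry _ _ _).symm.trans (Equiv.arrowCongr (evenOddEquiv n) (Equiv.refl Bool))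
  have he : ∀ t i j, e t (evenOddEquiv n (i, j)) = t i j := fun t i j => by
    simp [e]
  rw [← Equiv.sum_comp e]
  simp only [he]
  rw [← Fintype.prod_sum (fun (_ : Fin n) (t : Fin 2 → Bool) =>
    ((if t 1 = true ∧ ¬ t 0 = true then (1 : K) else 0) +
      q * (if ¬ t 1 = true ∧ t 0 = true then 1 else 0)) *
    ((if t 1 = true ∧ ¬ t 0 = true then (1 : K) else 0) +
      q * (if ¬ t 1 = true ∧ t 0 = true then 1 else 0))), Finset.prod_const, Finset.card_univ,
      Fintype.card_fin]
  congr 1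
  rw [← Equiv.sum_comp (finTwoArrowEquiv Bool).symm, Fintype.sum_prod_type]
  simp [sq, add_comm]

lemma gramIdentity_zigzag (hq : q ≠ 0) (hh : IsPath n h) (hg : IsPath n g)
    (h1 : ∀ i, IsPeak h (2 * i + 1)) (h2 : ∀ i, IsPeak g (2 * i + 1)) :
    GramIdentity q lam hh hg := by
  rw [GramIdentity, nzbk_join_zigzag hh hg h1 h2, card_oddDowns_zigzag h1,
    card_oddDowns_zigzag h2, pairing_zigzag hh hg h1 h2, ← pow_mul, ← two_mul, add_mul,
    inv_mul_cancel₀ hq, add_comm (q * q), sq]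

/-- Since `g` has peaks at all odd vertices, generators there fix it. They can be applied to `h`
alone until `h` has all these peaks too; none of them is lost on the way. -/
lemma gramIdentity_of_zigzag (hq : q ≠ 0) (hδ : q + q⁻¹ ≠ 0) (hl : lam ≠ 0)
    (hl1 : lam + lam⁻¹ = 1) (hg : IsPath n g) (h2 : ∀ i, IsPeak g (2 * i + 1))
    (hh : IsPath n h) : GramIdentity q lam hh hg := by
  classical
  have hn := Nat.pos_of_neZero n
  obtain ⟨m, hm⟩ : ∃ m, (Finset.univ.filter fun c : Fin (2 * n) =>
    c.val % 2 = 1 ∧ ¬ IsPeak h c.val).card = m := ⟨_, rfl⟩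
  induction m using Nat.strong_induction_on generalizing h with
  | _ m ih =>
  by_cases hex : ∃ c : Fin (2 * n), c.val % 2 = 1 ∧ ¬ IsPeak h c.val
  · obtain ⟨c, hc1, hc2⟩ := hex
    obtain ⟨h', H⟩ := exists_move hh hn hc2
    have hh' := H.isPath hh hn
    have hc : (c.val : ℤ) = 2 * (c.val / 2 : ℤ) + 1 := by omega
    have hpk : IsPeak g c.val := by rw [hc]; exact h2 _
    rw [← gramIdentity_iff hq hδ hl hl1 hh hg hh' hg (Or.inr H) (Or.inl ⟨hpk, rfl⟩)]
    refine ih _ ?_ hh' rfl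
    rw [← hm]
    apply Finset.card_lt_card
    rw [Finset.ssubset_iff_of_subset]
    · exact ⟨c, by simp [hc1, hc2], by simp [H.isPeak hh hn]⟩
    · intro d hd
      simp only [Finset.mem_filter, Finset.mem_univ, true_and] at hd ⊢
      exact ⟨hd.1, fun hp => hd.2 (H.isPeak_of_even hh hn (by omega) hp)⟩
  · push Not at hex
    refine gramIdentity_zigzag hq hh hg (fun i => ?_) h2
    have h3 := res_val_mod_two (n := n) (2 * i + 1)
    refine (hex (res n (2 * i + 1)) (by omega)).of_dvd hh ?_
    rw [← res_eq_iff, res_natCast]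

/-- The Gram identity holds for all pairs of paths. -/
lemma gramIdentity (hq : q ≠ 0) (hδ : q + q⁻¹ ≠ 0) (hl : lam ≠ 0) (hl1 : lam + lam⁻¹ = 1)
    (hh : IsPath n h) (hh' : IsPath n h') : GramIdentity q lam hh hh' := by
  have hn := Nat.pos_of_neZero n
  obtain ⟨B, hB⟩ : ∃ B : ℤ, ∀ x, 2 * B + 1 ≤ h' x := by
    obtain ⟨c, -, hc⟩ := Finset.exists_min_image (Finset.univ : Finset (Fin (2 * n)))
      (fun c => h' c.val) ⟨⟨0, by omega⟩, Finset.mem_univ _⟩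
    refine ⟨(h' c.val - 1) / 2, fun x => ?_⟩
    have := hc (res n x) (Finset.mem_univ _)
    have e := hh'.apply_of_dvd (x := x) (k := (res n x).val) (by rw [← res_eq_iff, res_natCast])
    omega
  -- A zigzag with peaks at the odd vertices, strictly below `h'` and of the same parity, so that
  -- `h'` can be built from it by raising valleys.
  obtain ⟨g, hgx⟩ : ∃ g : ℤ → ℤ, ∀ x, g x = 2 * B - 2 + (h' 0) % 2 + x % 2 := ⟨_, fun _ => rfl⟩
  have hg : IsPath n g := ⟨fun x => by rw [hgx, hgx]; omega, fun x => by rw [hgx, hgx]; omega⟩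
  have hpk : ∀ i, IsPeak g (2 * i + 1) := fun i => by
    rw [IsPeak, hgx, hgx, hgx]; omega
  suffices ∀ (hf : IsPath n h') {h : ℤ → ℤ} (hh : IsPath n h), GramIdentity q lam hh hf from
    this hh' hh
  refine hg.raise_induction (fun f => ∀ (hf : IsPath n f) {h : ℤ → ℤ} (hh : IsPath n h),
    GramIdentity q lam hh hf) (fun hf h hh => gramIdentity_of_zigzag hq hδ hl hl1 hf hpk hh) ?_ hh'
    (fun x => by have := hB x; rw [hgx]; omega) (by rw [hgx]; omega)
  intro f k hf hk ih hr h hh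
  obtain ⟨h₁, H⟩ := exists_step hh hn k
  -- The last raise of the second path is carried over to the first one, which is arbitrary in the
  -- induction hypothesis.
  rw [← gramIdentity_iff hq hδ hl hl1 hh hf (H.isPath hh hn) hr H (Or.inr (Move.raise hk))]
  exact ih hf _

end Zigzag
end TypeB

namespace TypeB

/-! ### Straightening -/

/-- The determinant of a matrix that is triangular with respect to a grading of the indices. -/
lemma det_of_graded {ι R : Type*} [Fintype ι] [DecidableEq ι] [CommRing R] (M : Matrix ι ι R)
    (φ : ι → ℕ) (h : ∀ i j, M i j ≠ 0 → i = j ∨ φ j < φ i) : M.det = ∏ i, M i i := by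
  rw [Matrix.det_apply, Finset.sum_eq_single (1 : Equiv.Perm ι)]
  · simp
  · intro σ _ hσ
    suffices ∏ i, M (σ i) i = 0 by rw [this, smul_zero]
    by_contra hne
    have hall : ∀ i, σ i = i ∨ φ i < φ (σ i) := fun i =>
      h _ _ fun h0 => hne (Finset.prod_eq_zero (Finset.mem_univ i) h0)
    obtain ⟨i, hi⟩ : ∃ i, σ i ≠ i := by
      by_contra hc
      push Not at hc
      exact hσ (Equiv.ext hc)
    have := Finset.sum_lt_sum (s := Finset.univ) (f := φ) (g := fun i => φ (σ i))
      (fun i _ => by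
        rcases hall i with e | e
        · rw [e]
        · exact e.le)
      ⟨i, Finset.mem_univ i, (hall i).resolve_left hi⟩
    rw [Equiv.sum_comp σ φ] at this
    exact lt_irrefl _ this
  · simp

/-! ### Sorting a list of spins by neighbouring exchanges -/

section Lists

variable {K V : Type*} [CommRing K] [AddCommGroup V] [Module K V] {q : K} {Φ : List Bool → V}

/-- The number of pairs `true … false` in a list. -/
def inversions : List Bool → ℕ
  | [] => 0
  | false :: T => inversions T
  | true :: T => T.count false + inversions T

/-- The rearrangement without inversions. -/
def straighten (T : List Bool) : List Bool :=
  List.replicate (T.count false) false ++ List.replicate (T.count true) true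

lemma move_right (hΦ : ∀ P T, Φ (P ++ true :: false :: T) = -q • Φ (P ++ false :: true :: T))
    (m : ℕ) (P T : List Bool) : Φ (P ++ true :: (List.replicate m false ++ T)) =
      (-q) ^ m • Φ (P ++ (List.replicate m false ++ true :: T)) := by
  induction m generalizing P with
  | zero => simp
  | succ m ih =>
    have := ih (P ++ [false])
    simp only [List.append_assoc, List.singleton_append] at this
    rw [List.replicate_succ, List.cons_append, hΦ, this, smul_smul, pow_succ', List.cons_append]

lemma move_left (hΦ : ∀ P T, Φ (P ++ true :: false :: T) = -q • Φ (P ++ false :: true :: T))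
    (m : ℕ) (P T : List Bool) : Φ (P ++ (List.replicate m true ++ false :: T)) =
      (-q) ^ m • Φ (P ++ false :: (List.replicate m true ++ T)) := by
  induction m generalizing P with
  | zero => simp
  | succ m ih =>
    have := ih (P ++ [true])
    simp only [List.append_assoc, List.singleton_append] at this
    rw [List.replicate_succ, List.cons_append, this, hΦ, smul_smul, pow_succ, List.cons_append]

lemma eq_smul_straighten
    (hΦ : ∀ P T, Φ (P ++ true :: false :: T) = -q • Φ (P ++ false :: true :: T))
    (P T : List Bool) : Φ (P ++ T) = (-q) ^ inversions T • Φ (P ++ straighten T) := by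
  induction T generalizing P with
  | nil => simp [inversions, straighten]
  | cons t T ih =>
    have := ih (P ++ [t])
    simp only [List.append_assoc, List.singleton_append] at this
    rw [this]
    cases t with
    | false => simp [inversions, straighten, List.replicate_succ]
    | true =>
      rw [straighten, move_right hΦ, smul_smul, inversions, add_comm, pow_add]
      simp [straighten, List.replicate_succ]

end Lists

/-! ### Products of nested arcs and the straightening relation -/

section Algebra

variable {K A : Type*} [CommRing K] [CommRing A] [Algebra K A] (q : K) (x y : ℕ → A)

/-- The contribution of an arc between two positions. -/
def arcTerm (a b : ℕ) : A := x b * y a + q • (y b * x a)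

/-- The monomial given by a list of positions and a list of spins. -/
def mono : List ℕ → List Bool → A
  | u :: U, t :: T => (if t then x u else y u) * mono U T
  | _, _ => 1

@[simp] lemma mono_nil (T : List Bool) : mono x y [] T = 1 := by cases T <;> rfl

@[simp] lemma mono_cons (u : ℕ) (U : List ℕ) (t : Bool) (T : List Bool) :
    mono x y (u :: U) (t :: T) = (if t then x u else y u) * mono x y U T := rfl

lemma mono_append {U : List ℕ} {T : List Bool} (h : U.length = T.length) (U' : List ℕ)
    (T' : List Bool) : mono x y (U ++ U') (T ++ T') = mono x y U T * mono x y U' T' := by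
  induction U generalizing T with
  | nil =>
    rw [List.length_nil, eq_comm, List.length_eq_zero_iff] at h
    simp [h]
  | cons u U ih =>
    cases T with
    | nil => simp at h
    | cons t T => simp [ih (by simpa using h), mul_assoc]

/-- Products of nested arcs on the positions below `N`. The list contains the free positions, none
of which lies below an arc, from the last one to the first; the last argument is the number of
arcs. -/
inductive Nested : ℕ → A → List ℕ → ℕ → Prop
  | nil : Nested 0 1 [] 0
  | free {N : ℕ} {f : A} {U : List ℕ} {c : ℕ} : Nested N f U c → Nested (N + 1) f (N :: U) c
  | close {N a : ℕ} {f : A} {U : List ℕ} {c : ℕ} :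
      Nested N f (a :: U) c → Nested (N + 1) (f * arcTerm q x y a N) U (c + 1)

variable {q x y}

lemma Nested.length {N : ℕ} {f : A} {U : List ℕ} {c : ℕ} (H : Nested q x y N f U c) :
    U.length + 2 * c = N := by
  induction H with
  | nil => rfl
  | free _ ih => simp only [List.length_cons]; omega
  | close _ ih => simp only [List.length_cons] at ih; omega

/-- No free position lies between two neighbouring free ones, so joining them keeps the arcs nested.
The induction goes back to the moment when `b` was read and closes the arc there instead. -/
lemma Nested.close_adjacent {N : ℕ} {f : A} {U : List ℕ} {c : ℕ} (H : Nested q x y N f U c)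
    {U₁ U₂ : List ℕ} {a b : ℕ} (hU : U = U₁ ++ b :: a :: U₂) :
    Nested q x y N (f * arcTerm q x y a b) (U₁ ++ U₂) (c + 1) := by
  induction H generalizing U₁ with
  | nil => simp at hU
  | @free N f U c H ih =>
    cases U₁ with
    | nil =>
      simp only [List.nil_append, List.cons.injEq] at hU
      obtain ⟨rfl, rfl⟩ := hU
      exact H.close
    | cons u U₁ =>
      simp only [List.cons_append, List.cons.injEq] at hU
      obtain ⟨rfl, rfl⟩ := hU
      exact (ih rfl).free
  | @close N d f U c H ih =>
    subst hU
    have := (ih (U₁ := d :: U₁) rfl).close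
    rwa [mul_right_comm] at this

variable (q x y) in
/-- The span of the products of at least `c` nested arcs and of spins on the free positions, with
`k` spins down in total. -/
def arcSpan (N k c : ℕ) : Submodule K A :=
  Submodule.span K {g | ∃ f U d T, Nested q x y N f U d ∧ c ≤ d ∧ T.length = U.length ∧
    T.count true + d = k ∧ g = f * mono x y U T}

lemma Nested.mem_arcSpan {N : ℕ} {f : A} {U : List ℕ} {c : ℕ} (H : Nested q x y N f U c)
    {T : List Bool} (hT : T.length = U.length) :
    f * mono x y U T ∈ arcSpan q x y N (T.count true + c) c :=
  Submodule.subset_span ⟨f, U, c, T, H, le_rfl, hT, rfl, rfl⟩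

/-- The class of a monomial modulo more arcs. -/
def monoClass (N k c : ℕ) (f : A) (U : List ℕ) (T : List Bool) : A ⧸ arcSpan q x y N k (c + 1) :=
  if T.length = U.length ∧ T.count true + c = k then
    (arcSpan q x y N k (c + 1)).mkQ (f * mono x y U T) else 0

/-- The two sides differ by a multiple of `arcTerm`, that is, by a product with one more arc.
Because the class is zero for lists of the wrong shape, the relation holds for all lists and the
sorting lemmas apply. -/
lemma Nested.monoClass_swap {N k : ℕ} {f : A} {U : List ℕ} {c : ℕ} (H : Nested q x y N f U c)
    (P T : List Bool) : monoClass (q := q) (x := x) (y := y) N k c f U (P ++ true :: false :: T) =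
      -q • monoClass N k c f U (P ++ false :: true :: T) := by
  unfold monoClass
  have e1 : (P ++ true :: false :: T).length = (P ++ false :: true :: T).length := by simp
  have e2 : (P ++ true :: false :: T).count true = (P ++ false :: true :: T).count true := by
    simp
  rw [e1, e2]
  split_ifs with hc
  · obtain ⟨h1, h2⟩ := hc
    have hP : P.length ≤ U.length := by rw [← h1]; simp
    obtain ⟨U₁, U', rfl, hU₁⟩ : ∃ U₁ U', U = U₁ ++ U' ∧ U₁.length = P.length :=
      ⟨U.take P.length, U.drop P.length, (List.take_append_drop _ _).symm, by simp [hP]⟩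
    obtain ⟨b, a, U₂, rfl⟩ : ∃ b a U₂, U' = b :: a :: U₂ := by
      simp only [List.length_append, List.length_cons] at h1
      match U' with
      | [] => simp at h1; omega
      | [_] => simp at h1; omega
      | b :: a :: U₂ => exact ⟨b, a, U₂, rfl⟩
    have hm := (H.close_adjacent rfl).mem_arcSpan (T := P ++ T) (by simp at h1 ⊢; omega)
    rw [show (P ++ T).count true + (c + 1) = k by simp at h2 ⊢; omega] at hm
    rw [← map_smul, ← sub_eq_zero, ← map_sub, Submodule.mkQ_apply, Submodule.Quotient.mk_eq_zero]
    convert hm using 1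
    rw [mono_append _ _ hU₁, mono_append _ _ hU₁, mono_append _ _ hU₁]
    simp only [mono_cons, if_true, Bool.false_eq_true, if_false, arcTerm, Algebra.smul_def, map_neg]
    ring
  · simp

/-- The product over the wrapping arcs. -/
def wrapProd (q lam : K) (lam' : K) (x y : ℕ → A) (Z : List (ℕ × ℕ)) : A :=
  (Z.map fun z => lam • (x z.2 * y z.1) + (q * lam') • (y z.2 * x z.1)).prod

/-- Expand the first pair `(a, b)` of `Z`, whose ends enclose the remaining `r` pairs in the list of
free positions. The term with `lam` is already sorted. In the other term a spin moves past `r`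
letters and another past `r + 1`, which costs `(-q)^(2r + 1)`. Altogether this gives the factor `lam
- lam' q^(2(r + 1))`. -/
lemma Nested.mkQ_wrapProd {lam lam' : K} {N k : ℕ} {f : A} {U : List ℕ} {c : ℕ}
    (H : Nested q x y N f U c) (Z : List (ℕ × ℕ)) {U₁ U₂ : List ℕ} {T₁ T₂ : List Bool}
    (hU : U = U₁ ++ (Z.map Prod.fst ++ ((Z.map Prod.snd).reverse ++ U₂)))
    (h₁ : U₁.length = T₁.length) (h₂ : U₂.length = T₂.length)
    (hk : T₁.count true + Z.length + T₂.count true + c = k) :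
    (arcSpan q x y N k (c + 1)).mkQ
        (f * (mono x y U₁ T₁ * wrapProd q lam lam' x y Z * mono x y U₂ T₂)) =
      (∏ j ∈ Finset.range Z.length, (lam - lam' * q ^ (2 * (j + 1)))) • monoClass N k c f U
        (T₁ ++ (List.replicate Z.length false ++ (List.replicate Z.length true ++ T₂))) := by
  induction Z generalizing U₁ U₂ T₁ T₂ with
  | nil =>
    subst hU
    rw [monoClass, if_pos]
    · simp [wrapProd, mono_append _ _ h₁]
    · simp at hk ⊢
      omega
  | cons z Z ih =>
    obtain ⟨a, b⟩ := z
    have e1 := ih (U₁ := U₁ ++ [a]) (T₁ := T₁ ++ [false]) (U₂ := b :: U₂) (T₂ := true :: T₂)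
      (by simpa using hU) (by simpa using h₁) (by simpa using h₂) (by simp at hk ⊢; omega)
    have e2 := ih (U₁ := U₁ ++ [a]) (T₁ := T₁ ++ [true]) (U₂ := b :: U₂) (T₂ := false :: T₂)
      (by simpa using hU) (by simpa using h₁) (by simpa using h₂) (by simp at hk ⊢; omega)
    have key : f * (mono x y U₁ T₁ * wrapProd q lam lam' x y ((a, b) :: Z) * mono x y U₂ T₂) =
        lam • (f * (mono x y (U₁ ++ [a]) (T₁ ++ [false]) * wrapProd q lam lam' x y Z *
          mono x y (b :: U₂) (true :: T₂))) +
        (q * lam') • (f * (mono x y (U₁ ++ [a]) (T₁ ++ [true]) * wrapProd q lam lam' x y Z *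
          mono x y (b :: U₂) (false :: T₂))) := by
      rw [mono_append _ _ h₁, mono_append _ _ h₁]
      simp only [wrapProd, List.map_cons, List.prod_cons, mono_cons, mono_nil, Algebra.smul_def,
        if_true, Bool.false_eq_true, if_false]
      ring
    rw [key, map_add, map_smul, map_smul, e1, e2]
    -- First the spin down at `a` moves to the right past the inner spins up, then the spin up at
    -- `b` moves to the left past all spins down.
    have s1 := move_right (H.monoClass_swap (k := k)) Z.length T₁
      (List.replicate Z.length true ++ false :: T₂)
    have s2 := move_left (H.monoClass_swap (k := k)) (Z.length + 1)
      (T₁ ++ List.replicate Z.length false) T₂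
    simp only [List.replicate_succ, List.cons_append, List.append_assoc] at s1 s2
    simp only [List.append_assoc, List.singleton_append]
    rw [s1, s2]
    have e3 : T₁ ++ (List.replicate (List.length ((a, b) :: Z)) false ++
        (List.replicate (List.length ((a, b) :: Z)) true ++ T₂)) =
        T₁ ++ (List.replicate Z.length false ++ false :: true ::
          (List.replicate Z.length true ++ T₂)) := by
      simp only [List.length_cons, List.replicate_succ', List.append_assoc, List.singleton_append]
      rw [← List.singleton_append (l := List.replicate Z.length true ++ T₂), ← List.append_assoc [true],
        List.singleton_append, ← List.replicate_succ, List.replicate_succ', List.append_assoc]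
      rfl
    have e4 : false :: (List.replicate Z.length true ++ true :: T₂) =
        false :: true :: (List.replicate Z.length true ++ T₂) := by
      rw [← List.singleton_append (l := T₂), ← List.append_assoc, ← List.replicate_succ',
        List.replicate_succ, List.cons_append]
    rw [e3, List.length_cons, Finset.prod_range_succ]
    have e5 : false :: (List.replicate Z.length false ++ (List.replicate Z.length true ++ true :: T₂)) =
        List.replicate Z.length false ++ false :: (List.replicate Z.length true ++ true :: T₂) := by
      rw [← List.cons_append, ← List.replicate_succ, List.replicate_succ', List.append_assoc,
        List.singleton_append]
    rw [e5, e4]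
    simp only [smul_smul, ← add_smul]
    congr 1
    have e6 : (-q) ^ Z.length * (-q) ^ (Z.length + 1) = - q ^ (2 * Z.length + 1) := by
      rw [← pow_add, ← add_assoc, ← two_mul, Odd.neg_pow ⟨_, rfl⟩]
    linear_combination (∏ j ∈ Finset.range Z.length, (lam - lam' * q ^ (2 * (j + 1)))) * q * lam' * e6

end Algebra
end TypeB

namespace TypeB

/-! ### Scanning a word -/

/-- The state of the scan of a word in which `false` is an opening and `true` a closing letter:
the arcs closed so far, the closing positions without partner in increasing order, and the stack of
the open positions. -/
structure ScanState where
  arcs : List (ℕ × ℕ)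
  closers : List ℕ
  openers : List ℕ

/-- Read the letter at the position `N`. -/
def ScanState.read (σ : ScanState) (N : ℕ) : Bool → ScanState
  | false => ⟨σ.arcs, σ.closers, N :: σ.openers⟩
  | true => match σ.openers with
    | [] => ⟨σ.arcs, σ.closers ++ [N], []⟩
    | a :: A => ⟨(a, N) :: σ.arcs, σ.closers, A⟩

/-- The state after `N` letters. -/
def scan (w : ℕ → Bool) : ℕ → ScanState
  | 0 => ⟨[], [], []⟩
  | N + 1 => (scan w N).read N (w N)

lemma scan_induction (w : ℕ → Bool) {P : ℕ → ScanState → Prop} (nil : P 0 ⟨[], [], []⟩)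
    (push : ∀ N E B A, P N ⟨E, B, A⟩ → w N = false → P (N + 1) ⟨E, B, N :: A⟩)
    (close : ∀ N E B a A, P N ⟨E, B, a :: A⟩ → w N = true → P (N + 1) ⟨(a, N) :: E, B, A⟩)
    (free : ∀ N E B, P N ⟨E, B, []⟩ → w N = true → P (N + 1) ⟨E, B ++ [N], []⟩) (N : ℕ) :
    P N (scan w N) := by
  induction N with
  | zero => exact nil
  | succ N ih =>
    rw [scan]
    generalize scan w N = σ at ih ⊢
    obtain ⟨E, B, A⟩ := σ
    cases hw : w N with
    | false => exact push _ _ _ _ ih hw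
    | true =>
      cases A with
      | nil => exact free _ _ _ ih hw
      | cons a A => exact close _ _ _ _ _ ih hw

lemma scan_congr {w w' : ℕ → Bool} {N : ℕ} (h : ∀ u < N, w u = w' u) : scan w N = scan w' N := by
  induction N with
  | zero => rfl
  | succ N ih => rw [scan, scan, ih fun u hu => h u (by omega), h N (by omega)]

lemma scan_prod {M : Type*} [CommMonoid M] (g : ℕ → M) (w : ℕ → Bool) (N : ℕ) :
    ∏ u ∈ Finset.range N, g u = ((scan w N).arcs.map fun e => g e.1 * g e.2).prod *
      (((scan w N).openers.map g).prod * ((scan w N).closers.map g).prod) := by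
  refine scan_induction w (P := fun N σ => ∏ u ∈ Finset.range N, g u =
    (σ.arcs.map fun e => g e.1 * g e.2).prod * ((σ.openers.map g).prod *
      (σ.closers.map g).prod)) (by simp) ?_ ?_ ?_ N
  · intro N E B A ih _
    rw [Finset.prod_range_succ, ih]
    simp only [List.map_cons, List.prod_cons]
    ac_rfl
  · intro N E B a A ih _
    rw [Finset.prod_range_succ, ih]
    simp only [List.map_cons, List.prod_cons]
    ac_rfl
  · intro N E B ih _
    rw [Finset.prod_range_succ, ih]
    simp only [List.map_append, List.map_nil, List.prod_append, List.map_cons, List.prod_nil,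
      List.prod_cons, mul_one, one_mul]
    ac_rfl

lemma scan_sum {M : Type*} [AddCommMonoid M] (g : ℕ → M) (w : ℕ → Bool) (N : ℕ) :
    ∑ u ∈ Finset.range N, g u = ((scan w N).arcs.map fun e => g e.1 + g e.2).sum +
      (((scan w N).openers.map g).sum + ((scan w N).closers.map g).sum) := by
  have := scan_prod (fun u => Multiplicative.ofAdd (g u)) w N
  apply_fun Multiplicative.toAdd at this
  simpa [toAdd_list_sum, Function.comp_def] using this

lemma scan_letters (w : ℕ → Bool) (N : ℕ) :
    (∀ e ∈ (scan w N).arcs, e.1 < e.2 ∧ e.2 < N ∧ w e.1 = false ∧ w e.2 = true) ∧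
    (∀ a ∈ (scan w N).openers, a < N ∧ w a = false) ∧
    (∀ b ∈ (scan w N).closers, b < N ∧ w b = true) := by
  refine scan_induction w (P := fun N σ =>
    (∀ e ∈ σ.arcs, e.1 < e.2 ∧ e.2 < N ∧ w e.1 = false ∧ w e.2 = true) ∧
    (∀ a ∈ σ.openers, a < N ∧ w a = false) ∧ (∀ b ∈ σ.closers, b < N ∧ w b = true)) (by simp)
    ?_ ?_ ?_ N
  · rintro N E B A ⟨h1, h2, h3⟩ hw
    refine ⟨fun e he => ?_, ?_, fun b hb => ?_⟩
    · have := h1 e he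
      exact ⟨this.1, by omega, this.2.2⟩
    · simp only [List.mem_cons, forall_eq_or_imp]
      exact ⟨⟨by omega, hw⟩, fun a ha => ⟨by have := h2 a ha; omega, (h2 a ha).2⟩⟩
    · exact ⟨by have := h3 b hb; omega, (h3 b hb).2⟩
  · rintro N E B a A ⟨h1, h2, h3⟩ hw
    simp only [List.mem_cons, forall_eq_or_imp] at h2 ⊢
    refine ⟨⟨⟨h2.1.1, by omega, h2.1.2, hw⟩, fun e he => ?_⟩, fun a ha => ?_, fun b hb => ?_⟩
    · have := h1 e he
      exact ⟨this.1, by omega, this.2.2⟩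
    · exact ⟨by have := h2.2 a ha; omega, (h2.2 a ha).2⟩
    · exact ⟨by have := h3 b hb; omega, (h3 b hb).2⟩
  · rintro N E B ⟨h1, -, h3⟩ hw
    refine ⟨fun e he => ?_, by simp, ?_⟩
    · have := h1 e he
      exact ⟨this.1, by omega, this.2.2⟩
    · simp only [List.mem_append, List.mem_singleton]
      rintro b (hb | rfl)
      · exact ⟨by have := h3 b hb; omega, (h3 b hb).2⟩
      · exact ⟨by omega, hw⟩

lemma scan_card_true (w : ℕ → Bool) (N : ℕ) : ((Finset.range N).filter (w · = true)).card =
    (scan w N).arcs.length + (scan w N).closers.length := by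
  obtain ⟨h1, h2, h3⟩ := scan_letters w N
  rw [Finset.card_filter, scan_sum _ w N, List.map_congr_left (g := fun _ => 1),
    List.map_congr_left (l := (scan w N).openers) (g := fun _ => 0),
    List.map_congr_left (l := (scan w N).closers) (g := fun _ => 1)]
  · simp
  · intro b hb; simp [h3 b hb]
  · intro b hb; simp [h2 b hb]
  · intro e he; simp [h1 e he]

lemma scan_length (w : ℕ → Bool) (N : ℕ) : 2 * (scan w N).arcs.length +
    (scan w N).openers.length + (scan w N).closers.length = N := by
  have := scan_sum (fun _ => 1) w N
  simp at this
  omega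

/-! ### Standard vectors span -/

section Algebra

variable {K A : Type*} [CommRing K] [CommRing A] [Algebra K A] (q : K) (x y : ℕ → A)

/-- The product of the arcs of a word. -/
def arcProd (E : List (ℕ × ℕ)) : A := (E.map fun e => arcTerm q x y e.1 e.2).prod

/-- The product of the arcs of a word and of the spins that match the other letters. -/
def stdVec (σ : ScanState) : A :=
  arcProd q x y σ.arcs * ((σ.openers.map y).prod * (σ.closers.map x).prod)

lemma mono_replicate (t : Bool) (U : List ℕ) :
    mono x y U (List.replicate U.length t) = (U.map (if t then x else y)).prod := by
  induction U with
  | nil => simp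
  | cons u U ih =>
    rw [List.length_cons, List.replicate_succ, mono_cons, ih, List.map_cons, List.prod_cons]
    cases t <;> rfl

lemma stdVec_eq (σ : ScanState) : stdVec q x y σ = arcProd q x y σ.arcs *
    mono x y (σ.openers ++ σ.closers.reverse) (List.replicate σ.openers.length false ++
      List.replicate σ.closers.length true) := by
  rw [stdVec, mono_append _ _ (by simp), mono_replicate, ← List.length_reverse (as := σ.closers),
    mono_replicate]
  simp [List.prod_reverse]

lemma scan_nested (w : ℕ → Bool) (N : ℕ) : Nested q x y N (arcProd q x y (scan w N).arcs)
    ((scan w N).openers ++ (scan w N).closers.reverse) (scan w N).arcs.length := by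
  refine scan_induction w (P := fun N σ => Nested q x y N (arcProd q x y σ.arcs)
    (σ.openers ++ σ.closers.reverse) σ.arcs.length) (by simpa [arcProd] using Nested.nil) ?_ ?_ ?_ N
  · intro N E B A ih _
    exact ih.free
  · intro N E B a A ih _
    simpa [arcProd, mul_comm] using ih.close
  · intro N E B ih _
    simpa using ih.free

variable {q x y}

/-- The word is read off from the construction: ends of arcs get their letters, the later free
positions become openers and the earlier ones unmatched closers. This order is the only one in which
the scan creates no further arcs. -/
lemma Nested.exists_scan {N : ℕ} {f : A} {U : List ℕ} {c : ℕ} (H : Nested q x y N f U c)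
    {S B : List ℕ} (hU : U = S ++ B.reverse) : ∃ w : ℕ → Bool,
      arcProd q x y (scan w N).arcs = f ∧ (scan w N).arcs.length = c ∧
      (scan w N).openers = S ∧ (scan w N).closers = B := by
  have upd : ∀ (w : ℕ → Bool) (N : ℕ) (b : Bool),
      scan (Function.update w N b) (N + 1) = (scan w N).read N b := fun w N b => by
    rw [scan, Function.update_self, scan_congr (w' := w)]
    intro u hu
    rw [Function.update_of_ne hu.ne]
  induction H generalizing S B with
  | nil =>
    simp only [List.nil_eq, List.append_eq_nil_iff, List.reverse_eq_nil_iff] at hU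
    exact ⟨fun _ => false, by simp [scan, arcProd, hU]⟩
  | @free N f U c H ih =>
    cases S with
    | nil =>
      obtain ⟨B, rfl⟩ : ∃ B', B = B' ++ [N] := by
        rw [List.nil_append, eq_comm, List.reverse_eq_cons_iff] at hU
        exact ⟨_, hU⟩
      obtain ⟨w, h1, h2, h3, h4⟩ := ih (S := []) (B := B) (by simpa using hU)
      refine ⟨Function.update w N true, ?_⟩
      rw [upd, ScanState.read, h3, h4]
      exact ⟨h1, h2, rfl, rfl⟩
    | cons a S =>
      simp only [List.cons_append, List.cons.injEq] at hU
      obtain ⟨rfl, rfl⟩ := hU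
      obtain ⟨w, h1, h2, h3, h4⟩ := ih rfl
      refine ⟨Function.update w N false, ?_⟩
      rw [upd, ScanState.read, h3, h4]
      exact ⟨h1, h2, rfl, rfl⟩
  | @close N a f U c H ih =>
    obtain ⟨w, h1, h2, h3, h4⟩ := ih (S := a :: S) (B := B) (by rw [hU]; rfl)
    refine ⟨Function.update w N true, ?_⟩
    rw [upd, ScanState.read, h3, h4]
    exact ⟨by rw [← h1]; simp [arcProd, mul_comm], by simp [h2], rfl, rfl⟩

lemma count_add_count (T : List Bool) : T.count false + T.count true = T.length := by
  induction T with
  | nil => rfl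
  | cons t T ih => cases t <;> simp <;> omega

lemma count_straighten (T : List Bool) : (straighten T).count true = T.count true := by
  simp [straighten, List.count_replicate]

lemma length_straighten (T : List Bool) : (straighten T).length = T.length := by
  rw [← count_add_count T]
  simp [straighten]

/-- Modulo more arcs a monomial is a multiple of its sorted version, which is the standard vector of
a word. The remainder is treated by downward induction on the number of arcs, which is bounded by
the number of positions. -/
lemma arcSpan_le (N k c : ℕ) : arcSpan q x y N k c ≤ Submodule.span K
    {g | ∃ w, c ≤ (scan w N).arcs.length ∧
      (scan w N).arcs.length + (scan w N).closers.length = k ∧ g = stdVec q x y (scan w N)} := by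
  obtain ⟨m, hm⟩ : ∃ m, N + 1 ≤ c + m := ⟨N + 1, by omega⟩
  induction m generalizing c with
  | zero =>
    refine Submodule.span_le.2 ?_
    rintro _ ⟨f, U, d, T, H, hd, -, -, rfl⟩
    have := H.length
    omega
  | succ m ih =>
    refine Submodule.span_le.2 ?_
    rintro _ ⟨f, U, d, T, H, hd, hT, hk, rfl⟩
    have e := eq_smul_straighten (H.monoClass_swap (k := k)) [] T
    rw [List.nil_append, List.nil_append, monoClass, monoClass, if_pos ⟨hT, hk⟩,
      if_pos ⟨by rwa [length_straighten], by rwa [count_straighten]⟩, ← map_smul, ← sub_eq_zero,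
      ← map_sub, Submodule.mkQ_apply, Submodule.Quotient.mk_eq_zero] at e
    have e' := ih (d + 1) (by omega) e
    rw [SetLike.mem_coe, ← sub_add_cancel (f * mono x y U T)]
    refine add_mem (Submodule.span_mono ?_ e') (Submodule.smul_mem _ _ (Submodule.subset_span ?_))
    · rintro _ ⟨w, h1, h2⟩
      exact ⟨w, by omega, h2⟩
    · have hc := count_add_count T
      obtain ⟨w, h1, h2, h3, h4⟩ := H.exists_scan (S := U.take (T.count false))
        (B := (U.drop (T.count false)).reverse) (by simp)
      refine ⟨w, by omega, ?_, ?_⟩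
      · rw [h2, h4]
        simp
        omega
      · have l1 : (U.take (T.count false)).length = T.count false := by simp; omega
        have l2 : (U.drop (T.count false)).reverse.length = T.count true := by simp; omega
        rw [stdVec_eq, h1, h3, h4, straighten, l1, l2, List.reverse_reverse,
          List.take_append_drop]

/-- The vector of a word on the circle, in terms of the scan. -/
def wrapVec (q lam lam' : K) (x y : ℕ → A) (σ : ScanState) : A :=
  arcProd q x y σ.arcs * wrapProd q lam lam' x y (σ.openers.zip σ.closers)

/-- The leading coefficient of `wrapVec` for a word with `r` wrapping arcs. -/
def wrapCoeff (q lam lam' : K) (r : ℕ) : K :=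
  ∏ j ∈ Finset.range r, (lam - lam' * q ^ (2 * (j + 1)))

lemma wrapVec_sub_mem (lam lam' : K) (w : ℕ → Bool) (N : ℕ)
    (hw : (scan w N).openers.length = (scan w N).closers.length) :
    wrapVec q lam lam' x y (scan w N) -
      wrapCoeff q lam lam' (scan w N).closers.length • stdVec q x y (scan w N) ∈
    Submodule.span K {g | ∃ w', (scan w N).arcs.length < (scan w' N).arcs.length ∧
      (scan w' N).arcs.length + (scan w' N).closers.length =
        (scan w N).arcs.length + (scan w N).closers.length ∧ g = stdVec q x y (scan w' N)} := by
  have hl : ((scan w N).openers.zip (scan w N).closers).length = (scan w N).closers.length := by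
    simp [hw]
  have := (scan_nested q x y w N).mkQ_wrapProd (lam := lam) (lam' := lam')
    ((scan w N).openers.zip (scan w N).closers) (U₁ := []) (U₂ := []) (T₁ := []) (T₂ := [])
    (k := (scan w N).arcs.length + (scan w N).closers.length)
    (by simp [List.map_fst_zip hw.le, List.map_snd_zip hw.ge]) rfl rfl (by simp [hw]; omega)
  rw [hl] at this
  simp only [mono_nil, one_mul, mul_one, List.nil_append, List.append_nil] at this
  rw [monoClass, if_pos (by simp [hw, List.count_replicate]; omega), ← map_smul, ← sub_eq_zero, ← map_sub,
    Submodule.mkQ_apply, Submodule.Quotient.mk_eq_zero] at this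
  rw [stdVec_eq, wrapVec, wrapCoeff, hw]
  exact arcSpan_le _ _ _ this

end Algebra
end TypeB

namespace TypeB

/-! ### The determinant of the matrix of spin vectors -/

/-- Words with as many opening as closing letters. -/
def Word (n : ℕ) : Type :=
  {w : Fin (2 * n) → Bool // (Finset.univ.filter fun c => w c = true).card = n}

instance (n : ℕ) : Fintype (Word n) := inferInstanceAs (Fintype (Subtype _))

instance (n : ℕ) : DecidableEq (Word n) := inferInstanceAs (DecidableEq (Subtype _))

/-- The letters of a finite word. -/
def letters {N : ℕ} (w : Fin N → Bool) (u : ℕ) : Bool := if h : u < N then w ⟨u, h⟩ else false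

lemma letters_val {N : ℕ} (w : Fin N → Bool) (c : Fin N) : letters w c.val = w c := by
  simp [letters]

lemma letters_restrict (w : ℕ → Bool) {N u : ℕ} (hu : u < N) :
    letters (fun c : Fin N => w c.val) u = w u := by
  simp [letters, hu]

lemma card_letters {N : ℕ} (w : Fin N → Bool) :
    ((Finset.range N).filter (letters w · = true)).card =
      (Finset.univ.filter fun c => w c = true).card := by
  rw [Finset.card_filter, Finset.card_filter, Finset.sum_range]
  simp only [letters_val]

variable {n : ℕ}

/-- The scan of a word. -/
def Word.state (w : Word n) : ScanState := scan (letters w.1) (2 * n)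

/-- The number of arcs across the end of the word. -/
def Word.rank (w : Word n) : ℕ := w.state.closers.length

lemma Word.length_arcs (w : Word n) : w.state.arcs.length + w.rank = n := by
  have := scan_card_true (letters w.1) (2 * n)
  rw [card_letters, w.2] at this
  exact this.symm

lemma Word.length_openers (w : Word n) : w.state.openers.length = w.rank := by
  have := w.length_arcs
  have := scan_length (letters w.1) (2 * n)
  unfold Word.rank Word.state at *
  omega

section

variable (K : Type*) [Field K]

/-- The indicator of a spin down. -/
def spinDown (n : ℕ) (u : ℕ) : Word n → K := fun s => if letters s.1 u then 1 else 0

/-- The indicator of a spin up. -/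
def spinUp (n : ℕ) (u : ℕ) : Word n → K := fun s => if letters s.1 u then 0 else 1

variable {K}

lemma apply_ne_zero_of_prod {ι S : Type*} {f : ι → S → K} {l : List ι} {s : S}
    (h : (l.map f).prod s ≠ 0) : ∀ e ∈ l, f e s ≠ 0 := by
  induction l with
  | nil => simp
  | cons a l ih =>
    rw [List.map_cons, List.prod_cons, Pi.mul_apply] at h
    simp only [List.mem_cons, forall_eq_or_imp]
    exact ⟨left_ne_zero_of_mul h, ih (right_ne_zero_of_mul h)⟩

lemma prod_apply_eq_one {ι S : Type*} {f : ι → S → K} {l : List ι} {s : S}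
    (h : ∀ e ∈ l, f e s = 1) : (l.map f).prod s = 1 := by
  induction l with
  | nil => simp
  | cons a l ih =>
    simp only [List.mem_cons, forall_eq_or_imp] at h
    rw [List.map_cons, List.prod_cons, Pi.mul_apply, h.1, ih h.2, mul_one]

lemma stdVec_self (q : K) (w : Word n) : stdVec q (spinDown K n) (spinUp K n) w.state w = 1 := by
  obtain ⟨h1, h2, h3⟩ := scan_letters (letters w.1) (2 * n)
  rw [stdVec, Pi.mul_apply, Pi.mul_apply, arcProd, prod_apply_eq_one, prod_apply_eq_one,
    prod_apply_eq_one, mul_one, mul_one]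
  · intro b hb
    simp [spinDown, h3 b hb]
  · intro a ha
    simp [spinUp, h2 a ha]
  · intro e he
    simp [arcTerm, spinDown, spinUp, h1 e he]

/-- The sum of the positions of the closing letters. -/
def Word.weight (w : Word n) : ℕ := ∑ u ∈ Finset.range (2 * n), if letters w.1 u then u else 0

lemma Word.ext_letters {w s : Word n} (h : ∀ u < 2 * n, letters s.1 u = letters w.1 u) : w = s := by
  refine Subtype.ext (funext fun c => ?_)
  exact (letters_val w.1 c).symm.trans ((h _ c.isLt).symm.trans (letters_val s.1 c))

/-- In the support every arc has opposite spins and all other spins agree with `w`. Reversing an arc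
moves a closing letter from its right end to its left end and so decreases the sum of positions. -/
lemma stdVec_ne_zero {q : K} {w s : Word n}
    (h : stdVec q (spinDown K n) (spinUp K n) w.state s ≠ 0) : w = s ∨ s.weight < w.weight := by
  obtain ⟨h1, h2, h3⟩ := scan_letters (letters w.1) (2 * n)
  rw [stdVec, Pi.mul_apply, Pi.mul_apply] at h
  have g1 := apply_ne_zero_of_prod (left_ne_zero_of_mul h)
  have g2 := apply_ne_zero_of_prod (left_ne_zero_of_mul (right_ne_zero_of_mul h))
  have g3 := apply_ne_zero_of_prod (right_ne_zero_of_mul (right_ne_zero_of_mul h))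
  have k1 : ∀ e ∈ w.state.arcs, letters s.1 e.1 = !letters s.1 e.2 := by
    intro e he
    have := g1 e he
    simp only [arcTerm, spinDown, spinUp, Pi.add_apply, Pi.mul_apply, Pi.smul_apply] at this
    cases e1 : letters s.1 e.1 <;> cases e2 : letters s.1 e.2 <;> simp [e1, e2] at this ⊢
  have k2 : ∀ a ∈ w.state.openers, letters s.1 a = false := by
    intro a ha
    simpa [spinUp] using g2 a ha
  have k3 : ∀ a ∈ w.state.closers, letters s.1 a = true := by
    intro a ha
    simpa [spinDown] using g3 a ha
  by_cases hex : ∃ e ∈ w.state.arcs, letters s.1 e.2 = false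
  · right
    obtain ⟨e, he, hf⟩ := hex
    rw [Word.weight, Word.weight, scan_sum _ (letters w.1), scan_sum _ (letters w.1)]
    refine add_lt_add_of_lt_of_le (List.sum_lt_sum _ _ (fun e he => ?_) ⟨e, he, ?_⟩) (le_of_eq ?_)
    · have a1 := h1 e he
      have a2 := k1 e he
      cases e2 : letters s.1 e.2 <;> simp [a1, a2, e2]
      exact a1.1.le
    · have a1 := h1 e he
      have a2 := k1 e he
      simp [a1, a2, hf]
    · congr 2
      · refine List.map_congr_left fun a ha => ?_
        rw [h2 a ha |>.2, k2 a ha]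
      · refine List.map_congr_left fun a ha => ?_
        rw [h3 a ha |>.2, k3 a ha]
  · left
    push Not at hex
    have hz := scan_sum (fun u => if letters s.1 u = letters w.1 u then 0 else 1)
      (letters w.1) (2 * n)
    rw [List.map_congr_left (g := fun _ => 0),
      List.map_congr_left (l := (scan (letters w.1) (2 * n)).openers) (g := fun _ => 0),
      List.map_congr_left (l := (scan (letters w.1) (2 * n)).closers) (g := fun _ => 0)] at hz
    · simp only [List.map_const', List.sum_replicate, smul_zero, add_zero] at hz
      rw [Finset.sum_eq_zero_iff] at hz
      refine Word.ext_letters fun u hu => ?_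
      simpa using hz u (Finset.mem_range.2 hu)
    · intro a ha
      rw [h3 a ha |>.2, k3 a ha]
      simp
    · intro a ha
      rw [h2 a ha |>.2, k2 a ha]
      simp
    · intro e he
      have a1 := h1 e he
      have a2 := k1 e he
      have a3 := hex e he
      simp only [ne_eq, Bool.not_eq_false] at a3
      simp [a1, a2, a3]

lemma det_stdVec (q : K) :
    (Matrix.of fun w s : Word n => stdVec q (spinDown K n) (spinUp K n) w.state s).det = 1 := by
  rw [det_of_graded _ Word.weight]
  · exact Finset.prod_eq_one fun w _ => stdVec_self q w
  · intro w s h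
    exact stdVec_ne_zero h

/-- The number of closing letters is always `n`, so a word with more arcs has fewer arcs across the
end. -/
lemma exists_wrapVec_expansion (q lam lam' : K) (w : Word n) : ∃ c : Word n → K,
    (∀ v, c v ≠ 0 → v.rank < w.rank) ∧ wrapVec q lam lam' (spinDown K n) (spinUp K n) w.state =
      wrapCoeff q lam lam' w.rank • stdVec q (spinDown K n) (spinUp K n) w.state +
      ∑ v, c v • stdVec q (spinDown K n) (spinUp K n) v.state := by
  have h := wrapVec_sub_mem (q := q) (x := spinDown K n) (y := spinUp K n) lam lam' (letters w.1)
    (2 * n) w.length_openers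
  have h' := Submodule.span_mono (t := (fun v : Word n =>
    stdVec q (spinDown K n) (spinUp K n) v.state) '' {v | v.rank < w.rank}) ?_ h
  · rw [Finsupp.mem_span_image_iff_linearCombination] at h'
    obtain ⟨l, hl, e⟩ := h'
    refine ⟨l, fun v hv => hl (by simpa using hv), ?_⟩
    rw [Finsupp.linearCombination_apply, Finsupp.sum_fintype _ _ (by simp)] at e
    rw [e]
    exact (add_sub_cancel _ _).symm
  · rintro _ ⟨w', h1, h2, rfl⟩
    have e : scan (letters fun c : Fin (2 * n) => w' c.val) (2 * n) = scan w' (2 * n) :=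
      scan_congr fun u hu => letters_restrict w' hu
    have hw := w.length_arcs
    let v : Word n := ⟨fun c => w' c.val, by
      rw [← card_letters, scan_card_true, e, h2]
      exact hw⟩
    have ev : v.state = scan w' (2 * n) := e
    refine ⟨v, ?_, by simp only [ev]⟩
    have hv := v.length_arcs
    change (scan (letters w.1) (2 * n)).arcs.length + w.rank = n at hw
    rw [ev] at hv
    show v.rank < w.rank
    omega

/-- The expansion writes the matrix as one that is triangular for the rank, with the leading
coefficients on the diagonal, times the matrix of standard vectors of determinant one. -/
lemma det_wrapVec (q lam lam' : K) :
    (Matrix.of fun w s : Word n => wrapVec q lam lam' (spinDown K n) (spinUp K n) w.state s).det =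
      ∏ w : Word n, wrapCoeff q lam lam' w.rank := by
  choose c hc he using fun w : Word n => exists_wrapVec_expansion q lam lam' w
  have : (Matrix.of fun w s : Word n =>
      wrapVec q lam lam' (spinDown K n) (spinUp K n) w.state s) =
      Matrix.of (fun w v => (if w = v then wrapCoeff q lam lam' w.rank else 0) + c w v) *
      Matrix.of fun w s : Word n => stdVec q (spinDown K n) (spinUp K n) w.state s := by
    ext w s
    simp only [Matrix.of_apply, Matrix.mul_apply, add_mul, ite_mul, zero_mul,
      Finset.sum_add_distrib, Finset.sum_ite_eq, Finset.mem_univ, if_true]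
    rw [he w]
    simp
  rw [this, Matrix.det_mul, det_stdVec, mul_one, det_of_graded _ Word.rank]
  · refine Finset.prod_congr rfl fun w _ => ?_
    have : c w w = 0 := by
      by_contra h
      exact lt_irrefl _ (hc w w h)
    simp [this]
  · intro w v h
    by_cases hwv : w = v
    · exact Or.inl hwv
    · simp only [Matrix.of_apply, hwv, if_false, zero_add] at h
      exact Or.inr (hc w v h)

end
end TypeB

namespace TypeB

/-! ### The path of a word -/

/-- Reading a word along a path. -/
structure ScanInvariant (h : ℤ → ℤ) (N : ℕ) (σ : ScanState) : Prop where
  arcs : ∀ e ∈ σ.arcs, IsArc h e.1 e.2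
  openers : ∀ (i a : ℕ), σ.openers[i]? = some a →
    a < N ∧ h a = h N - (i + 1) ∧ ∀ x : ℤ, a < x → x ≤ N → h a < h x
  closers : ∀ (i b : ℕ), σ.closers[i]? = some b →
    b < N ∧ h (b + 1) = h 0 - (i + 1) ∧ ∀ x : ℤ, 0 ≤ x → x ≤ b → h (b + 1) < h x
  height : h N = h 0 + σ.openers.length - σ.closers.length
  lower_bound : ∀ x : ℤ, 0 ≤ x → x ≤ N → h 0 - σ.closers.length ≤ h x

/-- The stack of the scan mirrors the heights: each waiting opener lies one level below the next one
above it in the stack, and each unmatched closer reaches a new minimum. -/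
lemma scanInvariant {h : ℤ → ℤ} {w : ℕ → Bool} {M : ℕ}
    (hw : ∀ u : ℕ, u < M → h (u + 1) = h u + if w u then -1 else 1) {N : ℕ} (hN : N ≤ M) :
    ScanInvariant h N (scan w N) := by
  refine scan_induction w (P := fun N σ => N ≤ M → ScanInvariant h N σ) ?_ ?_ ?_ ?_ N hN
  · intro _
    refine ⟨by simp, by simp, by simp, by simp, fun x h1 h2 => ?_⟩
    rw [show x = 0 by push_cast at h2; omega]
    simp
  · intro N E B A ih hf hN
    have H := ih (by omega)
    have hs := hw N (by omega)
    rw [hf] at hs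
    simp only [Bool.false_eq_true, if_false] at hs
    have hb := H.height
    refine ⟨H.arcs, fun i a ha => ?_, fun i b hb => ?_, ?_, fun x h1 h2 => ?_⟩
    · push_cast
      cases i with
      | zero =>
        simp only [List.getElem?_cons_zero, Option.some.injEq] at ha
        subst ha
        refine ⟨by omega, by push_cast; omega, fun x h1 h2 => ?_⟩
        rw [show x = N + 1 by omega]
        omega
      | succ i =>
        simp only [List.getElem?_cons_succ] at ha
        obtain ⟨h1, h2, h3⟩ := H.openers i a ha
        refine ⟨by omega, by push_cast; omega, fun x h4 h5 => ?_⟩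
        rcases eq_or_lt_of_le h5 with rfl | h6
        · omega
        · exact h3 x h4 (by omega)
    · obtain ⟨h1, h2, h3⟩ := H.closers i b hb
      exact ⟨by omega, h2, h3⟩
    · push_cast at hb ⊢
      simp only [List.length_cons] at hb ⊢
      omega
    · rcases eq_or_lt_of_le h2 with rfl | h3
      · push_cast
        simp only at hb ⊢
        omega
      · exact H.lower_bound x h1 (by push_cast at h3; omega)
  · intro N E B a A ih hf hN
    have H := ih (by omega)
    have hs := hw N (by omega)
    rw [hf, if_pos rfl] at hs
    have hb := H.height
    obtain ⟨a1, a2, a3⟩ := H.openers 0 a rfl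
    push_cast at a2
    refine ⟨?_, fun i c hc => ?_, fun i b hb => ?_, ?_, fun x h1 h2 => ?_⟩
    · simp only [List.mem_cons, forall_eq_or_imp]
      exact ⟨⟨by omega, by omega, a3⟩, H.arcs⟩
    · obtain ⟨h1, h2, h3⟩ := H.openers (i + 1) c (by simpa using hc)
      push_cast at h2 ⊢
      refine ⟨by omega, by omega, fun x h4 h5 => ?_⟩
      rcases eq_or_lt_of_le h5 with rfl | h6
      · omega
      · exact h3 x h4 (by omega)
    · obtain ⟨h1, h2, h3⟩ := H.closers i b hb
      exact ⟨by omega, h2, h3⟩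
    · push_cast at hb ⊢
      simp only [List.length_cons] at hb ⊢
      push_cast at hb
      omega
    · rcases eq_or_lt_of_le h2 with rfl | h3
      · push_cast
        simp only [List.length_cons] at hb ⊢
        push_cast at hb
        omega
      · exact H.lower_bound x h1 (by push_cast at h3; omega)
  · intro N E B ih hf hN
    have H := ih (by omega)
    have hs := hw N (by omega)
    rw [hf, if_pos rfl] at hs
    have hb := H.height
    have hl := H.lower_bound
    simp only [List.length_nil] at hb hl
    push_cast at hb
    refine ⟨H.arcs, by simp, fun i b hi => ?_, ?_, fun x h1 h2 => ?_⟩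
    · rw [List.getElem?_append] at hi
      split_ifs at hi with hlt
      · obtain ⟨h1, h2, h3⟩ := H.closers i b hi
        exact ⟨by omega, h2, h3⟩
      · rw [List.getElem?_singleton] at hi
        split_ifs at hi with h0
        simp only [Option.some.injEq] at hi
        subst hi
        have : i = B.length := by omega
        subst this
        refine ⟨by omega, by omega, fun x h1 h2 => ?_⟩
        have := hl x h1 h2
        omega
    · simp only [List.length_append, List.length_nil, List.length_singleton]
      push_cast
      omega
    · simp only [List.length_append, List.length_singleton]
      push_cast
      rcases eq_or_lt_of_le h2 with rfl | h3
      · push_cast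
        omega
      · have := hl x h1 (by push_cast at h3; omega)
        omega

variable {n : ℕ}

/-- The height after `N` letters. -/
def height (w : ℕ → Bool) (N : ℕ) : ℤ := ∑ u ∈ Finset.range N, if w u then -1 else 1

/-- The path of a word. -/
def Word.path (w : Word n) (x : ℤ) : ℤ := height (letters w.1) (x % (2 * n)).toNat

lemma height_eq (w : ℕ → Bool) (N : ℕ) :
    height w N = N - 2 * ((Finset.range N).filter (w · = true)).card := by
  have h1 : ∀ u, (if w u = true then (-1 : ℤ) else 1) =
      1 - 2 * (if w u = true then 1 else 0) := fun u => by split_ifs <;> rfl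
  rw [height, Finset.sum_congr rfl fun u _ => h1 u, Finset.sum_sub_distrib, ← Finset.mul_sum,
    Finset.sum_boole]
  simp

lemma Word.height_end (w : Word n) : height (letters w.1) (2 * n) = 0 := by
  rw [height_eq, card_letters, w.2]
  simp

lemma Word.path_natCast [NeZero n] (w : Word n) {u : ℕ} (hu : u ≤ 2 * n) :
    w.path u = height (letters w.1) u := by
  have hn := Nat.pos_of_neZero n
  rcases eq_or_lt_of_le hu with rfl | hlt
  · rw [w.height_end, Word.path]
    simp [height]
  · rw [Word.path, Int.emod_eq_of_lt (by omega) (by omega), Int.toNat_natCast]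

lemma Word.path_succ [NeZero n] (w : Word n) {u : ℕ} (hu : u < 2 * n) :
    w.path (u + 1) = w.path u + if letters w.1 u then -1 else 1 := by
  have := w.path_natCast (u := u + 1) hu
  push_cast at this
  rw [this, w.path_natCast hu.le, height, Finset.sum_range_succ]
  rfl

lemma Word.path_period (w : Word n) (x : ℤ) : w.path (x + 2 * n) = w.path x := by
  simp [Word.path]

lemma Word.isPath [NeZero n] (w : Word n) : IsPath n w.path := by
  have hn := Nat.pos_of_neZero n
  refine ⟨fun x => ?_, w.path_period⟩
  have h1 : ∀ y, w.path y = w.path (y % (2 * n)) := fun y => by simp [Word.path]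
  obtain ⟨u, hu⟩ : ∃ u : ℕ, x % (2 * n) = u :=
    ⟨_, (Int.toNat_of_nonneg (Int.emod_nonneg _ (by omega))).symm⟩
  have hlt : u < 2 * n := by
    have := Int.emod_lt_of_pos x (b := 2 * n) (by omega)
    omega
  have e1 : w.path x = w.path u := by rw [h1 x, hu]
  have e2 : w.path (x + 1) = w.path (u + 1) := by
    rw [h1 (x + 1), h1 (u + 1), ← Int.emod_add_emod, hu]
  rw [e1, e2, w.path_succ hlt]
  split_ifs <;> omega

lemma Word.scanInvariant [NeZero n] (w : Word n) : ScanInvariant w.path (2 * n) w.state := by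
  have := TypeB.scanInvariant (h := w.path) (M := 2 * n) (fun u hu => w.path_succ hu) le_rfl
  exact_mod_cast this

/-- The `i`-th opener from the top of the stack starts `i + 1` below the final height, and the
`i`-th unmatched closer ends `i + 1` below the initial height. These heights agree, so the two steps
match across the end of the period. -/
lemma Word.isArc_wrap [NeZero n] (w : Word n) {z : ℕ × ℕ}
    (hz : z ∈ w.state.openers.zip w.state.closers) : IsArc w.path z.1 (z.2 + 2 * n) := by
  obtain ⟨i, hi⟩ := List.mem_iff_getElem?.1 hz
  rw [List.getElem?_zip_eq_some] at hi
  have H := w.scanInvariant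
  obtain ⟨a1, a2, a3⟩ := H.openers i _ hi.1
  obtain ⟨b1, b2, b3⟩ := H.closers i _ hi.2
  have p0 : w.path (2 * n : ℕ) = w.path 0 := by
    have := w.path_period 0
    push_cast
    rwa [zero_add] at this
  refine ⟨by omega, ?_, fun x h1 h2 => ?_⟩
  · rw [show (z.2 + 2 * n + 1 : ℤ) = z.2 + 1 + 2 * n by ring, w.path_period]
    omega
  · by_cases hx : x ≤ (2 * n : ℕ)
    · exact a3 x h1 hx
    · have := b3 (x - 2 * n) (by push_cast at hx; omega) (by omega)
      rw [← w.path_period (x - 2 * n), sub_add_cancel] at this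
      omega

lemma prod_zip {M : Type*} [CommMonoid M] (f g : ℕ → M) {A B : List ℕ} (h : A.length = B.length) :
    (A.map f).prod * (B.map g).prod = ((A.zip B).map fun z => f z.1 * g z.2).prod := by
  induction A generalizing B with
  | nil =>
    rw [List.length_nil, eq_comm, List.length_eq_zero_iff] at h
    simp [h]
  | cons a A ih =>
    cases B with
    | nil => simp at h
    | cons b B =>
      simp only [List.map_cons, List.prod_cons, List.zip_cons_cons, ← ih (by simpa using h)]
      ac_rfl

lemma Word.zip_lt (w : Word n) {z : ℕ × ℕ} (hz : z ∈ w.state.openers.zip w.state.closers) :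
    z.1 < 2 * n ∧ z.2 < 2 * n := by
  obtain ⟨-, h2, h3⟩ := scan_letters (letters w.1) (2 * n)
  obtain ⟨a, b⟩ := z
  exact ⟨(h2 _ (List.of_mem_zip hz).1).1, (h3 _ (List.of_mem_zip hz).2).1⟩

section

variable [NeZero n] {K : Type*} [Field K] {q lam : K}

lemma Word.spinVec_path (w : Word n) (s : Fin (2 * n) → Bool) : spinVec q lam w.path s =
    (w.state.arcs.map fun e => cup q lam e.1 e.2 s).prod *
      ((w.state.openers.zip w.state.closers).map
        fun z => cup q lam z.1 (z.2 + 2 * n) s).prod := by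
  have h1 := scan_prod (fun u : ℕ => stepWeight q lam w.path u s) (letters w.1) (2 * n)
  change _ = (w.state.arcs.map _).prod * ((w.state.openers.map _).prod *
    (w.state.closers.map _).prod) at h1
  rw [Finset.prod_range, prod_zip _ _ w.length_openers] at h1
  rw [spinVec, h1]
  congr 1
  · refine congrArg List.prod (List.map_congr_left fun e he => ?_)
    have H := w.scanInvariant.arcs e he
    rw [H.stepWeight_eq q lam w.isPath, H.stepWeight_right q lam w.isPath, mul_one]
  · refine congrArg List.prod (List.map_congr_left fun e he => ?_)
    have H := w.isArc_wrap he
    rw [H.stepWeight_eq q lam w.isPath, stepWeight, if_neg, mul_one]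
    have := H.down w.isPath
    have := H.2.1
    rw [show (e.2 + 2 * n + 1 : ℤ) = e.2 + 1 + 2 * n by ring, w.path_period] at this
    rw [w.path_period] at *
    omega

lemma letters_res (s : Fin (2 * n) → Bool) {u : ℕ} (hu : u < 2 * n) :
    s (res n u) = letters s u := by
  have := res_natCast (⟨u, hu⟩ : Fin (2 * n))
  simp only at this
  rw [this, letters, dif_pos hu]

lemma cup_natCast (s : Fin (2 * n) → Bool) {a b : ℕ} (ha : a < 2 * n) (hb : b < 2 * n) :
    cup q lam a b s = (if letters s b then 1 else 0) * (if letters s a then 0 else 1) +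
      q * ((if letters s b then 0 else 1) * (if letters s a then 1 else 0)) := by
  rw [cup, minus, minus, plus, plus, letters_res s ha, letters_res s hb,
    Int.ediv_eq_zero_of_lt (by omega) (by omega), Int.ediv_eq_zero_of_lt (by omega) (by omega)]
  simp

lemma cup_wrap (s : Fin (2 * n) → Bool) {a b : ℕ} (ha : a < 2 * n) (hb : b < 2 * n) :
    cup q lam a (b + 2 * n) s =
      lam * ((if letters s b then 1 else 0) * (if letters s a then 0 else 1)) +
      q * lam⁻¹ * ((if letters s b then 0 else 1) * (if letters s a then 1 else 0)) := by
  have hn := Nat.pos_of_neZero n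
  rw [cup, minus, minus, plus, plus, res_add_dvd dvd_rfl, letters_res s ha, letters_res s hb,
    Int.add_ediv_of_dvd_right dvd_rfl, Int.ediv_self (by omega),
    Int.ediv_eq_zero_of_lt (by omega) (by omega), Int.ediv_eq_zero_of_lt (by omega) (by omega)]
  cases letters s a <;> cases letters s b <;> simp

lemma Word.spinVec_eq (w s : Word n) : spinVec q lam w.path s.1 =
    wrapVec q lam lam⁻¹ (spinDown K n) (spinUp K n) w.state s := by
  obtain ⟨h1, h2, h3⟩ := scan_letters (letters w.1) (2 * n)
  rw [w.spinVec_path, wrapVec, Pi.mul_apply, arcProd, wrapProd, Pi.list_prod_apply,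
    Pi.list_prod_apply, List.map_map, List.map_map]
  congr 1
  · refine congrArg List.prod (List.map_congr_left fun e he => ?_)
    have := h1 e he
    rw [cup_natCast _ (by omega) (by omega)]
    rfl
  · refine congrArg List.prod (List.map_congr_left fun e he => ?_)
    have := w.zip_lt he
    rw [cup_wrap _ this.1 this.2]
    rfl

/-- Each of the `n` arcs needs one spin down and one spin up, so spin vectors are supported on words
and the pairing matrix is a product of square matrices. -/
lemma Word.spinVec_eq_zero (w : Word n) {s : Fin (2 * n) → Bool}
    (hs : (Finset.univ.filter fun c => s c = true).card ≠ n) : spinVec q lam w.path s = 0 := by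
  obtain ⟨h1, h2, h3⟩ := scan_letters (letters w.1) (2 * n)
  by_contra hne
  rw [w.spinVec_path] at hne
  apply hs
  have k1 : ∀ e ∈ w.state.arcs, letters s e.1 = !letters s e.2 := by
    intro e he
    have hne := left_ne_zero_of_mul hne
    have : cup q lam e.1 e.2 s ≠ 0 := fun h0 =>
      hne (List.prod_eq_zero (List.mem_map.2 ⟨e, he, h0⟩))
    rw [cup_natCast _ (by have := h1 e he; omega) (by have := h1 e he; omega)] at this
    cases e1 : letters s e.1 <;> cases e2 : letters s e.2 <;> simp [e1, e2] at this ⊢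
  have k2 : ∀ e ∈ w.state.openers.zip w.state.closers, letters s e.1 = !letters s e.2 := by
    intro e he
    have hne := right_ne_zero_of_mul hne
    have : cup q lam e.1 (e.2 + 2 * n) s ≠ 0 := fun h0 =>
      hne (List.prod_eq_zero (List.mem_map.2 ⟨e, he, h0⟩))
    rw [cup_wrap _ (w.zip_lt he).1 (w.zip_lt he).2] at this
    cases e1 : letters s e.1 <;> cases e2 : letters s e.2 <;> simp [e1, e2] at this ⊢
  have hg := prod_zip (M := Multiplicative ℕ)
    (fun u => Multiplicative.ofAdd (if letters s u = true then 1 else 0))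
    (fun u => Multiplicative.ofAdd (if letters s u = true then 1 else 0)) w.length_openers
  have hp := scan_prod (fun u => Multiplicative.ofAdd (if letters s u = true then 1 else 0))
    (letters w.1) (2 * n)
  change _ = (w.state.arcs.map _).prod * ((w.state.openers.map _).prod *
    (w.state.closers.map _).prod) at hp
  rw [hg, List.map_congr_left (g := fun _ => Multiplicative.ofAdd 1),
    List.map_congr_left (l := w.state.openers.zip w.state.closers)
      (g := fun _ => Multiplicative.ofAdd 1)] at hp
  · rw [← card_letters, Finset.card_filter]
    apply_fun Multiplicative.toAdd at hp
    have := w.length_arcs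
    have := w.length_openers
    simp at hp
    simp
    unfold Word.rank at *
    omega
  · intro e he
    rw [k2 e he]
    cases letters s e.2 <;> rfl
  · intro e he
    rw [k1 e he]
    cases letters s e.2 <;> rfl

lemma Word.pairing_eq (v w : Word n) : pairing q lam n v.path w.path =
    ∑ s : Word n, wrapVec q lam lam⁻¹ (spinDown K n) (spinUp K n) v.state s *
      wrapVec q lam⁻¹ lam (spinDown K n) (spinUp K n) w.state s := by
  rw [pairing, ← Finset.sum_subset (Finset.subset_univ
    (Finset.univ.filter fun s : Fin (2 * n) → Bool =>
      (Finset.univ.filter fun c => s c = true).card = n))]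
  · rw [Finset.sum_subtype (p := fun s : Fin (2 * n) → Bool =>
      (Finset.univ.filter fun c => s c = true).card = n) _ (by simp)]
    refine Finset.sum_congr rfl fun s _ => ?_
    have h1 := v.spinVec_eq (q := q) (lam := lam) s
    have h2 := w.spinVec_eq (q := q) (lam := lam⁻¹) s
    rw [inv_inv] at h2
    rw [← h1, ← h2]
  · intro s _ hs
    rw [v.spinVec_eq_zero (by simpa using hs), zero_mul]

/-- The determinant of the Gram matrix of the spin vectors. -/
lemma det_pairing (hl : lam ≠ 0) (hl1 : lam + lam⁻¹ = 1) :
    (Matrix.of fun v w : Word n => pairing q lam n v.path w.path).det =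
      ∏ w : Word n, ∏ j ∈ Finset.range w.rank,
        (1 + q ^ (2 * (j + 1)) + (q ^ (2 * (j + 1))) ^ 2) := by
  have : (Matrix.of fun v w : Word n => pairing q lam n v.path w.path) =
      (Matrix.of fun w s : Word n =>
        wrapVec q lam lam⁻¹ (spinDown K n) (spinUp K n) w.state s) *
      (Matrix.of fun w s : Word n =>
        wrapVec q lam⁻¹ lam (spinDown K n) (spinUp K n) w.state s).transpose := by
    ext v w
    simp [Matrix.mul_apply, Word.pairing_eq]
  rw [this, Matrix.det_mul, Matrix.det_transpose, det_wrapVec, det_wrapVec,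
    ← Finset.prod_mul_distrib]
  refine Finset.prod_congr rfl fun w _ => ?_
  rw [wrapCoeff, wrapCoeff, ← Finset.prod_mul_distrib]
  refine Finset.prod_congr rfl fun j _ => ?_
  have h1 : lam * lam⁻¹ = 1 := mul_inv_cancel₀ hl
  generalize lam⁻¹ = mu at *
  -- This is where the weight `lam + lam⁻¹ = 1` enters: `(lam - mu t)(mu - lam t) = 1 - (lam² + mu²)
  -- t + t²` becomes `1 + t + t²`.
  have h2 : lam ^ 2 + mu ^ 2 = -1 := by linear_combination (lam + mu + 1) * hl1 - 2 * h1
  generalize q ^ (2 * (j + 1)) = t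
  linear_combination (1 + t ^ 2) * h1 - t * h2

end
end TypeB

namespace TypeB

/-! ### Counting words -/

lemma letters_snoc_of_lt {N : ℕ} (w : Fin N → Bool) (b : Bool) {u : ℕ} (hu : u < N) :
    letters (Fin.snoc w b : Fin (N + 1) → Bool) u = letters w u := by
  rw [letters, dif_pos (by omega), letters, dif_pos hu]
  exact Fin.snoc_castSucc (α := fun _ => Bool) b w ⟨u, hu⟩

lemma letters_snoc_self {N : ℕ} (w : Fin N → Bool) (b : Bool) :
    letters (Fin.snoc w b : Fin (N + 1) → Bool) N = b := by
  rw [letters, dif_pos (by omega)]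
  exact Fin.snoc_last (α := fun _ => Bool) b w

lemma scan_snoc {N : ℕ} (w : Fin N → Bool) (b : Bool) :
    scan (letters (Fin.snoc w b : Fin (N + 1) → Bool)) (N + 1) =
      (scan (letters w) N).read N b := by
  rw [scan, letters_snoc_self, scan_congr fun u hu => letters_snoc_of_lt w b hu]

/-- The number of closing letters. -/
def closings {N : ℕ} (w : Fin N → Bool) : ℕ := (Finset.univ.filter fun c => w c = true).card

/-- The number of closing letters without partner. -/
def unmatched {N : ℕ} (w : Fin N → Bool) : ℕ := (scan (letters w) N).closers.length

lemma closings_snoc {N : ℕ} (w : Fin N → Bool) (b : Bool) :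
    closings (Fin.snoc w b : Fin (N + 1) → Bool) = closings w + if b then 1 else 0 := by
  rw [closings, closings, Finset.card_filter, Finset.card_filter, Fin.sum_univ_castSucc]
  simp

lemma unmatched_le {N : ℕ} (w : Fin N → Bool) : unmatched w ≤ closings w := by
  have := scan_card_true (letters w) N
  rw [card_letters] at this
  unfold unmatched closings
  omega

lemma le_unmatched {N : ℕ} (w : Fin N → Bool) : 2 * closings w ≤ N + unmatched w := by
  have := scan_card_true (letters w) N
  have := scan_length (letters w) N
  rw [card_letters] at *
  unfold unmatched closings
  omega

lemma unmatched_snoc_false {N : ℕ} (w : Fin N → Bool) :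
    unmatched (Fin.snoc w false : Fin (N + 1) → Bool) = unmatched w := by
  rw [unmatched, scan_snoc]
  rfl

/-- Counting letters, the condition in the `if` says that no opener is waiting. -/
lemma unmatched_snoc_true {N : ℕ} (w : Fin N → Bool) :
    unmatched (Fin.snoc w true : Fin (N + 1) → Bool) =
      unmatched w + if 2 * closings w = N + unmatched w then 1 else 0 := by
  have h1 := scan_card_true (letters w) N
  have h2 := scan_length (letters w) N
  rw [card_letters] at h1
  rw [unmatched, scan_snoc, unmatched, closings]
  generalize scan (letters w) N = σ at *
  obtain ⟨E, B, A⟩ := σ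
  cases A with
  | nil =>
    rw [if_pos (by simp only [List.length_nil] at *; omega)]
    simp [ScanState.read]
  | cons a A =>
    rw [if_neg (by simp only [List.length_cons] at *; omega)]
    simp [ScanState.read]

lemma card_filter_snoc {N : ℕ} (P : (Fin (N + 1) → Bool) → Prop) [DecidablePred P] :
    (Finset.univ.filter P).card =
      (Finset.univ.filter fun w : Fin N → Bool => P (Fin.snoc w false)).card +
      (Finset.univ.filter fun w : Fin N → Bool => P (Fin.snoc w true)).card := by
  simp only [Finset.card_filter]
  rw [← Equiv.sum_comp (Fin.snocEquiv fun _ => Bool), Fintype.sum_prod_type, Fintype.sum_bool,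
    add_comm]
  rfl

lemma card_closings (N k : ℕ) :
    (Finset.univ.filter fun w : Fin N → Bool => closings w = k).card = N.choose k := by
  induction N generalizing k with
  | zero => cases k <;> simp [closings]
  | succ N ih =>
    rw [card_filter_snoc]
    simp only [closings_snoc, Bool.false_eq_true, if_false, add_zero, if_true, ih]
    cases k with
    | zero => simp
    | succ k =>
      simp only [Nat.add_right_cancel_iff, ih, Nat.choose_succ_succ]
      exact add_comm _ _

/-- The ballot theorem. -/
lemma card_unmatched (N k i : ℕ) (h1 : 2 * k ≤ N + i) (h2 : i ≤ k) :
    (Finset.univ.filter fun w : Fin N → Bool => closings w = k ∧ i ≤ unmatched w).card =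
      N.choose (k - i) := by
  induction N generalizing k with
  | zero =>
    obtain rfl : i = k := by omega
    obtain rfl : i = 0 := by omega
    simp [closings]
  | succ N ih =>
    rw [card_filter_snoc]
    simp only [closings_snoc, Bool.false_eq_true, if_false, add_zero, if_true,
      unmatched_snoc_false, unmatched_snoc_true]
    cases k with
    | zero =>
      rw [ih 0 (by omega) h2]
      simp
    | succ k =>
      by_cases h3 : 2 * (k + 1) ≤ N + i
      -- Away from the boundary a final closing letter may create a new unmatched closer, but never
      -- one that lifts the count from `i - 1` to `i`. The claim is then Pascal's rule.
      · rw [ih _ h3 h2, Finset.filter_congr (q := fun w : Fin N → Bool =>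
          closings w = k ∧ i ≤ unmatched w)]
        · by_cases h4 : i ≤ k
          · rw [ih k (by omega) h4, show k + 1 - i = k - i + 1 by omega, Nat.choose_succ_succ,
              add_comm]
          · rw [Finset.filter_false_of_mem, show k + 1 - i = 0 by omega]
            · simp
            · intro w _
              have := unmatched_le w
              omega
        · intro w _
          have := le_unmatched w
          split_ifs <;> omega
      -- On the boundary `2 * (k + 1) = N + 1 + i` every word with `k + 1` closing letters has at
      -- least `i` unmatched ones, so all words count; symmetry of the binomial coefficient gives
      -- the stated form.
      · rw [Finset.filter_congr (q := fun w : Fin N → Bool => closings w = k + 1),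
          Finset.filter_congr (p := fun w : Fin N → Bool => closings w + 1 = k + 1 ∧ _)
            (q := fun w : Fin N → Bool => closings w = k), card_closings,
          card_closings, add_comm, ← Nat.choose_succ_succ, ← Nat.choose_symm (by omega)]
        · congr 1
          omega
        · intro w _
          have := le_unmatched w
          split_ifs <;> omega
        · intro w _
          have := le_unmatched w
          omega

variable {n : ℕ}

lemma card_rank (i : ℕ) (hi : i ≤ n) :
    (Finset.univ.filter fun w : Word n => i ≤ w.rank).card = (2 * n).choose (n - i) := by
  rw [← card_unmatched (2 * n) n i (by omega) hi]
  refine Finset.card_bij (fun w _ => w.1) ?_ ?_ ?_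
  · intro w hw
    simp only [Finset.mem_filter, Finset.mem_univ, true_and] at hw ⊢
    exact ⟨w.2, hw⟩
  · intro v _ w _ h
    exact Subtype.ext h
  · intro w hw
    simp only [Finset.mem_filter, Finset.mem_univ, true_and] at hw
    exact ⟨⟨w, hw.1⟩, Finset.mem_filter.2 ⟨Finset.mem_univ _, hw.2⟩, rfl⟩

lemma Word.rank_le (w : Word n) : w.rank ≤ n := by
  have := w.length_arcs
  omega

lemma card_word : Fintype.card (Word n) = (2 * n).choose n := by
  have := card_rank (n := n) 0 (by omega)
  simpa using this

/-- Exchange the two products: the factor for `i` occurs once for every word of rank at least `i`.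
-/
lemma prod_rank {M : Type*} [CommMonoid M] (g : ℕ → M) :
    ∏ w : Word n, ∏ j ∈ Finset.range w.rank, g (j + 1) =
      ∏ i ∈ Finset.Icc 1 n, g i ^ (2 * n).choose (n - i) := by
  have h1 : ∀ w : Word n, ∏ j ∈ Finset.range w.rank, g (j + 1) =
      ∏ i ∈ Finset.Icc 1 n, if i ≤ w.rank then g i else 1 := by
    intro w
    have := w.rank_le
    have e : (Finset.Icc 1 n).filter (· ≤ w.rank) = (Finset.range w.rank).image (· + 1) := by
      ext i
      simp only [Finset.mem_filter, Finset.mem_Icc, Finset.mem_image, Finset.mem_range]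
      constructor
      · intro h
        exact ⟨i - 1, by omega, by omega⟩
      · rintro ⟨j, hj, rfl⟩
        omega
    rw [← Finset.prod_filter, e, Finset.prod_image (by simp)]
  rw [Finset.prod_congr rfl fun w _ => h1 w, Finset.prod_comm]
  refine Finset.prod_congr rfl fun i hi => ?_
  rw [← Finset.prod_filter, Finset.prod_const, card_rank i (Finset.mem_Icc.1 hi).2]

/-- The sum telescopes, as the terms are differences of consecutive values of `(n - m) * C(2n, n -
m)`. It balances the powers of `q` in the final formula. -/
lemma sum_choose (n : ℕ) : ∑ i ∈ Finset.Icc 1 n, 2 * i * (2 * n).choose (n - i) =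
    n * (2 * n).choose n := by
  have key : ∀ m ≤ n, ∑ i ∈ Finset.Icc 1 m, 2 * i * (2 * n).choose (n - i) +
      (n - m) * (2 * n).choose (n - m) = n * (2 * n).choose n := by
    intro m hm
    induction m with
    | zero => simp
    | succ m ih =>
      rw [← ih (by omega), Finset.sum_Icc_succ_top (by omega), add_assoc]
      congr 1
      obtain ⟨k, hk⟩ : ∃ k, n = m + 1 + k := ⟨n - (m + 1), by omega⟩
      have := Nat.choose_succ_right_eq (2 * n) k
      rw [show n - m = k + 1 by omega, show n - (m + 1) = k by omega, mul_comm (k + 1), this,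
        show 2 * n - k = 2 * (m + 1) + k by omega]
      ring
  simpa using key n le_rfl

end TypeB

namespace TypeB
variable {n : ℕ}

/-! ### Every non-crossing partition comes from a path -/

/-- If a block has elements on both sides of a site outside it, the nearest ones on each side form a
chord. Doing this for both pairs turns interleaving pairs of different blocks into crossing chords.
-/
lemma isNonCrossing_iff {π : Setoid (Fin (2 * n))} : IsNonCrossing π ↔
    ∀ i k j l, i < k → k < j → j < l → π i j → π k l → π i k := by
  constructor
  · intro H i k j l h1 h2 h3 hij hkl
    by_contra hik
    have next : ∀ u v z : Fin (2 * n), u < z → z < v → π u v → ¬ π u z → ∃ u' v',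
        u ≤ u' ∧ u' < z ∧ z < v' ∧ v' ≤ v ∧ π u u' ∧ IsChord π u' v' := by
      classical
      intro u v z huz hzv huv hz
      obtain ⟨u', hu', hmax⟩ := (Finset.univ.filter fun t => t < z ∧ π u t).exists_max_image id
        ⟨u, by simp [huz]⟩
      obtain ⟨v', hv', hmin⟩ := (Finset.univ.filter fun t => z < t ∧ π u t).exists_min_image id
        ⟨v, by simp [hzv, huv]⟩
      simp only [Finset.mem_filter, Finset.mem_univ, true_and, id, and_imp] at hu' hv' hmax hmin
      refine ⟨u', v', hmax u huz (π.refl u), hu'.1, hv'.1, hmin v hzv huv, hu'.2,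
        hu'.1.trans hv'.1, π.trans (π.symm hu'.2) hv'.2, fun t ht1 ht2 ht => ?_⟩
      have ht' := π.trans hu'.2 ht
      rcases lt_trichotomy t z with h | rfl | h
      · exact absurd (hmax t h ht') (not_le.2 ht1)
      · exact hz ht'
      · exact absurd (hmin t h ht') (not_le.2 ht2)
    obtain ⟨i', j', a1, a2, a3, a4, a5, a6⟩ := next i j k h1 h2 hij hik
    have hij' : π i j' := π.trans a5 a6.2.1
    obtain ⟨k', l', b1, b2, b3, b4, b5, b6⟩ := next k l j' a3 (a4.trans_lt h3) hkl
      fun h => hik (π.trans hij' (π.symm h))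
    exact H i' k' j' l' (a2.trans_le b1) b2 b3 ⟨a6, b6⟩
  · rintro H i k j l h1 h2 h3 ⟨hij, hkl⟩
    exact hij.2.2 k h1 h2 (H i k j l h1 h2 h3 hij.2.1 hkl.2.1)

lemma opp_injective : Function.Injective (opp : Fin (2 * n) → Fin (2 * n)) := fun p q h => by
  rw [← opp_opp p, h, opp_opp]

lemma opp_val (p : Fin (2 * n)) : (opp p).val = p.val + n ∨ p.val = (opp p).val + n := by
  unfold opp
  split_ifs with h
  · exact Or.inl rfl
  · exact Or.inr (by simp only; omega)

lemma isPartition_isolate {π : Setoid (Fin (2 * n))} (hπ : IsPartition π) (i : Fin (2 * n)) :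
    IsPartition (isolate i π) := by
  rw [isPartition_iff] at hπ ⊢
  simp only [isolate_apply]
  refine ⟨?_, ?_⟩
  · rintro x y (rfl | ⟨h1, h2, h3⟩)
    · exact Or.inl rfl
    · refine Or.inr ⟨hπ.1 _ _ h1, ⟨?_, ?_⟩, ?_, ?_⟩ <;> intro h
      · exact h2.2 (by rw [← h, opp_opp])
      · exact h2.1 (opp_injective h)
      · exact h3.2 (by rw [← h, opp_opp])
      · exact h3.1 (opp_injective h)
  · rintro x y (h1 | ⟨h1, h2, -⟩) (h3 | ⟨h3, h4, -⟩)
    · exact absurd h1.symm opp_ne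
    · exact absurd h1.symm opp_ne
    · exact absurd h3.symm opp_ne
    · exact Or.inr ⟨hπ.2 _ _ h1 h3, h2, h4⟩

lemma isNonCrossing_isolate {π : Setoid (Fin (2 * n))} (hπ : IsNonCrossing π) (i : Fin (2 * n)) :
    IsNonCrossing (isolate i π) := by
  rw [isNonCrossing_iff] at hπ ⊢
  rintro a k j l h1 h2 h3 (h4 | ⟨h4, h5, -⟩) (h6 | ⟨h6, h7, -⟩)
  · exact absurd h4 (h1.trans h2).ne
  · exact absurd h4 (h1.trans h2).ne
  · exact absurd h6 (h2.trans h3).ne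
  · exact Or.inr ⟨hπ a k j l h1 h2 h3 h4 h6, h5, h7⟩

variable [NeZero n]

/-- The partitions that come from paths. -/
def IsRealized (π : Setoid (Fin (2 * n))) : Prop := ∃ (h : ℤ → ℤ) (hh : IsPath n h),
  partitionOf hh = π

lemma isRealized_bot : IsRealized (⊥ : Setoid (Fin (2 * n))) := by
  obtain ⟨g, hg⟩ : ∃ g : ℤ → ℤ, ∀ x, g x = x % 2 := ⟨_, fun _ => rfl⟩
  have hp : IsPath n g := ⟨fun x => by rw [hg, hg]; omega, fun x => by rw [hg, hg]; omega⟩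
  refine ⟨g, hp, ?_⟩
  ext p q
  rw [Setoid.bot_def]
  constructor
  · intro H
    obtain ⟨i, rfl⟩ := exists_res p
    exact (partitionOf_eq_of_isPeak hp (by rw [IsPeak, hg, hg, hg]; omega) H).symm
  · rintro rfl
    exact (partitionOf hp).refl p

lemma IsRealized.isPartition {π : Setoid (Fin (2 * n))} (H : IsRealized π) : IsPartition π := by
  obtain ⟨h, hh, rfl⟩ := H
  exact isPartition_partitionOf hh

lemma IsRealized.isolate {π : Setoid (Fin (2 * n))} (H : IsRealized π) (i : Fin (2 * n)) :
    IsRealized (isolate i π) := by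
  obtain ⟨h, hh, rfl⟩ := H
  obtain ⟨x, rfl⟩ := exists_res i
  have hn := Nat.pos_of_neZero n
  obtain ⟨h', H⟩ := exists_step hh hn (2 * x + 1)
  exact ⟨h', H.isPath hh hn, H.partitionOf_isolate hh _⟩

lemma IsRealized.exists_isolate {π : Setoid (Fin (2 * n))} (H : IsRealized π)
    (S : Finset (Fin (2 * n))) : ∃ τ, IsRealized τ ∧ ∀ x y, τ x y ↔ x = y ∨
      (π x y ∧ (x ∉ S ∧ opp x ∉ S) ∧ (y ∉ S ∧ opp y ∉ S)) := by
  induction S using Finset.induction_on with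
  | empty =>
    refine ⟨π, H, fun x y => ⟨fun h => Or.inr ⟨h, by simp, by simp⟩, ?_⟩⟩
    rintro (rfl | h)
    · exact π.refl x
    · exact h.1
  | insert i S _ ih =>
    obtain ⟨τ, h1, h2⟩ := ih
    refine ⟨TypeB.isolate i τ, h1.isolate i, fun x y => ?_⟩
    have e : ∀ x : Fin (2 * n), x = opp i ↔ opp x = i := fun x =>
      ⟨fun h => by rw [h, opp_opp], fun h => by rw [← h, opp_opp]⟩
    rw [isolate_apply, h2]
    simp only [Finset.mem_insert, e, ne_eq]
    tauto

lemma IsRealized.exists_merge {π : Setoid (Fin (2 * n))} (H : IsRealized π) {p q : Fin (2 * n)}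
    (hpq : p.val + 1 = q.val) : ∃ τ, IsRealized τ ∧ π ≤ τ ∧ τ p q ∧
      ∀ σ, IsPartition σ → π ≤ σ → σ p q → τ ≤ σ := by
  obtain ⟨h, hh, rfl⟩ := H
  have hn := Nat.pos_of_neZero n
  obtain ⟨h', H⟩ := exists_step hh hn (2 * p.val + 2)
  have hh' := H.isPath hh hn
  have e1 := res_natCast p
  have e2 := res_natCast q
  rw [← hpq] at e2
  push_cast at e2
  refine ⟨_, ⟨h', hh', rfl⟩, ?_⟩
  rcases H with ⟨hp, rfl⟩ | H
  · refine ⟨le_rfl, ?_, fun σ _ h1 _ => h1⟩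
    have := partitionOf_of_isPeak hh hp
    rwa [e1, e2] at this
  · refine ⟨H.le_partitionOf hh hh', ?_, fun σ h1 h2 h3 => ?_⟩
    · have := partitionOf_of_isPeak hh' (H.isPeak hh hn)
      rwa [e1, e2] at this
    · exact H.partitionOf_le hh hh' h1 h2 (by rwa [e1, e2])

/-- Neighbouring sites are merged one after the other from `a` to `b`; each merge is the least
possible one. -/
lemma IsRealized.exists_merge_interval {π : Setoid (Fin (2 * n))} (H : IsRealized π)
    {a b : Fin (2 * n)} (hab : a ≤ b) : ∃ τ, IsRealized τ ∧ π ≤ τ ∧ τ a b ∧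
      ∀ σ, IsPartition σ → π ≤ σ → (∀ c, a ≤ c → c ≤ b → σ a c) → τ ≤ σ := by
  obtain ⟨d, hd⟩ : ∃ d, b.val = a.val + d := ⟨b.val - a.val, by rw [Fin.le_def] at hab; omega⟩
  induction d generalizing b with
  | zero =>
    obtain rfl : b = a := Fin.ext hd
    exact ⟨π, H, le_rfl, π.refl _, fun σ _ h _ => h⟩
  | succ d ih =>
    have hb := b.isLt
    let b' : Fin (2 * n) := ⟨a.val + d, by omega⟩
    obtain ⟨τ, h1, h2, h3, h4⟩ := ih (b := b') (by rw [Fin.le_def]; simp [b']) rfl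
    have hb' : b' ≤ b := by rw [Fin.le_def]; simp only [b']; omega
    have hab' : a ≤ b' := by rw [Fin.le_def]; simp [b']
    obtain ⟨τ', k1, k2, k3, k4⟩ := h1.exists_merge (p := b') (q := b) (by simp only [b']; omega)
    refine ⟨τ', k1, h2.trans k2, τ'.trans (k2 h3) k3, fun σ g1 g2 g3 => ?_⟩
    exact k4 σ g1 (h4 σ g1 g2 fun c c1 c2 => g3 c c1 (c2.trans hb'))
      (σ.trans (σ.symm (g3 b' hab' hb')) (g3 b hab le_rfl))

end TypeB

namespace TypeB
variable {n : ℕ}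

/-! ### Rebuilding a partition from an isolated one -/

section Gap

variable {π : Setoid (Fin (2 * n))} {a b : Fin (2 * n)}

/-- Two related positions with minimal distance. -/
structure IsMinimalGap (π : Setoid (Fin (2 * n))) (a b : Fin (2 * n)) : Prop where
  lt : a < b
  rel : π a b
  le : ∀ c d, c < d → π c d → b.val - a.val ≤ d.val - c.val

/-- A site between `a` and `b` that is related to another one would give a shorter gap, or a
crossing that puts it into the block of `a` and again gives a shorter gap. -/
lemma IsMinimalGap.eq_of_rel (H : IsMinimalGap π a b) (hπ : IsNonCrossing π) {m : Fin (2 * n)}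
    (h1 : a < m) (h2 : m < b) {m' : Fin (2 * n)} (h : π m m') : m' = m := by
  rw [isNonCrossing_iff] at hπ
  have hle := H.le
  have ham : ¬ π a m := fun h => by
    have := hle a m h1 h
    rw [Fin.lt_def] at *
    omega
  rcases lt_trichotomy m' m with h3 | h3 | h3
  · exfalso
    rcases lt_trichotomy m' a with h4 | rfl | h4
    · have := hπ m' a m b h4 h1 h2 (π.symm h) H.rel
      exact ham (π.trans (π.symm this) (π.symm h))
    · exact ham (π.symm h)
    · have := hle m' m h3 (π.symm h)
      rw [Fin.lt_def] at *
      omega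
  · exact h3
  · exfalso
    rcases lt_trichotomy m' b with h4 | rfl | h4
    · have := hle m m' h3 h
      rw [Fin.lt_def] at *
      omega
    · exact ham (π.trans H.rel (π.symm h))
    · exact ham (hπ a m b m' h1 h2 h4 H.rel h)

/-- If the gap were longer than `n`, the opposite pair would be related with a shorter gap. -/
lemma IsMinimalGap.le_half (H : IsMinimalGap π a b) (hπ : IsPartition π) :
    b.val ≤ a.val + n := by
  by_contra hlt
  have hab := H.lt
  have hb := b.isLt
  rw [Fin.lt_def] at hab
  have h1 := opp_val a
  have h2 := opp_val b
  have h3 := (opp a).isLt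
  have h4 := H.le (opp b) (opp a) (by rw [Fin.lt_def]; omega)
    (((isPartition_iff π).1 hπ).1 _ _ (π.symm H.rel))
  omega

open Classical in
/-- Move the positions between `a` and `b` to `a`, and symmetrically for the opposite positions. -/
noncomputable def collapse (a b x : Fin (2 * n)) : Fin (2 * n) :=
  if a < x ∧ x < b then a else if a < opp x ∧ opp x < b then opp a else x

lemma collapse_of_not {x : Fin (2 * n)} (h1 : ¬ (a < x ∧ x < b)) (h2 : ¬ (a < opp x ∧ opp x < b)) :
    collapse a b x = x := by
  rw [collapse, if_neg h1, if_neg h2]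

lemma collapse_opp (hab : b.val ≤ a.val + n) (x : Fin (2 * n)) :
    collapse a b (opp x) = opp (collapse a b x) := by
  have h1 := opp_val x
  have h2 : ¬ ((a < x ∧ x < b) ∧ (a < opp x ∧ opp x < b)) := by
    simp only [Fin.lt_def]
    omega
  unfold collapse
  rw [opp_opp]
  split_ifs <;> first | rfl | rw [opp_opp] | tauto

lemma isPartition_comap_collapse (hπ : IsPartition π) (hab : b.val ≤ a.val + n) :
    IsPartition (Setoid.comap (collapse a b) π) := by
  rw [isPartition_iff] at hπ ⊢
  simp only [Setoid.comap_rel, collapse_opp hab]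
  exact ⟨fun x y h => hπ.1 _ _ h, fun x y h h' => hπ.2 _ _ h h'⟩

/-- Starting with `a` isolated, merge the whole interval from `a` to `b` and then isolate the sites
strictly inside, which are singletons of `π`. This reattaches `a` to its block, and all operations
preserve realizability. -/
lemma isRealized_of_minimalGap [NeZero n] (H : IsMinimalGap π a b) (hπ : IsPartition π)
    (hnc : IsNonCrossing π) (hr : IsRealized (isolate a π)) : IsRealized π := by
  have hπ' := (isPartition_iff π).1 hπ
  have hhalf := H.le_half hπ
  have single : ∀ m m', a < m ∧ m < b → π m m' → m' = m := fun m m' h h' =>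
    H.eq_of_rel hnc h.1 h.2 h'
  have out : ∀ x y, π x y → x ≠ y → ¬ (a < x ∧ x < b) ∧ ¬ (a < opp x ∧ opp x < b) :=
    fun x y h hne => ⟨fun hx => hne (single x y hx h).symm,
      fun hx => hne (opp_injective (single _ _ hx (hπ'.1 _ _ h))).symm⟩
  have hfix : ∀ x y, π x y → x ≠ y → collapse a b x = x := fun x y h hne =>
    collapse_of_not (out x y h hne).1 (out x y h hne).2
  obtain ⟨σ, s1, s2, s3, s4⟩ := hr.exists_merge_interval H.lt.le
  have hσ := (isPartition_iff σ).1 s1.isPartition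
  -- An upper bound for the merged partition: it only differs from `π` by absorbing the interior
  -- sites into the block of `a`, and their negatives into the opposite block.
  have hle : σ ≤ Setoid.comap (collapse a b) π := by
    refine s4 _ (isPartition_comap_collapse hπ hhalf) ?_ ?_
    · intro x y hxy
      rw [Setoid.comap_rel]
      have hxy' := isolate_le a π hxy
      by_cases hne : x = y
      · rw [hne]
      · rwa [hfix x y hxy' hne, hfix y x (π.symm hxy') (Ne.symm hne)]
    · intro c h1 h2
      rw [Setoid.comap_rel, hfix a b H.rel H.lt.ne]
      rcases eq_or_lt_of_le h1 with rfl | h1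
      · rw [hfix a b H.rel H.lt.ne]
      rcases eq_or_lt_of_le h2 with rfl | h2
      · rw [hfix c a (π.symm H.rel) H.lt.ne']
        exact H.rel
      · rw [collapse, if_pos ⟨h1, h2⟩]
  have haσ : ∀ z, π a z → σ a z := by
    intro z hz
    by_cases hza : z = a
    · rw [hza]
    by_cases hzb : z = b
    · rwa [hzb]
    have hsub : ∀ x y, π x y → x ≠ a → x ≠ opp a → y ≠ a → y ≠ opp a → σ x y :=
      fun x y h h1 h2 h3 h4 => s2 (Or.inr ⟨h, ⟨h1, h2⟩, h3, h4⟩)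
    -- In this case any other site or its negative lies strictly between `a` and `b`, so the block
    -- of `a` contains nothing else.
    by_cases hba : b = opp a
    · exfalso
      have h1 := opp_val a
      have h2 := opp_val z
      have h3 := out a z hz (Ne.symm hza)
      have h4 := out z a (π.symm hz) hza
      have h5 := H.lt
      have h6 := z.isLt
      rw [Fin.ext_iff] at hza hzb
      have h7 : b.val = (opp a).val := by rw [hba]
      simp only [Fin.lt_def] at *
      omega
    · by_cases hzo : z = opp a
      · subst hzo
        have h1 : π b (opp b) := π.trans (π.symm H.rel) (π.trans hz (hπ'.1 _ _ H.rel))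
        have h2 := hsub b (opp b) h1 H.lt.ne' hba
          (fun h => hba (by rw [← h, opp_opp])) (fun h => H.lt.ne' (opp_injective h))
        exact σ.trans s3 (σ.trans h2 (σ.symm (hσ.1 _ _ s3)))
      · exact σ.trans s3 (hsub b z (π.trans (π.symm H.rel) hz) H.lt.ne' hba hza hzo)
  have hge : π ≤ σ := by
    intro x y hxy
    by_cases h1 : x = a
    · rw [h1] at hxy ⊢
      exact haσ y hxy
    by_cases h2 : y = a
    · rw [h2] at hxy ⊢
      exact σ.symm (haσ x (π.symm hxy))
    by_cases h3 : x = opp a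
    · have := hσ.1 _ _ (haσ (opp y) (by have := hπ'.1 _ _ hxy; rwa [h3, opp_opp] at this))
      rwa [opp_opp, ← h3] at this
    by_cases h4 : y = opp a
    · have := hσ.1 _ _ (haσ (opp x) (by have := hπ'.1 _ _ (π.symm hxy); rwa [h4, opp_opp] at this))
      rw [opp_opp, ← h4] at this
      exact σ.symm this
    exact s2 (Or.inr ⟨hxy, ⟨h1, h3⟩, h2, h4⟩)
  obtain ⟨τ, t1, t2⟩ := s1.exists_isolate (Finset.Ioo a b)
  suffices τ = π by rwa [← this]
  ext x y
  rw [t2]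
  simp only [Finset.mem_Ioo]
  constructor
  · rintro (rfl | ⟨h1, ⟨h2, h3⟩, h4, h5⟩)
    · exact π.refl x
    · have := hle h1
      rwa [Setoid.comap_rel, collapse_of_not h2 h3, collapse_of_not h4 h5] at this
  · intro hxy
    by_cases hne : x = y
    · exact Or.inl hne
    · exact Or.inr ⟨hge hxy, out x y hxy hne, out y x (π.symm hxy) (Ne.symm hne)⟩

end Gap

/-- Every non-crossing partition of type `B` is the partition of a path. -/
lemma isRealized [NeZero n] {π : Setoid (Fin (2 * n))} (hπ : IsPartition π)
    (hnc : IsNonCrossing π) : IsRealized π := by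
  classical
  obtain ⟨m, hm⟩ : ∃ m, (Finset.univ.filter fun x => ∃ y, x ≠ y ∧ π x y).card = m := ⟨_, rfl⟩
  induction m using Nat.strong_induction_on generalizing π with
  | _ m ih =>
  by_cases hex : ∃ c : Fin (2 * n) × Fin (2 * n), c.1 < c.2 ∧ π c.1 c.2
  · obtain ⟨⟨a, b⟩, h1, h2⟩ := (Finset.univ.filter fun c : Fin (2 * n) × Fin (2 * n) =>
      c.1 < c.2 ∧ π c.1 c.2).exists_min_image (fun c => c.2.val - c.1.val) (by
        obtain ⟨c, hc⟩ := hex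
        exact ⟨c, by simpa using hc⟩)
    simp only [Finset.mem_filter, Finset.mem_univ, true_and, and_imp, Prod.forall] at h1 h2
    refine isRealized_of_minimalGap ⟨h1.1, h1.2, h2⟩ hπ hnc
      (ih _ ?_ (isPartition_isolate hπ a) (isNonCrossing_isolate hnc a) rfl)
    rw [← hm]
    apply Finset.card_lt_card
    rw [Finset.ssubset_iff_of_subset]
    · refine ⟨a, ?_, ?_⟩
      · simp only [Finset.mem_filter, Finset.mem_univ, true_and]
        exact ⟨b, h1.1.ne, h1.2⟩
      · simp only [Finset.mem_filter, Finset.mem_univ, true_and, isolate_apply]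
        rintro ⟨y, h3, h4 | h4⟩
        · exact h3 h4
        · exact h4.2.1.1 rfl
    · intro x
      simp only [Finset.mem_filter, Finset.mem_univ, true_and]
      rintro ⟨y, h3, h4⟩
      exact ⟨y, h3, isolate_le a π h4⟩
  · push Not at hex
    suffices π = ⊥ by rw [this]; exact isRealized_bot
    ext x y
    rw [Setoid.bot_def]
    constructor
    · intro h
      rcases lt_trichotomy x y with h1 | h1 | h1
      · exact absurd h (hex (x, y) h1)
      · exact h1
      · exact absurd (π.symm h) (hex (y, x) h1)
    · rintro rfl
      exact π.refl x

lemma partitionOf_congr [NeZero n] {h h' : ℤ → ℤ} (hh : IsPath n h) (hh' : IsPath n h') (t : ℤ)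
    (e : ∀ x, h' x = h x - t) : partitionOf hh' = partitionOf hh := by
  have hr : ∀ a b, Rel h' a b ↔ Rel h a b := fun a b => by
    simp only [Rel, e, sub_left_inj, sub_le_sub_iff_right]
  ext p q
  obtain ⟨x, rfl⟩ := exists_res p
  obtain ⟨y, rfl⟩ := exists_res q
  rw [partitionOf_res, partitionOf_res]
  simp only [hr]

/-- A vertical shift makes the path start at height zero without changing its partition, and
periodicity balances the down steps. -/
lemma IsRealized.exists_word [NeZero n] {π : Setoid (Fin (2 * n))} (H : IsRealized π) :
    ∃ w : Word n, partitionOf w.isPath = π := by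
  obtain ⟨h, hh, rfl⟩ := H
  let f : Fin (2 * n) → Bool := fun c => decide (h (c.val + 1) = h c.val - 1)
  have hf : ∀ u ≤ 2 * n, height (letters f) u = h u - h 0 := by
    intro u hu
    induction u with
    | zero => simp [height]
    | succ u ih =>
      rw [height, Finset.sum_range_succ, ← height, ih (by omega), letters, dif_pos (by omega)]
      have := hh.step u
      push_cast
      by_cases h1 : h (u + 1) = h u - 1
      · simp only [f, h1, decide_true, if_true]
        ring
      · simp only [f, h1, decide_false, Bool.false_eq_true, if_false]
        omega
  let w : Word n := ⟨f, by
    have h1 := hf _ le_rfl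
    have h2 := hh.period 0
    rw [height_eq, card_letters] at h1
    push_cast at h1
    rw [zero_add] at h2
    omega⟩
  refine ⟨w, partitionOf_congr hh _ (h 0) fun x => ?_⟩
  have hn := Nat.pos_of_neZero n
  have h0 := Int.emod_nonneg x (b := 2 * n) (by omega)
  have h1 := Int.emod_lt_of_pos x (b := 2 * n) (by omega)
  rw [Word.path]
  change height (letters f) _ = _
  rw [hf _ (by omega), Int.toNat_of_nonneg h0,
    hh.apply_of_dvd (x := x % (2 * n)) (k := x) (by
      rw [← neg_sub, dvd_neg]; exact Int.dvd_self_sub_emod)]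

end TypeB

namespace TypeB
variable {n : ℕ}

/-! ### The determinant over the complex numbers -/

/-- Exchange opening and closing letters. -/
def Word.flip (w : Word n) : Word n := ⟨fun c => !w.1 c, by
  have h := Finset.card_filter_add_card_filter_not (s := (Finset.univ : Finset (Fin (2 * n))))
    (fun c => w.1 c = true)
  rw [w.2, Finset.card_univ, Fintype.card_fin] at h
  simp only [Bool.not_eq_true', ← Bool.not_eq_true]
  omega⟩

lemma Word.flip_flip (w : Word n) : w.flip.flip = w :=
  Subtype.ext (funext fun c => Bool.not_not (w.1 c))

variable [NeZero n]

lemma Word.oddDowns_path (w : Word n) : oddDowns n w.path =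
    Finset.univ.filter fun c : Fin (2 * n) => c.val % 2 = 1 ∧ w.1 c = true := by
  refine Finset.filter_congr fun c _ => and_congr_right fun _ => ?_
  rw [w.path_succ c.isLt, letters_val]
  cases w.1 c <;> simp

lemma Word.card_oddDowns_flip (w : Word n) :
    (oddDowns n w.path).card + (oddDowns n w.flip.path).card = n := by
  rw [w.oddDowns_path, w.flip.oddDowns_path, ← Finset.filter_filter, ← Finset.filter_filter]
  have : ∀ c, w.flip.1 c = true ↔ ¬ w.1 c = true := fun c => by
    change (!w.1 c) = true ↔ _
    cases w.1 c <;> simp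
  simp only [this]
  rw [Finset.card_filter_add_card_filter_not, card_odd]

/-- Flipping all letters exchanges up and down steps, so the counts for a word and its flip add up
to the number `n` of odd positions. -/
lemma sum_card_oddDowns :
    ∑ w : Word n, (oddDowns n w.path).card + ∑ w : Word n, (oddDowns n w.path).card =
      n * (2 * n).choose n := by
  let e : Word n ≃ Word n := ⟨Word.flip, Word.flip, Word.flip_flip, Word.flip_flip⟩
  conv_lhs => arg 2; rw [← Equiv.sum_comp e]
  rw [← Finset.sum_add_distrib, Finset.sum_congr rfl fun w _ => w.card_oddDowns_flip,
    Finset.sum_const, Finset.card_univ, card_word, smul_eq_mul, mul_comm]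

section

variable {K : Type*} [Field K] {q lam : K}

/-- The matrix of chromatic joins of the partitions of words. -/
noncomputable def wordJoins (n : ℕ) [NeZero n] {R : Type*} [CommRing R] (x : R) :
    Matrix (Word n) (Word n) R :=
  fun v w => x ^ nzbk (join (partitionOf v.isPath) (partitionOf w.isPath))

/-- The Gram identity in matrix form. The diagonal factors contribute the same power of `δ` as the
scalar factor on the left, so it cancels and only a power of `q` remains. -/
lemma det_wordJoins_mul (hq : q ≠ 0) (hδ : q + q⁻¹ ≠ 0) (hl : lam ≠ 0) (hl1 : lam + lam⁻¹ = 1) :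
    (wordJoins n ((q + q⁻¹) ^ 2)).det * q ^ (n * (2 * n).choose n) =
      ∏ i ∈ Finset.Icc 1 n, (1 + q ^ (2 * i) + (q ^ (2 * i)) ^ 2) ^ (2 * n).choose (n - i) := by
  have e : (((q + q⁻¹) * q) ^ n) • wordJoins n ((q + q⁻¹) ^ 2) =
      Matrix.diagonal (fun w : Word n => (q + q⁻¹) ^ (oddDowns n w.path).card) *
        (Matrix.of fun v w : Word n => pairing q lam n v.path w.path) *
        Matrix.diagonal (fun w : Word n => (q + q⁻¹) ^ (oddDowns n w.path).card) := by
    ext v w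
    have := gramIdentity hq hδ hl hl1 v.isPath w.isPath
    rw [GramIdentity] at this
    rw [Matrix.smul_apply, wordJoins, smul_eq_mul, mul_comm, this, Matrix.mul_diagonal,
      Matrix.diagonal_mul, Matrix.of_apply, pow_add]
    ring
  have h := congrArg Matrix.det e
  rw [Matrix.det_smul, Matrix.det_mul, Matrix.det_mul, Matrix.det_diagonal, det_pairing hl hl1,
    prod_rank (fun i => 1 + q ^ (2 * i) + (q ^ (2 * i)) ^ 2), card_word,
    Finset.prod_pow_eq_pow_sum, ← pow_mul, mul_pow] at h
  have h2 : (q + q⁻¹) ^ (∑ w : Word n, (oddDowns n w.path).card) *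
      (q + q⁻¹) ^ (∑ w : Word n, (oddDowns n w.path).card) =
      (q + q⁻¹) ^ (n * (2 * n).choose n) := by rw [← pow_add, sum_card_oddDowns]
  refine mul_left_cancel₀ (pow_ne_zero (n * (2 * n).choose n) hδ) ?_
  linear_combination h + (∏ i ∈ Finset.Icc 1 n,
    (1 + q ^ (2 * i) + (q ^ (2 * i)) ^ 2) ^ (2 * n).choose (n - i)) * h2

lemma eval_chebyshev (hq : q ≠ 0) (i : ℕ) :
    (Polynomial.Chebyshev.C K i).eval (q + q⁻¹) = q ^ i + q⁻¹ ^ i := by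
  induction i using Nat.strong_induction_on with
  | _ i ih =>
  match i with
  | 0 => simp; norm_num
  | 1 => simp
  | i + 2 =>
    have h1 := ih i (by omega)
    have h2 := ih (i + 1) (by omega)
    push_cast at h1 h2 ⊢
    rw [Polynomial.Chebyshev.C_add_two, Polynomial.eval_sub, Polynomial.eval_mul,
      Polynomial.eval_X, h1, h2]
    have := mul_inv_cancel₀ hq
    linear_combination (q ^ i + q⁻¹ ^ i) * this

/-- With `T_i = q^i + q^(-i)` one has `q^(2i) (T_i² - 1) = 1 + q^(2i) + q^(4i)`, and the powers of
`q` are collected by `sum_choose`. -/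
lemma det_wordJoins (hq : q ≠ 0) (hδ : q + q⁻¹ ≠ 0) (hl : lam ≠ 0) (hl1 : lam + lam⁻¹ = 1) :
    (wordJoins n ((q + q⁻¹) ^ 2)).det = ∏ i ∈ Finset.Icc 1 n,
      ((Polynomial.Chebyshev.C K (i : ℤ)).eval (q + q⁻¹) ^ 2 - 1) ^ (2 * n).choose (n - i) := by
  have h := det_wordJoins_mul (n := n) hq hδ hl hl1
  refine mul_right_cancel₀ (pow_ne_zero (n * (2 * n).choose n) hq) (h.trans ?_)
  rw [← sum_choose, ← Finset.prod_pow_eq_pow_sum, ← Finset.prod_mul_distrib]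
  refine Finset.prod_congr rfl fun i _ => ?_
  rw [pow_mul q (2 * i), ← mul_pow, eval_chebyshev hq]
  congr 1
  have := mul_inv_cancel₀ (pow_ne_zero i hq)
  rw [← inv_pow] at this
  rw [pow_mul', pow_two (q ^ i)]
  linear_combination (-(q ^ i * q⁻¹ ^ i + 1) - 2 * q ^ i * q ^ i) * this

end

/-! ### Specialization to complex numbers and transfer to partitions -/

lemma exists_add_inv (δ : ℂ) : ∃ q : ℂ, q ≠ 0 ∧ q + q⁻¹ = δ := by
  obtain ⟨s, hs⟩ := IsAlgClosed.exists_pow_nat_eq (discrim 1 (-δ) 1) (n := 2) (by norm_num)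
  obtain ⟨q, hq⟩ := exists_quadratic_eq_zero (a := (1 : ℂ)) (b := -δ) (c := 1) one_ne_zero
    ⟨s, by rw [← hs, sq]⟩
  have h0 : q ≠ 0 := by
    rintro rfl
    simp at hq
  refine ⟨q, h0, ?_⟩
  field_simp
  linear_combination hq

lemma det_wordJoins_complex {δ : ℂ} (hδ : δ ≠ 0) : (wordJoins n (δ ^ 2)).det =
    ∏ i ∈ Finset.Icc 1 n,
      ((Polynomial.Chebyshev.C ℂ (i : ℤ)).eval δ ^ 2 - 1) ^ (2 * n).choose (n - i) := by
  obtain ⟨q, hq, rfl⟩ := exists_add_inv δ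
  obtain ⟨lam, hl, hl1⟩ := exists_add_inv 1
  exact det_wordJoins hq hδ hl hl1

/-- Two words with the same partition would give two equal rows in the matrix of joins. At `q = 2`
its determinant is nonzero, since all factors `1 + q^(2i) + q^(4i)` are positive integers. -/
lemma partitionOf_word_injective :
    Function.Injective fun w : Word n => partitionOf w.isPath := by
  intro v w hvw
  by_contra hne
  obtain ⟨lam, hl, hl1⟩ := exists_add_inv 1
  have h := det_wordJoins_mul (n := n) (q := (2 : ℂ)) (by norm_num) (by norm_num) hl hl1
  rw [Matrix.det_zero_of_row_eq hne, zero_mul, eq_comm, Finset.prod_eq_zero_iff] at h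
  · obtain ⟨i, -, hi⟩ := h
    have : ((1 + 2 ^ (2 * i) + (2 ^ (2 * i)) ^ 2 : ℕ) : ℂ) = 0 := by
      push_cast
      exact eq_zero_of_pow_eq_zero hi
    rw [Nat.cast_eq_zero] at this
    simp at this
  · funext u
    simp only [wordJoins]
    rw [show partitionOf v.isPath = partitionOf w.isPath from hvw]

/-- Words correspond to non-crossing partitions. -/
noncomputable def wordEquiv (n : ℕ) [NeZero n] : Word n ≃ NCPartition n :=
  Equiv.ofBijective (fun w => ⟨partitionOf w.isPath, isPartition_partitionOf w.isPath,
    isNonCrossing_partitionOf w.isPath⟩) ⟨fun _ _ h =>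
      partitionOf_word_injective (congrArg Subtype.val h), fun π => by
        obtain ⟨w, hw⟩ := (isRealized π.2.1 π.2.2).exists_word
        exact ⟨w, Subtype.ext hw⟩⟩

lemma det_chromaticJoins {R : Type*} [CommRing R] (x : R) :
    (chromaticJoins n x).det = (wordJoins n x).det := by
  rw [← Matrix.det_submatrix_equiv_self (wordEquiv n)]
  rfl

/-- An identity of integer polynomials may be checked at infinitely many complex numbers; the
nonzero ones are those covered by the spin model. -/
lemma det_chromaticJoins_X : (chromaticJoins n (Polynomial.X ^ 2 : Polynomial ℤ)).det =
    ∏ i ∈ Finset.Icc 1 n,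
      (Polynomial.Chebyshev.C ℤ (i : ℤ) ^ 2 - 1) ^ (2 * n).choose (n - i) := by
  apply Polynomial.map_injective (Int.castRingHom ℂ) Int.cast_injective
  refine Polynomial.eq_of_infinite_eval_eq _ _ ((Set.finite_singleton (0 : ℂ)).infinite_compl.mono
    fun δ hδ => ?_)
  have h := det_wordJoins_complex (n := n) (δ := δ) hδ
  rw [← det_chromaticJoins] at h
  have e : (Polynomial.evalRingHom δ).comp (Polynomial.mapRingHom (Int.castRingHom ℂ))
      (chromaticJoins n (Polynomial.X ^ 2 : Polynomial ℤ)).det =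
      (chromaticJoins n (δ ^ 2)).det := by
    rw [RingHom.map_det]
    congr 1
    ext π π'
    simp [chromaticJoins]
  change Polynomial.eval δ _ = Polynomial.eval δ _
  refine Eq.trans e (h.trans ?_)
  simp [Polynomial.map_prod, Polynomial.eval_prod]

end TypeB


/-- `Polynomial.Chebyshev.C` is the Chebyshev polynomial of the first kind in the normalization
`C 0 = 2`, `C 1 = X`, `C (i + 2) = X * C (i + 1) - C i`. -/
theorem mainTheorem3 {R : Type*} [CommRing R] (n : ℕ) (δ : R) :
    (TypeB.chromaticJoins n (δ ^ 2)).det =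
      ∏ i ∈ Finset.Icc 1 n,
        (((Polynomial.Chebyshev.C R (i : ℤ)).eval δ) ^ 2 - 1) ^ (2 * n).choose (n - i) := by
  rcases Nat.eq_zero_or_pos n with rfl | hn
  -- The circle is empty for `n = 0`, and paths of period zero are of no use; the matrix has the
  -- single entry `x ^ 0`.
  · have : Subsingleton (Setoid (Fin (2 * 0))) := ⟨fun s t => Setoid.ext fun a => a.elim0⟩
    have : Subsingleton (TypeB.NCPartition 0) := inferInstanceAs (Subsingleton (Subtype _))
    let π : TypeB.NCPartition 0 := ⟨⊥, ⟨by rintro K ⟨a, -⟩; exact a.elim0, by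
      rintro K L ⟨⟨a, -⟩, -⟩; exact a.elim0⟩, fun i => i.elim0⟩
    rw [Matrix.det_eq_elem_of_subsingleton _ π, TypeB.chromaticJoins, TypeB.nzbk]
    have : {K | K ∈ (TypeB.join π.1 π.1).classes ∧ ¬ TypeB.IsZeroBlock (TypeB.join π.1 π.1) K} =
        ∅ := by
      ext K
      simp only [Set.mem_ofPred_eq, Set.mem_empty_iff_false, iff_false]
      rintro ⟨⟨a, -⟩, -⟩
      exact a.elim0
    rw [this]
    simp
  · have : NeZero n := ⟨hn.ne'⟩
    have h := congrArg (Polynomial.eval₂RingHom (Int.castRingHom R) δ)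
      (TypeB.det_chromaticJoins_X (n := n))
    rw [RingHom.map_det] at h
    have e : (Polynomial.eval₂RingHom (Int.castRingHom R) δ).mapMatrix
        (TypeB.chromaticJoins n (Polynomial.X ^ 2)) = TypeB.chromaticJoins n (δ ^ 2) := by
      ext π π'
      rw [RingHom.mapMatrix_apply, Matrix.map_apply, TypeB.chromaticJoins, TypeB.chromaticJoins,
        map_pow, map_pow, Polynomial.coe_eval₂RingHom, Polynomial.eval₂_X]
    rw [e] at h
    rw [h, map_prod]
    refine Finset.prod_congr rfl fun i _ => ?_
    rw [map_pow, map_sub, map_pow, map_one, ← Polynomial.Chebyshev.map_C (Int.castRingHom R),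
      Polynomial.eval_map, Polynomial.coe_eval₂RingHom]
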